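/- Setting. Let $\mathcal A$ be a $C^*$-algebra; all left actions on $C^*$-correspondences and all representations of $\mathcal A$ are assumed nondegenerate, and tensor products are interior tensor products. Let $\mathbb E$ be a product system over $\mathbb N_0^2$, given by two $C^*$-correspondences $E_1,E_2$ over $\mathcal A$ and a unitary isomorphism of correspondences $t_{2,1}:E_2\otimes E_1\to E_1\otimes E_2$; put $t_{i,i}=\mathrm{id}$, $t_{1,2}=t_{2,1}^{-1}$, $E=E_1\otimes E_2$. Let $(\sigma,V^{(1)},V^{(2)})$ be an isometric covariant representation of $\mathbb E$ on a Hilbert space $\mathcal H$: $\sigma$ is a representation of $\mathcal A$ on $\mathcal H$, the maps $V^{(i)}:E_i\to B(\mathcal H)$ are linear with $V^{(i)}(a\xi b)=\sigma(a)V^{(i)}(\xi)\sigma(b)$ and $V^{(i)}(\eta)^*V^{(i)}(\xi)=\sigma(\langle\eta,\xi\rangle)$, and the isometries $\widetilde V^{(i)}:E_i\otimes\mathcal H\to\mathcal H$, $\widetilde V^{(i)}(\xi\otimes h)=V^{(i)}(\xi)h$, satisfy $\widetilde V^{(2)}(I_{E_2}\otimes\widetilde V^{(1)})=\widetilde V^{(1)}(I_{E_1}\otimes\widetilde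 V^{(2)})(t_{2,1}\otimes I_{\mathcal H})$. Let $V:E\to B(\mathcal H)$ be the map with $\widetilde V=\widetilde V^{(1)}(I_{E_1}\otimes\widetilde V^{(2)})$, put $\widetilde V_0=I_{\mathcal H}$, $\widetilde V_{n+1}=\widetilde V(I_E\otimes\widetilde V_n):E^{\otimes(n+1)}\otimes\mathcal H\to\mathcal H$, and assume that the representation is pure, that is, $\widetilde V_n\widetilde V_n^*\to0$ strongly. Put $\mathcal W=\mathcal H\ominus\widetilde V(E\otimes\mathcal H)$ and $\mathcal W_i=\mathcal H\ominus\widetilde V^{(i)}(E_i\otimes\mathcal H)$; then $\mathcal W=\mathcal W_1\oplus\widetilde V^{(1)}(E_1\otimes\mathcal W_2)=\widetilde V^{(2)}(E_2\otimes\mathcal W_1)\oplus\mathcal W_2$. Let $\pi=\sigma|_{\mathcal W}$, let $\mathcal F(E)=\bigoplus_{n\ge0}E^{\otimes n}$ (with $E^{\otimes 0}=\mathcal A$), so that $\mathcal F(E)\otimes_\pi\mathcal W=\bigoplus_{n\ge0}E^{\otimes n}\otimes\mathcal W$ with $\mathcal W$ as the summand for $n=0$, and let $(\rho,S)$ be the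 representation of $E$ on $\mathcal F(E)\otimes_\pi\mathcal W$ where $\rho$ is given by the left action and $S(\xi)$ maps $x\in E^{\otimes n}\otimes\mathcal W$ to $\xi\otimes x\in E^{\otimes(n+1)}\otimes\mathcal W$; define $\widetilde S$, $\widetilde S_n$ as for $V$. A unitary $\Pi_V:\mathcal H\to\mathcal F(E)\otimes_\pi\mathcal W$ is the Wold-von Neumann decomposition of $(\sigma,V)$ if $\Pi_V\sigma(a)=\rho(a)\Pi_V$, $\Pi_VV(\xi)=S(\xi)\Pi_V$ and $\Pi_V\widetilde V_n(x)=\widetilde S_n(x)$ for $x\in E^{\otimes n}\otimes\mathcal W$, $n\ge0$. For $i=1,2$ let $t_{i,\mathbf 1}=(I_{E_1}\otimes t_{i,2})(t_{i,1}\otimes I_{E_2}):E_i\otimes E\to E\otimes E_i$, and let $t_i^{(n)}:E_i\otimes E^{\otimes n}\to E^{\otimes n}\otimes E_i$ be the isomorphism obtained by applying $t_{i,\mathbf 1}$ $n$ times. For an isometric bimodule map $\Theta:E_i\to B(\mathcal W,\mathcal F(E)\otimes_\pi\mathcal W)$, that is, a linear map with $\Theta(a\xi b)=\rho(a)\Theta(\xi)\pi(b)$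 for which $\widetilde\Theta:E_i\otimes\mathcal W\to\mathcal F(E)\otimes_\pi\mathcal W$, $\widetilde\Theta(\xi\otimes w)=\Theta(\xi)w$, is an isometry, $M_\Theta(\xi)$ is determined by $$M_\Theta(\xi)\,S_n(\xi_n)w=\widetilde S_n(I_{E^{\otimes n}}\otimes\widetilde\Theta)(t_i^{(n)}\otimes I_{\mathcal W})(\xi\otimes\xi_n\otimes w)\qquad(\xi\in E_i,\ \xi_n\in E^{\otimes n},\ w\in\mathcal W,\ n\ge0).$$ The isometric covariant representation $(\rho,M_{\Theta_1},M_{\Theta_2})$ of $\mathbb E$ is the BCL-representation of $(\sigma,V^{(1)},V^{(2)})$, with BCL symbols $\Theta_1,\Theta_2$ of this kind, if $\Pi_VV^{(i)}(\xi)\Pi_V^*=M_{\Theta_i}(\xi)$ for all $\xi\in E_i$, $i=1,2$. Theorem. For a pure isometric covariant representation $(\sigma,V^{(1)},V^{(2)})$ of $\mathbb E$ as above, the Wold-von Neumann decomposition $\Pi_V$ and the BCL-representation $(\rho,M_{\Theta_1},M_{\Theta_2})$ exist, and the BCL symbols are given by $$\widetilde\Theta_1=(P_{\mathcal W_1}^\perp+\widetilde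 S(I_{E_1\otimes E_2}\otimes P_{\mathcal W_1}))U',\qquad \widetilde\Theta_2=(P_{\mathcal W_2}^\perp+\widetilde S(t_{2,1}\otimes P_{\mathcal W_2}))U,$$ where $P_{\mathcal W_i}$ is the orthogonal projection of $\mathcal W$ onto $\mathcal W_i$, $P_{\mathcal W_i}^\perp=I_{\mathcal W}-P_{\mathcal W_i}$, the first term of each sum is applied to the first component of the value of $U'$, $U$ and the second term to the second component, and where, under the identifications $E_1\otimes\mathcal W=E_1\otimes\mathcal W_2\oplus E_1\otimes\widetilde V^{(2)}(E_2\otimes\mathcal W_1)$ and $E_2\otimes\mathcal W=E_2\otimes\mathcal W_1\oplus E_2\otimes\widetilde V^{(1)}(E_1\otimes\mathcal W_2)$, $$U'=\begin{bmatrix}\widetilde V^{(1)}|_{E_1\otimes\mathcal W_2}&0\\0&I_{E_1}\otimes\widetilde V^{(2)*}|_{\widetilde V^{(2)}(E_2\otimes\mathcal W_1)}\end{bmatrix}:E_1\otimes\mathcal W_2\oplus E_1\otimes\widetilde V^{(2)}(E_2\otimes\mathcal W_1)\to\widetilde V^{(1)}(E_1\otimes\mathcal W_2)\oplus E\otimes\mathcal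 W_1$$ and $$U=\begin{bmatrix}\widetilde V^{(2)}|_{E_2\otimes\mathcal W_1}&0\\0&I_{E_2}\otimes\widetilde V^{(1)*}|_{\widetilde V^{(1)}(E_1\otimes\mathcal W_2)}\end{bmatrix}:E_2\otimes\mathcal W_1\oplus E_2\otimes\widetilde V^{(1)}(E_1\otimes\mathcal W_2)\to\widetilde V^{(2)}(E_2\otimes\mathcal W_1)\oplus E_2\otimes E_1\otimes\mathcal W_2$$ are unitary isomorphisms. -/

import Mathlib

open scoped ComplexOrder InnerProductSpace TensorProduct

universe u v

/-- A C⋆-correspondence over the C⋆-algebra `A`: a (right) Hilbert C⋆-module over `A`, with an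
`A`-valued inner product `ip` that is linear in the second variable, `⟨x, y a⟩ = ⟨x, y⟩ a`, and a
nondegenerate left action of `A` by adjointable operators. Mathlib's `CStarModule` has an inner
product that is `A`-linear for a left action of `A`, hence it is not used here.
Boundedness of the operators `left a` and `right a` is automatic. -/
structure Corr (A : Type v) [NonUnitalCStarAlgebra A] [PartialOrder A] [StarOrderedRing A] where
  carrier : Type u
  [normedAddCommGroup : NormedAddCommGroup carrier]
  [normedSpace : NormedSpace ℂ carrier]
  [completeSpace : CompleteSpace carrier]
  ip : carrier → carrier → A
  ip_add_right : ∀ x y z, ip x (y + z) = ip x y + ip x z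
  ip_smul_right : ∀ (c : ℂ) (x y), ip x (c • y) = c • ip x y
  star_ip : ∀ x y, star (ip x y) = ip y x
  ip_self_nonneg : ∀ x, 0 ≤ ip x x
  norm_sq_eq : ∀ x, ‖x‖ ^ 2 = ‖ip x x‖
  right : Aᵐᵒᵖ →ₙₐ[ℂ] (carrier →L[ℂ] carrier)
  ip_right : ∀ (a : A) (x y), ip x (right (MulOpposite.op a) y) = ip x y * a
  left : A →ₙₐ[ℂ] (carrier →L[ℂ] carrier)
  ip_left : ∀ (a : A) (x y), ip (left a x) y = ip x (left (star a) y)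
  left_nondegenerate :
    (Submodule.span ℂ {x : carrier | ∃ a y, x = left a y}).topologicalClosure = ⊤

/-- An auxiliary fact about C⋆-algebras: `2 ‖a‖ d - d²` represents `a⋆ a`. -/
theorem exists_sqrt_complement {B : Type*} [NonUnitalCStarAlgebra B] (a : B) :
    ∃ d : B, IsSelfAdjoint d ∧ star a * a = ((2 * ‖a‖ : ℝ) : ℂ) • d - d * d := by
  let _ : PartialOrder B := CStarAlgebra.spectralOrder B
  have _ : StarOrderedRing B := CStarAlgebra.spectralOrderedRing B
  set b := star a * a with hb
  have hbsa : IsSelfAdjoint b := IsSelfAdjoint.star_mul_self a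
  set f : ℝ → ℝ := fun x => ‖a‖ - √(‖a‖ ^ 2 - x) with hf
  have hf0 : f 0 = 0 := by simp [hf]
  have hcont : Continuous f := by fun_prop
  refine ⟨cfcₙ f b, cfcₙ_predicate f b, ?_⟩
  rw [Complex.coe_smul, ← cfcₙ_smul (2 * ‖a‖ : ℝ) f b hcont.continuousOn hf0,
    ← cfcₙ_mul f f b hcont.continuousOn hf0 hcont.continuousOn hf0,
    ← cfcₙ_sub _ _ b (by fun_prop) (by simp [hf0]) (by fun_prop) (by simp [hf0])]
  conv_lhs => rw [← cfcₙ_id' ℝ b]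
  refine cfcₙ_congr fun x hx => ?_
  have h1 : ‖x‖ ≤ ‖b‖ := by
    exact NonUnitalIsometricContinuousFunctionalCalculus.norm_quasispectrum_le b hx hbsa
  have h2 : x ≤ ‖a‖ ^ 2 := by
    rw [hb, CStarRing.norm_star_mul_self, ← sq] at h1
    exact (le_abs_self x).trans h1
  have h3 := Real.mul_self_sqrt (sub_nonneg.mpr h2)
  simp only [hf, smul_eq_mul]
  linear_combination h3

section
variable {E F B : Type*} [AddCommGroup E] [Module ℂ E] [AddCommGroup F] [Module ℂ F]
  [AddCommGroup B] [Module ℂ B]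

/-- The sesquilinear form on a tensor product defined by its values on elementary tensors. -/
noncomputable def sesqForm (g : E → F → E → F → B)
    (h1 : ∀ e e' f x y, g (e + e') f x y = g e f x y + g e' f x y)
    (h1' : ∀ (c : ℂ) e f x y, g (c • e) f x y = star c • g e f x y)
    (h2 : ∀ e f f' x y, g e (f + f') x y = g e f x y + g e f' x y)
    (h2' : ∀ (c : ℂ) e f x y, g e (c • f) x y = star c • g e f x y)
    (h3 : ∀ e f x x' y, g e f (x + x') y = g e f x y + g e f x' y)
    (h3' : ∀ (c : ℂ) e f x y, g e f (c • x) y = c • g e f x y)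
    (h4 : ∀ e f x y y', g e f x (y + y') = g e f x y + g e f x y')
    (h4' : ∀ (c : ℂ) e f x y, g e f x (c • y) = c • g e f x y) :
    E ⊗[ℂ] F →ₗ⋆[ℂ] E ⊗[ℂ] F →ₗ[ℂ] B :=
  TensorProduct.lift <| LinearMap.mk₂'ₛₗ (starRingEnd ℂ) (starRingEnd ℂ)
    (fun e f => TensorProduct.lift <| LinearMap.mk₂ ℂ (g e f) (h3 e f) (fun c x y => h3' c e f x y)
      (h4 e f) (fun c x y => h4' c e f x y))
    (fun e e' f => TensorProduct.ext' fun x y => by simp [h1])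
    (fun c e f => TensorProduct.ext' fun x y => by simp [h1'])
    (fun e f f' => TensorProduct.ext' fun x y => by simp [h2])
    (fun c e f => TensorProduct.ext' fun x y => by simp [h2'])
end

/-- A selfadjoint element `x` has a selfadjoint "negative part" `n = z⋆ z`, whose vanishing means
that `x` is of the form `y⋆ y`. -/
theorem exists_negPart {B : Type*} [NonUnitalCStarAlgebra B] (x : B) (hx : IsSelfAdjoint x) :
    ∃ n z : B, IsSelfAdjoint n ∧ n = star z * z ∧ n * x * n = -(n * n * n) ∧
      (n = 0 → ∃ y, x = star y * y) := by
  let _ : PartialOrder B := CStarAlgebra.spectralOrder B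
  have _ : StarOrderedRing B := CStarAlgebra.spectralOrderedRing B
  obtain ⟨z, hz⟩ := CStarAlgebra.nonneg_iff_eq_star_mul_self.mp (CFC.negPart_nonneg x)
  refine ⟨x⁻, z, (CFC.negPart_nonneg x).isSelfAdjoint, hz, ?_, fun h => ?_⟩
  · have h : x⁻ * x = -(x⁻ * x⁻) := by
      nth_rewrite 2 [← CFC.posPart_sub_negPart x hx]
      rw [mul_sub, CFC.negPart_mul_posPart, zero_sub]
    rw [h, neg_mul]
  · exact CStarAlgebra.nonneg_iff_eq_star_mul_self.mp ((CFC.negPart_eq_zero_iff x hx).mp h)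

namespace Corr

variable {A : Type v} [NonUnitalCStarAlgebra A] [PartialOrder A] [StarOrderedRing A]

instance : CoeSort (Corr.{u} A) (Type u) := ⟨Corr.carrier⟩

instance (E : Corr A) : NormedAddCommGroup E := E.normedAddCommGroup
noncomputable instance (E : Corr A) : NormedSpace ℂ E := E.normedSpace
instance (E : Corr A) : CompleteSpace E := E.completeSpace

variable (E : Corr.{u} A)

theorem ip_add_left (x y z : E) : E.ip (x + y) z = E.ip x z + E.ip y z := by
  rw [← E.star_ip, E.ip_add_right, star_add, E.star_ip, E.star_ip]

theorem ip_smul_left (c : ℂ) (x y : E) : E.ip (c • x) y = star c • E.ip x y := by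
  rw [← E.star_ip, E.ip_smul_right, star_smul, E.star_ip]

theorem ip_right_left (a : A) (x y : E) :
    E.ip (E.right (MulOpposite.op a) x) y = star a * E.ip x y := by
  rw [← E.star_ip, E.ip_right, star_mul, E.star_ip]

theorem ip_sum_right {ι : Type*} (s : Finset ι) (f : ι → E) (x : E) :
    E.ip x (∑ i ∈ s, f i) = ∑ i ∈ s, E.ip x (f i) :=
  map_sum (AddMonoidHom.mk' (E.ip x) (E.ip_add_right x)) f s

theorem ip_sum_left {ι : Type*} (s : Finset ι) (f : ι → E) (x : E) :
    E.ip (∑ i ∈ s, f i) x = ∑ i ∈ s, E.ip (f i) x :=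
  map_sum (AddMonoidHom.mk' (fun y => E.ip y x) (fun y z => E.ip_add_left y z x)) f s

theorem ip_left' (a : A) (x y : E) : E.ip x (E.left a y) = E.ip (E.left (star a) x) y := by
  rw [E.ip_left, star_star]

/-- A Gram matrix is of the form `Y⋆ Y`. -/
theorem gram_eq {ι : Type*} [Fintype ι] (x : ι → E) :
    ∃ Y : ι → ι → A, ∀ i j, E.ip (x i) (x j) = ∑ k, star (Y k i) * Y k j := by
  classical
  let X : CStarMatrix ι ι A := CStarMatrix.ofMatrix fun i j => E.ip (x i) (x j)
  have hX : ∀ i j, X i j = E.ip (x i) (x j) := fun i j => rfl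
  have hsa : IsSelfAdjoint X := by
    ext i j
    rw [CStarMatrix.star_apply, hX, hX, E.star_ip]
  obtain ⟨N, Z, hNsa, hZ, h1, hfin⟩ := exists_negPart X hsa
  have hneg : N = 0 := by
    set W := Z * N with hW
    have h2 : N * N * N = star W * W := by
      rw [hW, star_mul, hNsa.star_eq, mul_assoc N (star Z), ← mul_assoc (star Z), ← hZ, mul_assoc]
    have hstar : ∀ i j, star (N i j) = N j i := fun i j => by
      rw [← CStarMatrix.star_apply, hNsa.star_eq]
    have h3 : ∀ k, 0 ≤ (N * X * N) k k := by
      intro k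
      have : (N * X * N) k k = E.ip (∑ i, E.right (MulOpposite.op (N i k)) (x i))
          (∑ i, E.right (MulOpposite.op (N i k)) (x i)) := by
        simp only [CStarMatrix.mul_apply, E.ip_sum_left, E.ip_sum_right, E.ip_right,
          E.ip_right_left, hX, Finset.sum_mul, hstar]
        rw [Finset.sum_comm]
      rw [this]
      exact E.ip_self_nonneg _
    have h4 : ∀ k, (star W * W) k k = ∑ l, star (W l k) * W l k := fun k => by
      simp only [CStarMatrix.mul_apply, CStarMatrix.star_apply]
    have h5 : ∀ l k, W l k = 0 := by
      intro l k
      have ha : (star W * W) k k ≤ 0 := by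
        have := h3 k
        rw [h1, h2, CStarMatrix.neg_apply] at this
        exact neg_nonneg.mp this
      rw [h4] at ha
      have hb : star (W l k) * W l k ≤ 0 :=
        (Finset.single_le_sum (f := fun l => star (W l k) * W l k)
          (fun i _ => star_mul_self_nonneg (W i k)) (Finset.mem_univ l)).trans ha
      exact CStarRing.star_mul_self_eq_zero_iff _ |>.mp (le_antisymm hb (star_mul_self_nonneg _))
    have hW0 : W = 0 := by ext l k; exact h5 l k
    have hNN : N * N = 0 := by
      have : N * N * N = 0 := by rw [h2, hW0, mul_zero]
      apply CStarRing.star_mul_self_eq_zero_iff _ |>.mp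
      rw [star_mul, hNsa.star_eq, ← mul_assoc, this, zero_mul]
    apply CStarRing.star_mul_self_eq_zero_iff _ |>.mp
    rw [hNsa.star_eq, hNN]
  obtain ⟨Y, hY⟩ := hfin hneg
  refine ⟨fun i j => Y i j, fun i j => ?_⟩
  rw [← hX, hY]
  simp only [CStarMatrix.mul_apply, CStarMatrix.star_apply]

/-- The form `‖a‖² ⟨x, y⟩ - ⟨a x, a y⟩` is of the form `⟨c x, c y⟩`. -/
theorem exists_left_complement (a : A) :
    ∃ c : E →ₗ[ℂ] E, ∀ x y,
      E.ip (c x) (c y) = ((‖a‖ ^ 2 : ℝ) : ℂ) • E.ip x y - E.ip (E.left a x) (E.left a y) := by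
  obtain ⟨d, hd, h⟩ := exists_sqrt_complement a
  have hsub : ∀ x y z, E.ip x (y - z) = E.ip x y - E.ip x z := fun x y z => by
    rw [sub_eq_add_neg, ← neg_one_smul ℂ z, E.ip_add_right, E.ip_smul_right, neg_one_smul,
      sub_eq_add_neg]
  have hsub' : ∀ x y z, E.ip (x - y) z = E.ip x z - E.ip y z := fun x y z => by
    rw [sub_eq_add_neg, ← neg_one_smul ℂ y, E.ip_add_left, E.ip_smul_left, star_neg, star_one,
      neg_one_smul, sub_eq_add_neg]
  refine ⟨((‖a‖ : ℝ) : ℂ) • LinearMap.id - (E.left d).toLinearMap, fun x y => ?_⟩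
  have h2 : E.ip (E.left a x) (E.left a y) =
      ((2 * ‖a‖ : ℝ) : ℂ) • E.ip x (E.left d y) - E.ip x (E.left d (E.left d y)) := by
    rw [E.ip_left]
    have : E.left (star a) (E.left a y) = E.left (star a * a) y := by rw [map_mul]; rfl
    rw [this, h, map_sub, map_smul, map_mul]
    simp only [sub_apply, smul_apply, hsub, E.ip_smul_right]
    rfl
  rw [h2]
  simp only [LinearMap.sub_apply, LinearMap.smul_apply, LinearMap.id_apply,
    ContinuousLinearMap.coe_coe, hsub, hsub', E.ip_smul_right, E.ip_smul_left, E.ip_left,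
    hd.star_eq]
  simp only [Complex.star_def, Complex.conj_ofReal, smul_smul]
  push_cast
  module

end Corr

/-- A Hilbert space with a nondegenerate representation `σ` of the C⋆-algebra `A`. -/
structure HilbertRep (A : Type v) [NonUnitalCStarAlgebra A] where
  carrier : Type u
  [normedAddCommGroup : NormedAddCommGroup carrier]
  [innerProductSpace : InnerProductSpace ℂ carrier]
  [completeSpace : CompleteSpace carrier]
  σ : A →⋆ₙₐ[ℂ] (carrier →L[ℂ] carrier)
  nondegenerate :
    (Submodule.span ℂ {x : carrier | ∃ a y, x = σ a y}).topologicalClosure = ⊤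

namespace HilbertRep

instance {A : Type v} [NonUnitalCStarAlgebra A] : CoeSort (HilbertRep.{u} A) (Type u) :=
  ⟨HilbertRep.carrier⟩

variable {A : Type v} [NonUnitalCStarAlgebra A]

noncomputable instance (K : HilbertRep A) : NormedAddCommGroup K := K.normedAddCommGroup
noncomputable instance (K : HilbertRep A) : InnerProductSpace ℂ K := K.innerProductSpace
instance (K : HilbertRep A) : CompleteSpace K := K.completeSpace

theorem inner_σ_left (K : HilbertRep A) (a : A) (x y : K) :
    ⟪K.σ a x, y⟫_ℂ = ⟪x, K.σ (star a) y⟫_ℂ := by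
  rw [map_star, ContinuousLinearMap.star_eq_adjoint, ContinuousLinearMap.adjoint_inner_right]

theorem inner_σ_right (K : HilbertRep A) (a : A) (x y : K) :
    ⟪x, K.σ a y⟫_ℂ = ⟪K.σ (star a) x, y⟫_ℂ := by
  rw [inner_σ_left, star_star]

theorem norm_σ_le (K : HilbertRep A) (a : A) : ‖K.σ a‖ ≤ ‖a‖ :=
  NonUnitalStarAlgHom.norm_apply_le K.σ a

theorem σ_mul_apply (K : HilbertRep A) (a b : A) (x : K) : K.σ (a * b) x = K.σ a (K.σ b x) := by
  rw [map_mul]; rfl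

/-- A bounded operator which intertwines two representations. -/
@[ext]
structure Hom (K L : HilbertRep.{u} A) where
  toCLM : K →L[ℂ] L
  comm : ∀ a x, toCLM (K.σ a x) = L.σ a (toCLM x)

namespace Hom

variable {K L M : HilbertRep.{u} A}

noncomputable instance : CoeFun (Hom K L) (fun _ => K → L) := ⟨fun T => T.toCLM⟩

/-- The identity operator. -/
noncomputable def id (K : HilbertRep.{u} A) : Hom K K where
  toCLM := ContinuousLinearMap.id ℂ K
  comm _ _ := rfl

/-- The composition of intertwiners. -/
noncomputable def comp (T : Hom L M) (S : Hom K L) : Hom K M where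
  toCLM := T.toCLM.comp S.toCLM
  comm a x := by simp [S.comm, T.comm]

/-- The difference of intertwiners. -/
noncomputable def sub (T S : Hom K L) : Hom K L where
  toCLM := T.toCLM - S.toCLM
  comm a x := by simp [S.comm, T.comm]

/-- The Hilbert space adjoint. -/
noncomputable def adjoint (T : Hom K L) : Hom L K where
  toCLM := T.toCLM.adjoint
  comm a x := by
    refine ext_inner_left ℂ fun y => ?_
    rw [ContinuousLinearMap.adjoint_inner_right, inner_σ_right, inner_σ_right,
      ContinuousLinearMap.adjoint_inner_right, T.comm]

end Hom

end HilbertRep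

section HilbertTensor

variable {A : Type v} [NonUnitalCStarAlgebra A] [PartialOrder A] [StarOrderedRing A]

/-- The algebraic tensor product over `ℂ` of a correspondence and a representation space, with the
seminorm of the form `⟨e ⊗ h, e' ⊗ h'⟩ = ⟨h, σ(⟨e, e'⟩) h'⟩`. -/
def PreTensor (E : Corr.{u} A) (K : HilbertRep.{u} A) : Type u := E ⊗[ℂ] K

namespace PreTensor

variable (E : Corr.{u} A) (K L : HilbertRep.{u} A)

/-- The form `⟨e ⊗ h, e' ⊗ h'⟩ = ⟨h, σ(⟨e, e'⟩) h'⟩`. -/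
noncomputable def form : E ⊗[ℂ] K →ₗ⋆[ℂ] E ⊗[ℂ] K →ₗ[ℂ] ℂ :=
  sesqForm (fun e h e' h' => ⟪h, K.σ (E.ip e e') h'⟫_ℂ)
    (fun e e' h x y => by simp [E.ip_add_left])
    (fun c e h x y => by simp [E.ip_smul_left])
    (fun e h h' x y => by simp)
    (fun c e h x y => by simp [mul_comm])
    (fun e h x x' y => by simp [E.ip_add_right])
    (fun c e h x y => by simp [E.ip_smul_right])
    (fun e h x y y' => by simp)
    (fun c e h x y => by simp)

variable {E K L}

theorem form_tmul (e e' : E) (h h' : K) :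
    form E K (e ⊗ₜ h) (e' ⊗ₜ h') = ⟪h, K.σ (E.ip e e') h'⟫_ℂ := rfl

theorem form_conj (z w : E ⊗[ℂ] K) : star (form E K w z) = form E K z w := by
  induction z with
  | zero => simp
  | add z z' hz hz' => simp only [map_add, star_add, LinearMap.add_apply, hz, hz']
  | tmul e h =>
    induction w with
    | zero => simp
    | add w w' hw hw' => simp only [map_add, star_add, LinearMap.add_apply, hw, hw']
    | tmul e' h' =>
      rw [form_tmul, form_tmul, K.inner_σ_right, E.star_ip]
      exact inner_conj_symm _ _

theorem form_sum_self {ι : Type*} [Fintype ι] (x : ι → E) (h : ι → K) (Y : ι → ι → A)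
    (hY : ∀ i j, E.ip (x i) (x j) = ∑ k, star (Y k i) * Y k j) :
    form E K (∑ i, x i ⊗ₜ h i) (∑ i, x i ⊗ₜ h i) =
      ((∑ k, ‖∑ j, K.σ (Y k j) (h j)‖ ^ 2 : ℝ) : ℂ) := by
  have h1 : ∀ i j, ⟪h i, K.σ (E.ip (x i) (x j)) (h j)⟫_ℂ =
      ∑ k, ⟪K.σ (Y k i) (h i), K.σ (Y k j) (h j)⟫_ℂ := fun i j => by
    rw [hY, map_sum, sum_apply, inner_sum]
    refine Finset.sum_congr rfl fun k _ => ?_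
    rw [K.σ_mul_apply, ← K.inner_σ_left]
  have h2 : ∀ k, ((‖∑ j, K.σ (Y k j) (h j)‖ : ℂ)) ^ 2 =
      ∑ j, ∑ i, ⟪K.σ (Y k i) (h i), K.σ (Y k j) (h j)⟫_ℂ := fun k => by
    rw [← Complex.coe_algebraMap, ← inner_self_eq_norm_sq_to_K (𝕜 := ℂ), inner_sum]
    simp_rw [sum_inner]
  simp only [map_sum, LinearMap.sum_apply, form_tmul, h1, Complex.ofReal_sum, Complex.ofReal_pow,
    h2]
  rw [Finset.sum_comm (s := Finset.univ (α := ι))]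
  refine (Finset.sum_congr rfl fun i _ => Finset.sum_comm).trans ?_
  rw [Finset.sum_comm]
  refine Finset.sum_congr rfl fun k _ => ?_
  rw [Finset.sum_comm]

theorem exists_sum (z : E ⊗[ℂ] K) : ∃ (S : Finset (E × K)), z = ∑ i : S, i.1.1 ⊗ₜ[ℂ] i.1.2 := by
  obtain ⟨S, hS⟩ := TensorProduct.exists_finset z
  exact ⟨S, by rw [hS]; exact (Finset.sum_coe_sort S (fun i => i.1 ⊗ₜ[ℂ] i.2)).symm⟩

theorem form_self_nonneg (z : E ⊗[ℂ] K) : 0 ≤ (form E K z z).re := by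
  obtain ⟨S, hS⟩ := exists_sum z
  obtain ⟨Y, hY⟩ := E.gram_eq fun i : S => i.1.1
  rw [hS, form_sum_self _ _ Y hY, Complex.ofReal_re]
  positivity

theorem form_map_le (T : HilbertRep.Hom K L) (z : E ⊗[ℂ] K) :
    (form E L (TensorProduct.map LinearMap.id T.toCLM.toLinearMap z)
      (TensorProduct.map LinearMap.id T.toCLM.toLinearMap z)).re ≤
      ‖T.toCLM‖ ^ 2 * (form E K z z).re := by
  obtain ⟨S, hS⟩ := exists_sum z
  obtain ⟨Y, hY⟩ := E.gram_eq fun i : S => i.1.1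
  have hm : TensorProduct.map LinearMap.id T.toCLM.toLinearMap z =
      ∑ i : S, i.1.1 ⊗ₜ[ℂ] T.toCLM i.1.2 := by
    rw [hS, map_sum]; rfl
  rw [hm, hS, form_sum_self _ _ Y hY, form_sum_self _ _ Y hY, Complex.ofReal_re, Complex.ofReal_re,
    Finset.mul_sum]
  refine Finset.sum_le_sum fun k _ => ?_
  have : ∑ j : S, L.σ (Y k j) (T.toCLM j.1.2) = T.toCLM (∑ j : S, K.σ (Y k j) j.1.2) := by
    rw [map_sum]
    exact Finset.sum_congr rfl fun j _ => (T.comm _ _).symm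
  rw [this, ← mul_pow]
  gcongr
  exact T.toCLM.le_opNorm _

theorem form_left_le (a : A) (z : E ⊗[ℂ] K) :
    (form E K (TensorProduct.map (E.left a).toLinearMap LinearMap.id z)
      (TensorProduct.map (E.left a).toLinearMap LinearMap.id z)).re ≤
      ‖a‖ ^ 2 * (form E K z z).re := by
  obtain ⟨c, hc⟩ := E.exists_left_complement a
  have key : ∀ z w : E ⊗[ℂ] K,
      form E K (TensorProduct.map c LinearMap.id z) (TensorProduct.map c LinearMap.id w) =
        ((‖a‖ ^ 2 : ℝ) : ℂ) * form E K z w -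
        form E K (TensorProduct.map (E.left a).toLinearMap LinearMap.id z)
          (TensorProduct.map (E.left a).toLinearMap LinearMap.id w) := by
    intro z w
    induction z with
    | zero => simp
    | add z z' hz hz' =>
      simp only [map_add, LinearMap.add_apply, hz, hz']; ring
    | tmul e h =>
      induction w with
      | zero => simp
      | add w w' hw hw' => simp only [map_add, hw, hw']; ring
      | tmul e' h' =>
        simp only [TensorProduct.map_tmul, form_tmul, LinearMap.id_apply, hc]
        rw [map_sub, map_smul, sub_apply, smul_apply, inner_sub_right, inner_smul_right]
        rfl
  have h := form_self_nonneg (TensorProduct.map c LinearMap.id z)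
  rw [key, Complex.sub_re, Complex.re_ofReal_mul] at h
  linarith

variable (E K)

/-- The inner product on the algebraic tensor product. -/
@[reducible] noncomputable def core : PreInnerProductSpace.Core ℂ (E ⊗[ℂ] K) where
  inner z w := form E K z w
  conj_inner_symm z w := form_conj z w
  re_inner_nonneg z := form_self_nonneg z
  add_left z w x := by simp
  smul_left z w c := by simp

noncomputable instance : SeminormedAddCommGroup (PreTensor E K) :=
  InnerProductSpace.Core.toSeminormedAddCommGroup (𝕜 := ℂ) (F := E ⊗[ℂ] K) (c := core E K)

noncomputable instance : InnerProductSpace ℂ (PreTensor E K) :=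
  InnerProductSpace.ofCore (core E K)

/-- The canonical map to the completion. -/
noncomputable def emb : E ⊗[ℂ] K →ₗ[ℂ] UniformSpace.Completion (PreTensor E K) :=
  (UniformSpace.Completion.toComplₗᵢ (𝕜 := ℂ) (E := PreTensor E K)).toLinearMap

theorem denseRange_emb : DenseRange (emb E K) :=
  UniformSpace.Completion.denseRange_coe (α := PreTensor E K)

variable {E K}

theorem inner_emb (z w : E ⊗[ℂ] K) : ⟪emb E K z, emb E K w⟫_ℂ = form E K z w :=
  UniformSpace.Completion.inner_coe (E := PreTensor E K) z w

theorem norm_emb_sq (z : E ⊗[ℂ] K) : ‖emb E K z‖ ^ 2 = (form E K z z).re := by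
  rw [← inner_emb, ← inner_self_eq_norm_sq (𝕜 := ℂ)]; rfl

theorem norm_emb_left_le (a : A) (z : E ⊗[ℂ] K) :
    ‖(emb E K ∘ₗ TensorProduct.map (E.left a).toLinearMap LinearMap.id) z‖ ≤
      ‖a‖ * ‖emb E K z‖ := by
  refine le_of_sq_le_sq ?_ (by positivity)
  rw [mul_pow, LinearMap.comp_apply, norm_emb_sq, norm_emb_sq]
  exact form_left_le a z

theorem ext_emb {X : Type*} [TopologicalSpace X] [T2Space X]
    {f g : UniformSpace.Completion (PreTensor E K) → X} (hf : Continuous f) (hg : Continuous g)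
    (h : ∀ z, f (emb E K z) = g (emb E K z)) (x) : f x = g x :=
  (denseRange_emb E K).induction_on x (isClosed_eq hf hg) h

end PreTensor


namespace PreTensor

variable (E : Corr.{u} A) (K : HilbertRep.{u} A)

/-- The operator `e ⊗ k ↦ a e ⊗ k`. -/
noncomputable def leftOp (a : A) :
    UniformSpace.Completion (PreTensor E K) →L[ℂ] UniformSpace.Completion (PreTensor E K) :=
  (emb E K ∘ₗ TensorProduct.map (E.left a).toLinearMap LinearMap.id).extendOfNorm (emb E K)

theorem leftOp_emb (a : A) (z : E ⊗[ℂ] K) : leftOp E K a (emb E K z) =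
    emb E K (TensorProduct.map (E.left a).toLinearMap LinearMap.id z) :=
  LinearMap.extendOfNorm_eq (denseRange_emb E K) ⟨‖a‖, norm_emb_left_le a⟩ z

theorem leftOp_tmul (a : A) (e : E) (k : K) : leftOp E K a (emb E K (e ⊗ₜ k)) =
    emb E K (E.left a e ⊗ₜ k) := leftOp_emb E K a _

variable {E K}

theorem ext_tmul {X : Type*} [TopologicalSpace X] [T2Space X] [AddCommMonoid X] [Module ℂ X]
    {f g : UniformSpace.Completion (PreTensor E K) →L[ℂ] X}
    (h : ∀ e k, f (emb E K (e ⊗ₜ k)) = g (emb E K (e ⊗ₜ k))) : f = g := by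
  refine ContinuousLinearMap.ext fun x => ext_emb f.continuous g.continuous (fun z => ?_) x
  induction z with
  | zero => simp
  | add z w hz hw => simp only [map_add, hz, hw]
  | tmul e k => exact h e k

theorem inner_leftOp (a : A) (x y : UniformSpace.Completion (PreTensor E K)) :
    ⟪leftOp E K a x, y⟫_ℂ = ⟪x, leftOp E K (star a) y⟫_ℂ := by
  refine ext_emb (f := fun x => ⟪leftOp E K a x, y⟫_ℂ)
    (g := fun x => ⟪x, leftOp E K (star a) y⟫_ℂ) (by fun_prop) (by fun_prop) (fun z => ?_) x
  refine ext_emb (f := fun y => ⟪leftOp E K a (emb E K z), y⟫_ℂ)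
    (g := fun y => ⟪emb E K z, leftOp E K (star a) y⟫_ℂ) (by fun_prop) (by fun_prop)
    (fun w => ?_) y
  rw [leftOp_emb, leftOp_emb, inner_emb, inner_emb]
  induction z with
  | zero => simp
  | add z z' hz hz' => simp only [map_add, LinearMap.add_apply, hz, hz']
  | tmul e h =>
    induction w with
    | zero => simp
    | add w w' hw hw' => simp only [map_add, hw, hw']
    | tmul e' h' =>
      simp only [TensorProduct.map_tmul, form_tmul, ContinuousLinearMap.coe_coe, E.ip_left]
      rfl

variable (E K)

/-- The representation `a ↦ (e ⊗ k ↦ a e ⊗ k)`. -/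
noncomputable def rep : A →⋆ₙₐ[ℂ]
    (UniformSpace.Completion (PreTensor E K) →L[ℂ] UniformSpace.Completion (PreTensor E K)) where
  toFun := leftOp E K
  map_smul' c a := ext_tmul fun e k => by
    rw [smul_apply, leftOp_tmul, leftOp_tmul, map_smul, smul_apply, ← TensorProduct.smul_tmul',
      map_smul]
    rfl
  map_zero' := ext_tmul fun e k => by simp [leftOp_tmul]
  map_add' a b := ext_tmul fun e k => by simp [leftOp_tmul, TensorProduct.add_tmul]
  map_mul' a b := ext_tmul fun e k => by simp [leftOp_tmul]
  map_star' a := by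
    rw [ContinuousLinearMap.star_eq_adjoint]
    refine ContinuousLinearMap.ext fun x => ext_inner_left ℂ fun y => ?_
    rw [ContinuousLinearMap.adjoint_inner_right, inner_leftOp]

theorem norm_emb_tmul_le (e : E) (k : K) : ‖emb E K (e ⊗ₜ k)‖ ≤ ‖e‖ * ‖k‖ := by
  refine le_of_sq_le_sq ?_ (by positivity)
  rw [norm_emb_sq, form_tmul, mul_pow, E.norm_sq_eq]
  calc (⟪k, K.σ (E.ip e e) k⟫_ℂ).re ≤ ‖⟪k, K.σ (E.ip e e) k⟫_ℂ‖ := Complex.re_le_norm _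
    _ ≤ ‖k‖ * ‖K.σ (E.ip e e) k‖ := norm_inner_le_norm _ _
    _ ≤ ‖k‖ * (‖E.ip e e‖ * ‖k‖) := by
      gcongr
      exact (K.σ _).le_of_opNorm_le (K.norm_σ_le _) _
    _ = _ := by ring

/-- The bounded bilinear map `(e, k) ↦ e ⊗ k`. -/
noncomputable def tmulL : E →L[ℂ] K →L[ℂ] UniformSpace.Completion (PreTensor E K) :=
  LinearMap.mkContinuous₂ (TensorProduct.mk ℂ E K |>.compr₂ (emb E K)) 1 fun e k => by
    rw [one_mul]; exact norm_emb_tmul_le E K e k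

theorem tmulL_apply (e : E) (k : K) : tmulL E K e k = emb E K (e ⊗ₜ k) := rfl

theorem eq_top_of_tmul_mem (S : Submodule ℂ (UniformSpace.Completion (PreTensor E K)))
    (hS : IsClosed (S : Set (UniformSpace.Completion (PreTensor E K)))) (h : ∀ e k, emb E K (e ⊗ₜ k) ∈ S) : S = ⊤ := by
  refine Submodule.eq_top_iff'.mpr fun x => ?_
  refine (denseRange_emb E K).induction_on (p := fun x => x ∈ S) x (by exact hS) fun z => ?_
  induction z with
  | zero => simp
  | add z w hz hw => rw [map_add]; exact S.add_mem hz hw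
  | tmul e k => exact h e k

end PreTensor

open PreTensor in
/-- The interior tensor product `E ⊗_σ K`, the Hausdorff completion of the algebraic tensor product
for the form `⟨e ⊗ h, e' ⊗ h'⟩ = ⟨h, σ(⟨e, e'⟩) h'⟩`, with the representation `φ(a) ⊗ I_K`, where `φ` is
the left action. -/
noncomputable def Corr.tensorRep (E : Corr.{u} A) (K : HilbertRep.{u} A) : HilbertRep.{u} A where
  carrier := UniformSpace.Completion (PreTensor E K)
  σ := rep E K
  nondegenerate := by
    set S := Submodule.span ℂ {x | ∃ a y, x = rep E K a y} with hS
    refine eq_top_of_tmul_mem E K _ S.isClosed_topologicalClosure fun e k => ?_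
    have h1 : e ∈ (Submodule.span ℂ {x : E | ∃ a y, x = E.left a y}).topologicalClosure := by
      rw [E.left_nondegenerate]; trivial
    have h2 : (Submodule.span ℂ {x : E | ∃ a y, x = E.left a y}).topologicalClosure ≤
        S.topologicalClosure.comap ((tmulL E K).flip k).toLinearMap := by
      refine Submodule.topologicalClosure_minimal _ (Submodule.span_le.mpr ?_)
        (S.isClosed_topologicalClosure.preimage ((tmulL E K).flip k).continuous)
      rintro _ ⟨a, y, rfl⟩
      refine S.le_topologicalClosure (Submodule.subset_span ⟨a, emb E K (y ⊗ₜ k), ?_⟩)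
      exact (leftOp_tmul E K a y k).symm
    exact h2 h1

infixr:70 " ⊗ᴴ " => Corr.tensorRep

namespace Corr

open PreTensor

/-- The canonical map of the algebraic tensor product. -/
noncomputable def inc (E : Corr.{u} A) (K : HilbertRep.{u} A) :
    E ⊗[ℂ] K →ₗ[ℂ] (E ⊗ᴴ K : Type u) := emb E K

/-- The elementary tensor `e ⊗ k`. -/
noncomputable def tmul (E : Corr.{u} A) (K : HilbertRep.{u} A) (e : E) (k : K) :
    (E ⊗ᴴ K : Type u) := E.inc K (e ⊗ₜ k)

variable (E : Corr.{u} A) {K L M : HilbertRep.{u} A}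

theorem denseRange_inc : DenseRange (E.inc K) := denseRange_emb E K

theorem inner_inc (z w : E ⊗[ℂ] K) : ⟪E.inc K z, E.inc K w⟫_ℂ = form E K z w := inner_emb z w

theorem norm_inc_sq (z : E ⊗[ℂ] K) : ‖E.inc K z‖ ^ 2 = (form E K z z).re := norm_emb_sq z

theorem ext_inc {X : Type*} [TopologicalSpace X] [T2Space X]
    {f g : (E ⊗ᴴ K : Type u) → X} (hf : Continuous f) (hg : Continuous g)
    (h : ∀ z, f (E.inc K z) = g (E.inc K z)) (x) : f x = g x :=
  PreTensor.ext_emb hf hg h x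

theorem ext_tmul {X : Type*} [TopologicalSpace X] [T2Space X] [AddCommMonoid X] [Module ℂ X]
    {f g : (E ⊗ᴴ K : Type u) →L[ℂ] X} (h : ∀ e k, f (E.tmul K e k) = g (E.tmul K e k)) : f = g :=
  PreTensor.ext_tmul (E := E) (K := K) h

theorem inner_tmul (e e' : E) (k k' : K) :
    ⟪E.tmul K e k, E.tmul K e' k'⟫_ℂ = ⟪k, K.σ (E.ip e e') k'⟫_ℂ := inner_emb _ _

theorem σ_tmul (a : A) (e : E) (k : K) :
    (E ⊗ᴴ K).σ a (E.tmul K e k) = E.tmul K (E.left a e) k := leftOp_tmul E K a e k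

theorem tensor_hom_ext {f g : HilbertRep.Hom (E ⊗ᴴ K) L}
    (h : ∀ e k, f (E.tmul K e k) = g (E.tmul K e k)) : f = g :=
  HilbertRep.Hom.ext (E.ext_tmul h)

theorem norm_map_le (T : HilbertRep.Hom K L) (z : E ⊗[ℂ] K) :
    ‖(E.inc L ∘ₗ TensorProduct.map LinearMap.id T.toCLM.toLinearMap) z‖ ≤
      ‖T.toCLM‖ * ‖E.inc K z‖ := by
  refine le_of_sq_le_sq ?_ (by positivity)
  rw [mul_pow, LinearMap.comp_apply, norm_inc_sq, norm_inc_sq]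
  exact form_map_le T z

/-- The bounded operator `I_E ⊗ T`. -/
noncomputable def mapCLM (T : HilbertRep.Hom K L) : (E ⊗ᴴ K : Type u) →L[ℂ] (E ⊗ᴴ L : Type u) :=
  (E.inc L ∘ₗ TensorProduct.map LinearMap.id T.toCLM.toLinearMap).extendOfNorm (E.inc K)

theorem mapCLM_tmul (T : HilbertRep.Hom K L) (e : E) (k : K) :
    E.mapCLM T (E.tmul K e k) = E.tmul L e (T k) :=
  LinearMap.extendOfNorm_eq (E.denseRange_inc) ⟨_, E.norm_map_le T⟩ (e ⊗ₜ k)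

/-- `I_E ⊗ T`. -/
noncomputable def map (T : HilbertRep.Hom K L) : HilbertRep.Hom (E ⊗ᴴ K) (E ⊗ᴴ L) where
  toCLM := E.mapCLM T
  comm a := DFunLike.congr_fun <| E.ext_tmul
    (f := (E.mapCLM T).comp ((E ⊗ᴴ K).σ a)) (g := ((E ⊗ᴴ L).σ a).comp (E.mapCLM T)) fun e k => by
      simp only [ContinuousLinearMap.comp_apply, mapCLM_tmul, σ_tmul]

theorem map_tmul (T : HilbertRep.Hom K L) (e : E) (k : K) :
    E.map T (E.tmul K e k) = E.tmul L e (T k) := E.mapCLM_tmul T e k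

end Corr

/-- An isometric bimodule map `V : E → B(K, L)`: a linear map with `V(a ξ) = σ(a) V(ξ)`,
`V(ξ a) = V(ξ) σ(a)` and `V(η)* V(ξ) = σ(⟨η, ξ⟩)`, where the last condition says that the map
`Ṽ : E ⊗ K → L`, `Ṽ(ξ ⊗ k) = V(ξ) k`, is an isometry. For `K = L = H` the pair `(σ, V)` is an isometric
covariant representation of `E` on `H`. Complete boundedness of `V` is automatic. -/
structure IsoCov (E : Corr.{u} A) (K L : HilbertRep.{u} A) where
  toFun : E →ₗ[ℂ] (K →L[ℂ] L)
  map_left : ∀ a ξ, toFun (E.left a ξ) = L.σ a ∘L toFun ξ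
  map_right : ∀ a ξ, toFun (E.right (MulOpposite.op a) ξ) = toFun ξ ∘L K.σ a
  isometric : ∀ η ξ, (toFun η).adjoint ∘L toFun ξ = K.σ (E.ip η ξ)

namespace IsoCov

open PreTensor Corr

variable {E : Corr.{u} A} {K L M : HilbertRep.{u} A}

noncomputable instance : CoeFun (IsoCov E K L) (fun _ => E → K →L[ℂ] L) := ⟨fun V => V.toFun⟩

theorem inner_apply (V : IsoCov E K L) (η ξ : E) (k k' : K) :
    ⟪V η k, V ξ k'⟫_ℂ = ⟪k, K.σ (E.ip η ξ) k'⟫_ℂ := by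
  rw [← V.isometric, ContinuousLinearMap.comp_apply, ContinuousLinearMap.adjoint_inner_right]

/-- `Ṽ` on the algebraic tensor product. -/
noncomputable def pre (V : IsoCov E K L) : E ⊗[ℂ] K →ₗ[ℂ] L :=
  TensorProduct.lift ((ContinuousLinearMap.coeLM ℂ).comp V.toFun)

theorem pre_tmul (V : IsoCov E K L) (e : E) (k : K) : V.pre (e ⊗ₜ k) = V e k := rfl

theorem inner_pre (V : IsoCov E K L) (z w : E ⊗[ℂ] K) :
    ⟪V.pre z, V.pre w⟫_ℂ = form E K z w := by
  induction z with
  | zero => simp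
  | add z z' hz hz' => simp only [map_add, LinearMap.add_apply, inner_add_left, hz, hz']
  | tmul e h =>
    induction w with
    | zero => simp
    | add w w' hw hw' => simp only [map_add, inner_add_right, hw, hw']
    | tmul e' h' => rw [pre_tmul, pre_tmul, form_tmul, inner_apply]

theorem norm_pre (V : IsoCov E K L) (z : E ⊗[ℂ] K) : ‖V.pre z‖ ≤ 1 * ‖E.inc K z‖ := by
  rw [one_mul]
  refine le_of_sq_le_sq (le_of_eq ?_) (by positivity)
  rw [norm_inc_sq, ← V.inner_pre, ← inner_self_eq_norm_sq (𝕜 := ℂ)]; rfl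

/-- `Ṽ` as a bounded operator. -/
noncomputable def tildeCLM (V : IsoCov E K L) : (E ⊗ᴴ K : Type u) →L[ℂ] L :=
  V.pre.extendOfNorm (E.inc K)

theorem tildeCLM_inc (V : IsoCov E K L) (z) : V.tildeCLM (E.inc K z) = V.pre z :=
  LinearMap.extendOfNorm_eq (E.denseRange_inc) ⟨1, V.norm_pre⟩ z

theorem tildeCLM_tmul (V : IsoCov E K L) (e : E) (k : K) : V.tildeCLM (E.tmul K e k) = V e k :=
  V.tildeCLM_inc _

/-- The isometry `Ṽ : E ⊗ K → L`, `Ṽ(ξ ⊗ k) = V(ξ) k`. -/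
noncomputable def tilde (V : IsoCov E K L) : HilbertRep.Hom (E ⊗ᴴ K) L where
  toCLM := V.tildeCLM
  comm a := DFunLike.congr_fun <| E.ext_tmul
    (f := V.tildeCLM.comp ((E ⊗ᴴ K).σ a)) (g := (L.σ a).comp V.tildeCLM) fun e k => by
      simp only [ContinuousLinearMap.comp_apply, tildeCLM_tmul, σ_tmul, V.map_left]

theorem tilde_tmul (V : IsoCov E K L) (e : E) (k : K) : V.tilde (E.tmul K e k) = V e k :=
  V.tildeCLM_tmul e k

theorem inner_tilde (V : IsoCov E K L) (x y : (E ⊗ᴴ K : Type u)) :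
    ⟪V.tilde x, V.tilde y⟫_ℂ = ⟪x, y⟫_ℂ := by
  refine E.ext_inc (f := fun x => ⟪V.tildeCLM x, V.tildeCLM y⟫_ℂ)
    (g := fun x => ⟪x, y⟫_ℂ) (by fun_prop) (by fun_prop) (fun z => ?_) x
  refine E.ext_inc (f := fun y => ⟪V.tildeCLM (E.inc K z), V.tildeCLM y⟫_ℂ)
    (g := fun y => ⟪E.inc K z, y⟫_ℂ) (by fun_prop) (by fun_prop)
    (fun w => ?_) y
  rw [tildeCLM_inc, tildeCLM_inc, inner_inc, inner_pre]

end IsoCov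

open PreTensor in
/-- The isometric bimodule map `E → B(K, E ⊗ K)`, `ξ ↦ (k ↦ ξ ⊗ k)`. -/
noncomputable def Corr.creation (E : Corr.{u} A) (K : HilbertRep.{u} A) : IsoCov E K (E ⊗ᴴ K) where
  toFun := (tmulL E K).toLinearMap
  map_left a ξ := ContinuousLinearMap.ext fun k => (E.σ_tmul a ξ k).symm
  map_right a ξ := ContinuousLinearMap.ext fun k => ext_inner_left ℂ fun x => by
    refine E.ext_inc (f := fun x => ⟪x, E.inc K (E.right (MulOpposite.op a) ξ ⊗ₜ k)⟫_ℂ)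
      (g := fun x => ⟪x, E.inc K (ξ ⊗ₜ K.σ a k)⟫_ℂ) (by fun_prop) (by fun_prop) (fun z => ?_) x
    rw [inner_inc, inner_inc]
    induction z with
    | zero => simp
    | add z z' hz hz' => simp only [map_add, LinearMap.add_apply, hz, hz']
    | tmul e h => rw [form_tmul, form_tmul, E.ip_right, K.σ_mul_apply]
  isometric η ξ := ContinuousLinearMap.ext fun k => ext_inner_left ℂ fun x => by
    rw [ContinuousLinearMap.comp_apply, ContinuousLinearMap.adjoint_inner_right]
    exact E.inner_tmul η ξ x k

end HilbertTensor

section ModuleTensor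

variable {A : Type v} [NonUnitalCStarAlgebra A] [PartialOrder A] [StarOrderedRing A]

/-- Cauchy-Schwarz inequality for `A`-valued positive semidefinite sesquilinear forms. -/
theorem norm_form_sq_le {P : Type*} [AddCommGroup P] [Module ℂ P] (q : P →ₗ⋆[ℂ] P →ₗ[ℂ] A)
    (hstar : ∀ z w, star (q z w) = q w z) (hpos : ∀ z, 0 ≤ q z z)
    (hright : ∀ (a : A) (w : P), ∃ w', ∀ z, q z w' = q z w * a) (z w : P) :
    ‖q z w‖ ^ 2 ≤ ‖q z z‖ * ‖q w w‖ := by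
  set b := q w z with hb
  have hzw : q z w = star b := (hstar w z).symm
  have key : ∀ t : ℝ, 0 ≤ t → (2 * t - t ^ 2 * ‖q w w‖) * ‖b‖ ^ 2 ≤ ‖q z z‖ := by
    intro t ht
    rcases le_or_gt 0 (2 * t - t ^ 2 * ‖q w w‖) with hc | hc
    · obtain ⟨w', hw'⟩ := hright ((t : ℂ) • b) w
      have hst : star ((t : ℂ) • b) = (t : ℂ) • star b := by
        rw [star_smul, Complex.star_def, Complex.conj_ofReal]
      have h1 : q z w' = t • (star b * b) := by
        rw [hw', hzw, mul_smul_comm, Complex.coe_smul]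
      have h2 : q w' z = t • (star b * b) := by
        rw [← hstar, h1, star_smul, star_mul, star_star]; simp
      have h3 : q w' w' = (t ^ 2) • (star b * q w w * b) := by
        have h : q w' w = (t : ℂ) • star b * q w w := by
          rw [← hstar, hw', star_mul, hst, hstar w w]
        rw [hw', h]
        simp only [smul_mul_assoc, mul_smul_comm, Complex.coe_smul, smul_smul, sq]
      have h4 := hpos (w' - z)
      have h5 : q (w' - z) (w' - z) =
          (t ^ 2) • (star b * q w w * b) - t • (star b * b) - (t • (star b * b) - q z z) := by
        rw [map_sub q, LinearMap.sub_apply, map_sub, map_sub, h1, h2, h3]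
      have h6 : (t ^ 2) • (star b * q w w * b) ≤ (t ^ 2) • (‖q w w‖ • (star b * b)) :=
        smul_le_smul_of_nonneg_left
          (CStarAlgebra.star_left_conjugate_le_norm_smul (hb := (hpos w).isSelfAdjoint))
          (by positivity)
      have h7 : (2 * t - t ^ 2 * ‖q w w‖) • (star b * b) ≤ q z z := by
        rw [h5] at h4
        have h8 : (2 * t - t ^ 2 * ‖q w w‖) • (star b * b) =
          t • (star b * b) + t • (star b * b) - (t ^ 2) • (‖q w w‖ • (star b * b)) := by module
        have h9 : (0 : A) ≤ (t ^ 2) • (‖q w w‖ • (star b * b)) - t • (star b * b)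
            - (t • (star b * b) - q z z) := h4.trans (by gcongr)
        rw [h8]
        have h10 := add_le_add_right h9 (t • (star b * b) + t • (star b * b)
          - (t ^ 2) • (‖q w w‖ • (star b * b)))
        refine (le_of_eq ?_).trans (h10.trans (le_of_eq ?_)) <;> abel
      have h8 := CStarAlgebra.norm_le_norm_of_nonneg_of_le
        (smul_nonneg hc (star_mul_self_nonneg b)) h7
      rwa [norm_smul, Real.norm_of_nonneg hc, CStarRing.norm_star_mul_self, ← sq] at h8
    · exact (mul_nonpos_of_nonpos_of_nonneg hc.le (by positivity)).trans (norm_nonneg _)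
  rw [hzw, norm_star]
  rcases (norm_nonneg (q w w)).eq_or_lt with h0 | h0
  · rw [← h0] at key ⊢
    by_contra! hcon
    rw [mul_zero] at hcon
    have := key ((‖q z z‖ + 1) / ‖b‖ ^ 2) (by positivity)
    rw [mul_zero, sub_zero, mul_assoc, div_mul_cancel₀ _ hcon.ne'] at this
    linarith [norm_nonneg (q z z)]
  · have := key (1 / ‖q w w‖) (by positivity)
    have h1 : (2 * (1 / ‖q w w‖) - (1 / ‖q w w‖) ^ 2 * ‖q w w‖) = 1 / ‖q w w‖ := by
      field_simp; ring
    rw [h1, one_div_mul_eq_div, div_le_iff₀ h0] at this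
    exact this

namespace Corr

theorem norm_ip_le (F : Corr.{u} A) (x y : F) : ‖F.ip x y‖ ≤ ‖x‖ * ‖y‖ := by
  refine le_of_sq_le_sq ?_ (by positivity)
  rw [mul_pow, F.norm_sq_eq, F.norm_sq_eq]
  exact norm_form_sq_le (LinearMap.mk₂'ₛₗ (starRingEnd ℂ) (RingHom.id ℂ) F.ip
    F.ip_add_left F.ip_smul_left F.ip_add_right F.ip_smul_right) F.star_ip F.ip_self_nonneg
    (fun a w => ⟨_, fun z => F.ip_right a z w⟩) x y

theorem norm_left_le (F : Corr.{u} A) (a : A) (x : F) : ‖F.left a x‖ ≤ ‖a‖ * ‖x‖ := by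
  obtain ⟨c, hc⟩ := F.exists_left_complement a
  refine le_of_sq_le_sq ?_ (by positivity)
  have h := F.ip_self_nonneg (c x)
  rw [hc, sub_nonneg] at h
  have h1 := CStarAlgebra.norm_le_norm_of_nonneg_of_le (F.ip_self_nonneg _) h
  rwa [norm_smul, ← F.norm_sq_eq, ← F.norm_sq_eq, Complex.norm_real,
    Real.norm_of_nonneg (by positivity), ← mul_pow] at h1

end Corr

/-- The algebraic tensor product of the underlying vector spaces of two correspondences. -/
def PreTensorC (E F : Corr.{u} A) : Type u := E ⊗[ℂ] F

namespace PreTensorC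

variable (E F : Corr.{u} A)

/-- The `A`-valued form `⟨e ⊗ f, e' ⊗ f'⟩ = ⟨f, ⟨e, e'⟩ f'⟩`. -/
noncomputable def form : E ⊗[ℂ] F →ₗ⋆[ℂ] E ⊗[ℂ] F →ₗ[ℂ] A :=
  sesqForm (fun e f e' f' => F.ip f (F.left (E.ip e e') f'))
    (fun e e' h x y => by simp [E.ip_add_left, F.ip_add_right])
    (fun c e h x y => by simp [E.ip_smul_left, F.ip_smul_right])
    (fun e h h' x y => by simp [F.ip_add_left])
    (fun c e h x y => by simp [F.ip_smul_left])
    (fun e h x x' y => by simp [E.ip_add_right, F.ip_add_right])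
    (fun c e h x y => by simp [E.ip_smul_right, F.ip_smul_right])
    (fun e h x y y' => by simp [F.ip_add_right])
    (fun c e h x y => by simp [F.ip_smul_right])

variable {E F}

theorem form_tmul (e e' : E) (h h' : F) :
    form E F (e ⊗ₜ h) (e' ⊗ₜ h') = F.ip h (F.left (E.ip e e') h') := rfl

theorem star_form (z w : E ⊗[ℂ] F) : star (form E F z w) = form E F w z := by
  induction z with
  | zero => simp
  | add z z' hz hz' => simp only [map_add, star_add, LinearMap.add_apply, hz, hz']
  | tmul e h =>
    induction w with
    | zero => simp
    | add w w' hw hw' => simp only [map_add, star_add, LinearMap.add_apply, hw, hw']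
    | tmul e' h' => rw [form_tmul, form_tmul, F.star_ip, F.ip_left, E.star_ip]

theorem form_right (a : A) (z w : E ⊗[ℂ] F) :
    form E F z (TensorProduct.map LinearMap.id (F.right (MulOpposite.op a)).toLinearMap w) =
      form E F z w * a := by
  induction z with
  | zero => simp
  | add z z' hz hz' => simp only [map_add, LinearMap.add_apply, hz, hz', add_mul]
  | tmul e h =>
    induction w with
    | zero => simp
    | add w w' hw hw' => simp only [map_add, hw, hw', add_mul]
    | tmul e' h' =>
      rw [TensorProduct.map_tmul, form_tmul, form_tmul, ContinuousLinearMap.coe_coe,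
        F.ip_left', F.ip_right, F.ip_left']
      rfl

theorem form_left (a : A) (z w : E ⊗[ℂ] F) :
    form E F (TensorProduct.map (E.left a).toLinearMap LinearMap.id z) w =
      form E F z (TensorProduct.map (E.left (star a)).toLinearMap LinearMap.id w) := by
  induction z with
  | zero => simp
  | add z z' hz hz' => simp only [map_add, LinearMap.add_apply, hz, hz']
  | tmul e h =>
    induction w with
    | zero => simp
    | add w w' hw hw' => simp only [map_add, hw, hw']
    | tmul e' h' =>
      simp only [TensorProduct.map_tmul, form_tmul, ContinuousLinearMap.coe_coe, E.ip_left]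
      rfl

theorem form_self_nonneg (z : E ⊗[ℂ] F) : 0 ≤ form E F z z := by
  obtain ⟨S, hS⟩ := TensorProduct.exists_finset z
  rw [← Finset.sum_coe_sort] at hS
  obtain ⟨Y, hY⟩ := E.gram_eq fun i : S => i.1.1
  have : form E F z z = ∑ k, F.ip (∑ j, F.left (Y k j) j.1.2) (∑ j, F.left (Y k j) j.1.2) := by
    rw [hS]
    have h1 : ∀ i j : S, F.ip i.1.2 (F.left (E.ip i.1.1 j.1.1) j.1.2) =
        ∑ k, F.ip (F.left (Y k i) i.1.2) (F.left (Y k j) j.1.2) := fun i j => by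
      rw [hY, map_sum, sum_apply, F.ip_sum_right]
      refine Finset.sum_congr rfl fun k _ => ?_
      rw [F.ip_left, map_mul]; rfl
    simp only [map_sum, LinearMap.sum_apply, form_tmul, h1, F.ip_sum_right, F.ip_sum_left]
    refine (Finset.sum_congr rfl fun i _ => Finset.sum_comm).trans ?_
    rw [Finset.sum_comm]
  rw [this]
  exact Finset.sum_nonneg fun k _ => F.ip_self_nonneg _

theorem form_left_le (a : A) (z : E ⊗[ℂ] F) :
    form E F (TensorProduct.map (E.left a).toLinearMap LinearMap.id z)
      (TensorProduct.map (E.left a).toLinearMap LinearMap.id z) ≤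
      ((‖a‖ ^ 2 : ℝ) : ℂ) • form E F z z := by
  obtain ⟨c, hc⟩ := E.exists_left_complement a
  have key : ∀ z w : E ⊗[ℂ] F,
      form E F (TensorProduct.map c LinearMap.id z) (TensorProduct.map c LinearMap.id w) =
        ((‖a‖ ^ 2 : ℝ) : ℂ) • form E F z w -
        form E F (TensorProduct.map (E.left a).toLinearMap LinearMap.id z)
          (TensorProduct.map (E.left a).toLinearMap LinearMap.id w) := by
    intro z w
    induction z with
    | zero => simp
    | add z z' hz hz' =>
      simp only [map_add, LinearMap.add_apply, hz, hz']; module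
    | tmul e h =>
      induction w with
      | zero => simp
      | add w w' hw hw' => simp only [map_add, hw, hw']; module
      | tmul e' h' =>
        simp only [TensorProduct.map_tmul, form_tmul, LinearMap.id_apply, hc]
        have hsub : ∀ x y z, F.ip x (y - z) = F.ip x y - F.ip x z := fun x y z => by
          rw [sub_eq_add_neg, ← neg_one_smul ℂ z, F.ip_add_right, F.ip_smul_right, neg_one_smul,
            sub_eq_add_neg]
        rw [map_sub, map_smul, sub_apply, smul_apply, hsub, F.ip_smul_right]
        rfl
  have h := form_self_nonneg (TensorProduct.map c LinearMap.id z)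
  rw [key, sub_nonneg] at h
  exact h

theorem norm_form_sq_le (z w : E ⊗[ℂ] F) :
    ‖form E F z w‖ ^ 2 ≤ ‖form E F z z‖ * ‖form E F w w‖ :=
  _root_.norm_form_sq_le (form E F) star_form form_self_nonneg
    (fun a w => ⟨_, fun z => form_right a z w⟩) z w

theorem form_smul_smul (c : ℂ) (z : E ⊗[ℂ] F) :
    form E F (c • z) (c • z) = c • (star c • form E F z z) := by
  rw [map_smul, map_smulₛₗ, LinearMap.smul_apply]; rfl

theorem sqrt_form_smul_le (c : ℂ) (z : E ⊗[ℂ] F) :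
    √‖form E F (c • z) (c • z)‖ ≤ ‖c‖ * √‖form E F z z‖ := by
  rw [form_smul_smul, norm_smul, norm_smul, norm_star, ← mul_assoc, ← sq,
    Real.sqrt_mul (by positivity), Real.sqrt_sq (norm_nonneg _)]

theorem norm_form_le (z w : E ⊗[ℂ] F) :
    ‖form E F z w‖ ≤ √‖form E F z z‖ * √‖form E F w w‖ := by
  rw [← Real.sqrt_mul (norm_nonneg _)]
  exact Real.le_sqrt_of_sq_le (norm_form_sq_le z w)

variable (E F)

noncomputable instance : SeminormedAddCommGroup (PreTensorC E F) :=
  AddGroupSeminorm.toSeminormedAddCommGroup (E := E ⊗[ℂ] F)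
    { toFun := fun z => √‖form E F z z‖
      map_zero' := by simp
      neg' := fun x => by simp
      add_le' := fun z w => by
        refine Real.sqrt_le_iff.mpr ⟨by positivity, ?_⟩
        have h1 := norm_form_le z w
        have h2 := norm_form_le w z
        have h3 := Real.sq_sqrt (norm_nonneg (form E F z z))
        have h4 := Real.sq_sqrt (norm_nonneg (form E F w w))
        calc ‖form E F (z + w) (z + w)‖
            = ‖form E F z z + form E F z w + (form E F w z + form E F w w)‖ := by
              simp only [map_add, LinearMap.add_apply]; congr 1; abel
          _ ≤ ‖form E F z z‖ + ‖form E F z w‖ + (‖form E F w z‖ + ‖form E F w w‖) :=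
              (norm_add_le _ _).trans (add_le_add (norm_add_le _ _) (norm_add_le _ _))
          _ ≤ (√‖form E F z z‖ + √‖form E F w w‖) ^ 2 := by nlinarith }

theorem norm_def (z : PreTensorC E F) : ‖z‖ = √‖form E F z z‖ := rfl

noncomputable instance : Module ℂ (PreTensorC E F) := inferInstanceAs (Module ℂ (E ⊗[ℂ] F))

noncomputable instance : NormedSpace ℂ (PreTensorC E F) where
  norm_smul_le := sqrt_form_smul_le

/-- The canonical map to the completion. -/
noncomputable def emb : E ⊗[ℂ] F →ₗ[ℂ] UniformSpace.Completion (PreTensorC E F) :=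
  (UniformSpace.Completion.toComplₗᵢ (𝕜 := ℂ) (E := PreTensorC E F)).toLinearMap

theorem denseRange_emb : DenseRange (emb E F) :=
  UniformSpace.Completion.denseRange_coe (α := PreTensorC E F)

variable {E F}

theorem norm_emb (z : E ⊗[ℂ] F) : ‖emb E F z‖ = √‖form E F z z‖ :=
  UniformSpace.Completion.norm_coe (E := PreTensorC E F) z

theorem norm_form_le_emb (z w : E ⊗[ℂ] F) : ‖form E F z w‖ ≤ ‖emb E F z‖ * ‖emb E F w‖ := by
  rw [norm_emb, norm_emb]; exact norm_form_le z w

theorem ext_emb {X : Type*} [TopologicalSpace X] [T2Space X]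
    {f g : UniformSpace.Completion (PreTensorC E F) → X} (hf : Continuous f) (hg : Continuous g)
    (h : ∀ z, f (emb E F z) = g (emb E F z)) (x) : f x = g x :=
  (denseRange_emb E F).induction_on x (isClosed_eq hf hg) h

theorem ext_tmul {X : Type*} [TopologicalSpace X] [T2Space X] [AddCommMonoid X] [Module ℂ X]
    {f g : UniformSpace.Completion (PreTensorC E F) →L[ℂ] X}
    (h : ∀ e k, f (emb E F (e ⊗ₜ k)) = g (emb E F (e ⊗ₜ k))) : f = g := by
  refine ContinuousLinearMap.ext fun x => ext_emb f.continuous g.continuous (fun z => ?_) x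
  induction z with
  | zero => simp
  | add z w hz hw => simp only [map_add, hz, hw]
  | tmul e k => exact h e k

variable (E F)

/-- The inner product with an element of the algebraic tensor product. -/
noncomputable def ipAux (z : E ⊗[ℂ] F) : UniformSpace.Completion (PreTensorC E F) →L[ℂ] A :=
  (form E F z).extendOfNorm (emb E F)

theorem ipAux_emb (z w : E ⊗[ℂ] F) : ipAux E F z (emb E F w) = form E F z w :=
  LinearMap.extendOfNorm_eq (denseRange_emb E F) ⟨‖emb E F z‖, norm_form_le_emb z⟩ w

/-- The inner product, before extension in the first variable. -/
noncomputable def ipAuxₗ :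
    E ⊗[ℂ] F →ₗ⋆[ℂ] (UniformSpace.Completion (PreTensorC E F) →L[ℂ] A) where
  toFun := ipAux E F
  map_add' z z' := ContinuousLinearMap.ext fun x =>
    ext_emb (ipAux E F (z + z')).continuous (ipAux E F z + ipAux E F z').continuous
      (fun w => by simp [ipAux_emb]) x
  map_smul' c z := ContinuousLinearMap.ext fun x =>
    ext_emb (ipAux E F (c • z)).continuous (starRingEnd ℂ c • ipAux E F z).continuous
      (fun w => by simp [ipAux_emb]) x

/-- The `A`-valued inner product on the completion. -/
noncomputable def ipL : UniformSpace.Completion (PreTensorC E F) →L⋆[ℂ]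
    UniformSpace.Completion (PreTensorC E F) →L[ℂ] A :=
  (ipAuxₗ E F).extendOfNorm (emb E F)

variable {E F}

theorem ipL_emb (z w : E ⊗[ℂ] F) : ipL E F (emb E F z) (emb E F w) = form E F z w := by
  have : ipL E F (emb E F z) = ipAuxₗ E F z :=
    LinearMap.extendOfNorm_eq (denseRange_emb E F) ⟨1, fun z => by
      rw [one_mul]
      exact LinearMap.opNorm_extendOfNorm_le (denseRange_emb E F) (norm_nonneg _)
        (norm_form_le_emb z)⟩ z
  rw [this]
  exact ipAux_emb E F z w

theorem norm_emb_sq (z : E ⊗[ℂ] F) : ‖emb E F z‖ ^ 2 = ‖form E F z z‖ := by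
  rw [norm_emb, Real.sq_sqrt (norm_nonneg _)]

theorem norm_emb_left_le (a : A) (z : E ⊗[ℂ] F) :
    ‖(emb E F ∘ₗ TensorProduct.map (E.left a).toLinearMap LinearMap.id) z‖ ≤
      ‖a‖ * ‖emb E F z‖ := by
  refine le_of_sq_le_sq ?_ (by positivity)
  rw [mul_pow, LinearMap.comp_apply, norm_emb_sq, norm_emb_sq]
  refine (CStarAlgebra.norm_le_norm_of_nonneg_of_le (form_self_nonneg _)
    (form_left_le a z)).trans (le_of_eq ?_)
  rw [norm_smul, Complex.norm_real, Real.norm_of_nonneg (by positivity)]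

theorem norm_emb_right_le (a : A) (z : E ⊗[ℂ] F) :
    ‖(emb E F ∘ₗ TensorProduct.map LinearMap.id (F.right (MulOpposite.op a)).toLinearMap) z‖ ≤
      ‖a‖ * ‖emb E F z‖ := by
  refine le_of_sq_le_sq ?_ (by positivity)
  rw [mul_pow, LinearMap.comp_apply, norm_emb_sq, norm_emb_sq, form_right, ← star_form,
    form_right, star_mul]
  calc _ ≤ ‖star a‖ * ‖star (form E F z z)‖ * ‖a‖ :=
        (norm_mul_le _ _).trans (by gcongr; exact norm_mul_le _ _)
    _ = _ := by rw [norm_star, norm_star]; ring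

variable (E F)

/-- The operator `e ⊗ f ↦ a e ⊗ f`. -/
noncomputable def leftOp (a : A) :
    UniformSpace.Completion (PreTensorC E F) →L[ℂ] UniformSpace.Completion (PreTensorC E F) :=
  (emb E F ∘ₗ TensorProduct.map (E.left a).toLinearMap LinearMap.id).extendOfNorm (emb E F)

/-- The operator `e ⊗ f ↦ e ⊗ f a`. -/
noncomputable def rightOp (a : A) :
    UniformSpace.Completion (PreTensorC E F) →L[ℂ] UniformSpace.Completion (PreTensorC E F) :=
  (emb E F ∘ₗ TensorProduct.map LinearMap.id
    (F.right (MulOpposite.op a)).toLinearMap).extendOfNorm (emb E F)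

variable {E F}

theorem leftOp_emb (a : A) (z : E ⊗[ℂ] F) : leftOp E F a (emb E F z) =
    emb E F (TensorProduct.map (E.left a).toLinearMap LinearMap.id z) :=
  LinearMap.extendOfNorm_eq (denseRange_emb E F) ⟨‖a‖, norm_emb_left_le a⟩ z

theorem rightOp_emb (a : A) (z : E ⊗[ℂ] F) : rightOp E F a (emb E F z) =
    emb E F (TensorProduct.map LinearMap.id (F.right (MulOpposite.op a)).toLinearMap z) :=
  LinearMap.extendOfNorm_eq (denseRange_emb E F) ⟨‖a‖, norm_emb_right_le a⟩ z

theorem leftOp_tmul (a : A) (e : E) (f : F) : leftOp E F a (emb E F (e ⊗ₜ f)) =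
    emb E F (E.left a e ⊗ₜ f) := leftOp_emb a _

theorem rightOp_tmul (a : A) (e : E) (f : F) : rightOp E F a (emb E F (e ⊗ₜ f)) =
    emb E F (e ⊗ₜ F.right (MulOpposite.op a) f) := rightOp_emb a _

variable (E F)

/-- The left action. -/
noncomputable def leftHom : A →ₙₐ[ℂ]
    (UniformSpace.Completion (PreTensorC E F) →L[ℂ] UniformSpace.Completion (PreTensorC E F)) where
  toFun := leftOp E F
  map_smul' c a := ext_tmul fun e k => by
    rw [smul_apply, leftOp_tmul, leftOp_tmul, map_smul, smul_apply, ← TensorProduct.smul_tmul',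
      map_smul]
    rfl
  map_zero' := ext_tmul fun e k => by simp [leftOp_tmul]
  map_add' a b := ext_tmul fun e k => by simp [leftOp_tmul, TensorProduct.add_tmul]
  map_mul' a b := ext_tmul fun e k => by simp [leftOp_tmul]

/-- The right action. -/
noncomputable def rightHom : Aᵐᵒᵖ →ₙₐ[ℂ]
    (UniformSpace.Completion (PreTensorC E F) →L[ℂ] UniformSpace.Completion (PreTensorC E F)) where
  toFun a := rightOp E F a.unop
  map_smul' c a := ext_tmul fun e k => by
    rw [smul_apply, rightOp_tmul, rightOp_tmul, MulOpposite.unop_smul, MulOpposite.op_smul,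
      map_smul, smul_apply, TensorProduct.tmul_smul, map_smul]
    rfl
  map_zero' := ext_tmul fun e k => by simp [rightOp_tmul]
  map_add' a b := ext_tmul fun e k => by simp [rightOp_tmul, TensorProduct.tmul_add]
  map_mul' a b := ext_tmul fun e k => by simp [rightOp_tmul]

theorem eq_top_of_tmul_mem (S : Submodule ℂ (UniformSpace.Completion (PreTensorC E F)))
    (hS : IsClosed (S : Set (UniformSpace.Completion (PreTensorC E F))))
    (h : ∀ e k, emb E F (e ⊗ₜ k) ∈ S) : S = ⊤ := by
  refine Submodule.eq_top_iff'.mpr fun x => ?_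
  refine (denseRange_emb E F).induction_on (p := fun x => x ∈ S) x (by exact hS) fun z => ?_
  induction z with
  | zero => simp
  | add z w hz hw => rw [map_add]; exact S.add_mem hz hw
  | tmul e k => exact h e k

theorem continuous_emb_tmul_left (f : F) : Continuous fun e : E => emb E F (e ⊗ₜ f) := by
  let T : E →ₗ[ℂ] UniformSpace.Completion (PreTensorC E F) :=
    emb E F ∘ₗ (TensorProduct.mk ℂ E F).flip f
  refine AddMonoidHomClass.continuous_of_bound T ‖f‖ fun e => ?_
  refine le_of_sq_le_sq ?_ (by positivity)
  change ‖emb E F (e ⊗ₜ f)‖ ^ 2 ≤ _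
  rw [norm_emb_sq, form_tmul, mul_pow, E.norm_sq_eq]
  calc _ ≤ ‖f‖ * (‖E.ip e e‖ * ‖f‖) := (F.norm_ip_le _ _).trans (by
        gcongr; exact F.norm_left_le _ _)
    _ = _ := by ring

end PreTensorC

open PreTensorC in
/-- The interior tensor product `E ⊗_A F` of correspondences, the Hausdorff completion of the
algebraic tensor product for the `A`-valued form `⟨e ⊗ f, e' ⊗ f'⟩ = ⟨f, ⟨e, e'⟩ f'⟩`, with
`a (e ⊗ f) b = a e ⊗ f b`. -/
noncomputable def Corr.tensor (E F : Corr.{u} A) : Corr.{u} A where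
  carrier := UniformSpace.Completion (PreTensorC E F)
  ip x y := ipL E F x y
  ip_add_right x y z := map_add _ _ _
  ip_smul_right c x y := map_smul _ _ _
  star_ip x y := by
    refine ext_emb (f := fun x => star (ipL E F x y)) (g := fun x => ipL E F y x)
      (by fun_prop) (by fun_prop) (fun z => ?_) x
    refine ext_emb (f := fun y => star (ipL E F (emb E F z) y))
      (g := fun y => ipL E F y (emb E F z)) (by fun_prop) (by fun_prop) (fun w => ?_) y
    rw [ipL_emb, ipL_emb, star_form]
  ip_self_nonneg x := by
    refine (denseRange_emb E F).induction_on (p := fun x => 0 ≤ ipL E F x x) x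
      (isClosed_le (by fun_prop) (by fun_prop)) fun z => ?_
    rw [ipL_emb]; exact form_self_nonneg z
  norm_sq_eq x := by
    refine ext_emb (f := fun x => ‖x‖ ^ 2) (g := fun x => ‖ipL E F x x‖)
      (by fun_prop) (by fun_prop) (fun z => ?_) x
    rw [ipL_emb, norm_emb_sq]
  right := rightHom E F
  ip_right a x y := by
    refine ext_emb (f := fun x => ipL E F x (rightOp E F a y)) (g := fun x => ipL E F x y * a)
      (by fun_prop) (by fun_prop) (fun z => ?_) x
    refine ext_emb (f := fun y => ipL E F (emb E F z) (rightOp E F a y))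
      (g := fun y => ipL E F (emb E F z) y * a) (by fun_prop) (by fun_prop) (fun w => ?_) y
    rw [rightOp_emb, ipL_emb, ipL_emb, form_right]
  left := leftHom E F
  ip_left a x y := by
    refine ext_emb (f := fun x => ipL E F (leftOp E F a x) y)
      (g := fun x => ipL E F x (leftOp E F (star a) y))
      (by fun_prop) (by fun_prop) (fun z => ?_) x
    refine ext_emb (f := fun y => ipL E F (leftOp E F a (emb E F z)) y)
      (g := fun y => ipL E F (emb E F z) (leftOp E F (star a) y))
      (by fun_prop) (by fun_prop) (fun w => ?_) y
    rw [leftOp_emb, leftOp_emb, ipL_emb, ipL_emb, form_left]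
  left_nondegenerate := by
    set S := Submodule.span ℂ {x | ∃ a y, x = leftHom E F a y} with hS
    refine eq_top_of_tmul_mem E F _ S.isClosed_topologicalClosure fun e k => ?_
    have h1 : e ∈ (Submodule.span ℂ {x : E | ∃ a y, x = E.left a y}).topologicalClosure := by
      rw [E.left_nondegenerate]; trivial
    have h2 : (Submodule.span ℂ {x : E | ∃ a y, x = E.left a y}).topologicalClosure ≤
        S.topologicalClosure.comap (emb E F ∘ₗ (TensorProduct.mk ℂ E F).flip k) := by
      refine Submodule.topologicalClosure_minimal _ (Submodule.span_le.mpr ?_)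
        (S.isClosed_topologicalClosure.preimage (continuous_emb_tmul_left E F k))
      rintro _ ⟨a, y, rfl⟩
      refine S.le_topologicalClosure (Submodule.subset_span ⟨a, emb E F (y ⊗ₜ k), ?_⟩)
      exact (leftOp_tmul a y k).symm
    exact h2 h1

infixr:70 " ⊗ᶜ " => Corr.tensor

end ModuleTensor

section Composition

variable {A : Type v} [NonUnitalCStarAlgebra A] [PartialOrder A] [StarOrderedRing A]

namespace Corr

/-- The canonical map of the algebraic tensor product into the interior tensor product. -/
noncomputable def incC (E F : Corr.{u} A) : E ⊗[ℂ] F →ₗ[ℂ] (E ⊗ᶜ F : Corr.{u} A) :=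
  PreTensorC.emb E F

/-- The elementary tensor `e ⊗ f` in the interior tensor product. -/
noncomputable def tmulC (E F : Corr.{u} A) (e : E) (f : F) : (E ⊗ᶜ F : Corr.{u} A) :=
  E.incC F (e ⊗ₜ f)

variable (E F : Corr.{u} A)

theorem denseRange_incC : DenseRange (E.incC F) := PreTensorC.denseRange_emb E F

theorem ip_incC (z w : E ⊗[ℂ] F) :
    (E ⊗ᶜ F).ip (E.incC F z) (E.incC F w) = PreTensorC.form E F z w := PreTensorC.ipL_emb z w

theorem ip_tmulC (e e' : E) (f f' : F) :
    (E ⊗ᶜ F).ip (E.tmulC F e f) (E.tmulC F e' f') = F.ip f (F.left (E.ip e e') f') :=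
  E.ip_incC F _ _

theorem norm_incC_sq (z : E ⊗[ℂ] F) : ‖E.incC F z‖ ^ 2 = ‖PreTensorC.form E F z z‖ :=
  PreTensorC.norm_emb_sq z

theorem left_tmulC (a : A) (e : E) (f : F) :
    (E ⊗ᶜ F).left a (E.tmulC F e f) = E.tmulC F (E.left a e) f := PreTensorC.leftOp_tmul a e f

theorem right_tmulC (a : A) (e : E) (f : F) :
    (E ⊗ᶜ F).right (MulOpposite.op a) (E.tmulC F e f) =
      E.tmulC F e (F.right (MulOpposite.op a) f) := PreTensorC.rightOp_tmul a e f

variable {E F}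

theorem extC_inc {X : Type*} [TopologicalSpace X] [T2Space X]
    {f g : (E ⊗ᶜ F : Corr.{u} A) → X} (hf : Continuous f) (hg : Continuous g)
    (h : ∀ z, f (E.incC F z) = g (E.incC F z)) (x) : f x = g x :=
  PreTensorC.ext_emb hf hg h x

theorem extC_tmul {X : Type*} [TopologicalSpace X] [T2Space X] [AddCommMonoid X] [Module ℂ X]
    {f g : (E ⊗ᶜ F : Corr.{u} A) →L[ℂ] X}
    (h : ∀ e k, f (E.tmulC F e k) = g (E.tmulC F e k)) : f = g :=
  PreTensorC.ext_tmul (E := E) (F := F) h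

theorem continuous_ip (x : E) : Continuous (E.ip x) := by
  let T : E →ₗ[ℂ] A :=
    { toFun := E.ip x, map_add' := E.ip_add_right x, map_smul' := fun c y => E.ip_smul_right c x y }
  exact AddMonoidHomClass.continuous_of_bound T ‖x‖ fun y => E.norm_ip_le x y

theorem continuous_ip_left (y : E) : Continuous fun x => E.ip x y := by
  have : (fun x => E.ip x y) = fun x => star (E.ip y x) := funext fun x => (E.star_ip y x).symm
  rw [this]
  exact continuous_star.comp (continuous_ip y)

end Corr

namespace IsoCov

variable {E F : Corr.{u} A} {K L M : HilbertRep.{u} A}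

/-- `V(e) W(f)` on the algebraic tensor product. -/
noncomputable def compPre (V : IsoCov E L M) (W : IsoCov F K L) : E ⊗[ℂ] F →ₗ[ℂ] (K →L[ℂ] M) :=
  TensorProduct.lift <| LinearMap.mk₂ ℂ (fun e f => V e ∘L W f)
    (fun e e' f => by ext; simp) (fun c e f => by ext; simp)
    (fun e f f' => by ext; simp) (fun c e f => by ext; simp)

theorem compPre_tmul (V : IsoCov E L M) (W : IsoCov F K L) (e : E) (f : F) :
    V.compPre W (e ⊗ₜ f) = V e ∘L W f := rfl

theorem inner_compPre (V : IsoCov E L M) (W : IsoCov F K L) (z w : E ⊗[ℂ] F) (k k' : K) :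
    ⟪V.compPre W z k, V.compPre W w k'⟫_ℂ = ⟪k, K.σ (PreTensorC.form E F z w) k'⟫_ℂ := by
  induction z with
  | zero => simp
  | add z z' hz hz' => simp only [map_add, LinearMap.add_apply, add_apply, inner_add_left,
      inner_add_right, hz, hz']
  | tmul e h =>
    induction w with
    | zero => simp
    | add w w' hw hw' => simp only [map_add, add_apply, inner_add_right, hw, hw']
    | tmul e' h' =>
      rw [compPre_tmul, compPre_tmul, ContinuousLinearMap.comp_apply,
        ContinuousLinearMap.comp_apply, V.inner_apply, PreTensorC.form_tmul, ← W.inner_apply,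
        W.map_left]
      rfl

theorem norm_compPre (V : IsoCov E L M) (W : IsoCov F K L) (z : E ⊗[ℂ] F) :
    ‖V.compPre W z‖ ≤ 1 * ‖E.incC F z‖ := by
  rw [one_mul]
  refine ContinuousLinearMap.opNorm_le_bound _ (norm_nonneg _) fun k => ?_
  refine le_of_sq_le_sq ?_ (by positivity)
  rw [mul_pow, E.norm_incC_sq, ← inner_self_eq_norm_sq (𝕜 := ℂ), inner_compPre]
  calc _ ≤ ‖⟪k, K.σ (PreTensorC.form E F z z) k⟫_ℂ‖ := Complex.re_le_norm _
    _ ≤ ‖k‖ * ‖K.σ (PreTensorC.form E F z z) k‖ := norm_inner_le_norm _ _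
    _ ≤ ‖k‖ * (‖PreTensorC.form E F z z‖ * ‖k‖) := by
      gcongr
      exact (K.σ _).le_of_opNorm_le (K.norm_σ_le _) _
    _ = _ := by ring

/-- `V(e) W(f)` as a bounded linear map on `E ⊗ F`. -/
noncomputable def compCLM (V : IsoCov E L M) (W : IsoCov F K L) :
    (E ⊗ᶜ F : Corr.{u} A) →L[ℂ] (K →L[ℂ] M) :=
  (V.compPre W).extendOfNorm (E.incC F)

theorem compCLM_inc (V : IsoCov E L M) (W : IsoCov F K L) (z : E ⊗[ℂ] F) :
    V.compCLM W (E.incC F z) = V.compPre W z :=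
  LinearMap.extendOfNorm_eq (E.denseRange_incC F) ⟨1, V.norm_compPre W⟩ z

theorem compCLM_tmul (V : IsoCov E L M) (W : IsoCov F K L) (e : E) (f : F) :
    V.compCLM W (E.tmulC F e f) = V e ∘L W f := V.compCLM_inc W _

theorem inner_compCLM (V : IsoCov E L M) (W : IsoCov F K L) (x y : (E ⊗ᶜ F : Corr.{u} A))
    (k k' : K) :
    ⟪V.compCLM W x k, V.compCLM W y k'⟫_ℂ = ⟪k, K.σ ((E ⊗ᶜ F).ip x y) k'⟫_ℂ := by
  have hσ : Continuous fun a => ⟪k, K.σ a k'⟫_ℂ := by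
    have : Continuous K.σ :=
      AddMonoidHomClass.continuous_of_bound K.σ 1 fun a => by rw [one_mul]; exact K.norm_σ_le a
    fun_prop
  refine Corr.extC_inc (f := fun x => ⟪V.compCLM W x k, V.compCLM W y k'⟫_ℂ)
    (g := fun x => ⟪k, K.σ ((E ⊗ᶜ F).ip x y) k'⟫_ℂ) (by fun_prop)
    (hσ.comp (Corr.continuous_ip_left y)) (fun z => ?_) x
  refine Corr.extC_inc (f := fun y => ⟪V.compCLM W (E.incC F z) k, V.compCLM W y k'⟫_ℂ)
    (g := fun y => ⟪k, K.σ ((E ⊗ᶜ F).ip (E.incC F z) y) k'⟫_ℂ) (by fun_prop)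
    (hσ.comp (Corr.continuous_ip _)) (fun w => ?_) y
  rw [compCLM_inc, compCLM_inc, inner_compPre, E.ip_incC]

/-- The composite `e ⊗ f ↦ V(e) W(f)` of two isometric bimodule maps. -/
noncomputable def comp (V : IsoCov E L M) (W : IsoCov F K L) : IsoCov (E ⊗ᶜ F) K M where
  toFun := (V.compCLM W).toLinearMap
  map_left a ξ := by
    refine DFunLike.congr_fun (Corr.extC_tmul
      (f := (V.compCLM W).comp ((E ⊗ᶜ F).left a))
      (g := (ContinuousLinearMap.compL ℂ K M M (M.σ a)).comp (V.compCLM W)) fun e f => ?_) ξ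
    simp only [ContinuousLinearMap.comp_apply, Corr.left_tmulC, compCLM_tmul, V.map_left]
    rfl
  map_right a ξ := by
    refine DFunLike.congr_fun (Corr.extC_tmul
      (f := (V.compCLM W).comp ((E ⊗ᶜ F).right (MulOpposite.op a)))
      (g := ((ContinuousLinearMap.compL ℂ K K M).flip (K.σ a)).comp (V.compCLM W))
      fun e f => ?_) ξ
    simp only [ContinuousLinearMap.comp_apply, Corr.right_tmulC, compCLM_tmul, W.map_right]
    rfl
  isometric η ξ := ContinuousLinearMap.ext fun k => ext_inner_left ℂ fun x => by
    rw [ContinuousLinearMap.comp_apply, ContinuousLinearMap.adjoint_inner_right]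
    exact V.inner_compCLM W η ξ x k

theorem comp_tmul (V : IsoCov E L M) (W : IsoCov F K L) (e : E) (f : F) :
    V.comp W (E.tmulC F e f) = V e ∘L W f := V.compCLM_tmul W e f

end IsoCov

namespace HilbertRep.Hom

variable {A : Type v} [NonUnitalCStarAlgebra A] {K L M : HilbertRep.{u} A}

theorem comp_apply (T : Hom L M) (S : Hom K L) (x : K) : T.comp S x = T (S x) := rfl

theorem id_apply (x : K) : Hom.id K x = x := rfl

theorem adjoint_inner_left (T : Hom K L) (x : K) (y : L) : ⟪T.adjoint y, x⟫_ℂ = ⟪y, T x⟫_ℂ :=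
  ContinuousLinearMap.adjoint_inner_left _ _ _

theorem adjoint_inner_right (T : Hom K L) (x : K) (y : L) : ⟪x, T.adjoint y⟫_ℂ = ⟪T x, y⟫_ℂ :=
  ContinuousLinearMap.adjoint_inner_right _ _ _

/-- An inner product preserving map has closed range. -/
theorem isClosed_range (T : Hom K L) (hT : ∀ x y, ⟪T x, T y⟫_ℂ = ⟪x, y⟫_ℂ) :
    IsClosed (Set.range T) := by
  have : Isometry T.toCLM := AddMonoidHomClass.isometry_of_norm T.toCLM fun x => by
    rw [← sq_eq_sq₀ (norm_nonneg _) (norm_nonneg _), ← inner_self_eq_norm_sq (𝕜 := ℂ),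
      ← inner_self_eq_norm_sq (𝕜 := ℂ), hT]
  exact this.isClosedEmbedding.isClosed_range

theorem adjoint_comp_self (T : Hom K L) (hT : ∀ x y, ⟪T x, T y⟫_ℂ = ⟪x, y⟫_ℂ) :
    T.adjoint.comp T = Hom.id K :=
  Hom.ext <| ContinuousLinearMap.ext fun x => ext_inner_left ℂ fun y => by
    change ⟪y, T.adjoint (T x)⟫_ℂ = ⟪y, x⟫_ℂ
    rw [adjoint_inner_right, hT]

theorem comp_adjoint_self (T : Hom K L) (hT : ∀ x y, ⟪T x, T y⟫_ℂ = ⟪x, y⟫_ℂ)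
    (hs : Function.Surjective T) : T.comp T.adjoint = Hom.id L :=
  Hom.ext <| ContinuousLinearMap.ext fun x => by
    obtain ⟨y, rfl⟩ := hs x
    change T (T.adjoint (T y)) = T y
    exact congrArg T (congrArg (fun S => S y) (adjoint_comp_self T hT))

end HilbertRep.Hom

namespace Corr

variable (E F : Corr.{u} A) (K : HilbertRep.{u} A)

/-- The canonical identification of `(E ⊗ F) ⊗ K` with `E ⊗ (F ⊗ K)`. -/
noncomputable def assoc : HilbertRep.Hom ((E ⊗ᶜ F) ⊗ᴴ K) (E ⊗ᴴ F ⊗ᴴ K) :=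
  ((E.creation (F ⊗ᴴ K)).comp (F.creation K)).tilde

theorem assoc_tmul (e : E) (f : F) (k : K) :
    E.assoc F K ((E ⊗ᶜ F).tmul K (E.tmulC F e f) k) = E.tmul _ e (F.tmul K f k) := by
  rw [assoc, IsoCov.tilde_tmul, IsoCov.comp_tmul]; rfl

theorem inner_assoc (x y) : ⟪E.assoc F K x, E.assoc F K y⟫_ℂ = ⟪x, y⟫_ℂ := IsoCov.inner_tilde _ x y

theorem assoc_surjective : Function.Surjective (E.assoc F K) := by
  have hcl := (E.assoc F K).isClosed_range (E.inner_assoc F K)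
  set S := LinearMap.range (E.assoc F K).toCLM.toLinearMap with hS
  have hcl' : IsClosed (S : Set (E ⊗ᴴ F ⊗ᴴ K : HilbertRep.{u} A)) := hcl
  have h : S = ⊤ := PreTensor.eq_top_of_tmul_mem E (F ⊗ᴴ K) S hcl' fun e x => by
    have : S.comap (PreTensor.tmulL E (F ⊗ᴴ K) e).toLinearMap = ⊤ :=
      PreTensor.eq_top_of_tmul_mem F K _
        (hcl'.preimage (PreTensor.tmulL E (F ⊗ᴴ K) e).continuous)
        fun f k => ⟨_, E.assoc_tmul F K e f k⟩
    have hx : x ∈ S.comap (PreTensor.tmulL E (F ⊗ᴴ K) e).toLinearMap := by rw [this]; trivial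
    exact hx
  exact LinearMap.range_eq_top.mp h

theorem assoc_adjoint_comp : (E.assoc F K).adjoint.comp (E.assoc F K) = HilbertRep.Hom.id _ :=
  (E.assoc F K).adjoint_comp_self (E.inner_assoc F K)

theorem assoc_comp_adjoint : (E.assoc F K).comp (E.assoc F K).adjoint = HilbertRep.Hom.id _ :=
  (E.assoc F K).comp_adjoint_self (E.inner_assoc F K) (E.assoc_surjective F K)

end Corr

/-- `Ṽ(I ⊗ W̃)` is the tilde of the composite. -/
theorem IsoCov.tilde_comp {E F : Corr.{u} A} {K L M : HilbertRep.{u} A} (V : IsoCov E L M)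
    (W : IsoCov F K L) :
    (V.comp W).tilde = (V.tilde.comp (E.map W.tilde)).comp (E.assoc F K) := by
  refine Corr.tensor_hom_ext _ fun x k => ?_
  refine DFunLike.congr_fun (Corr.extC_tmul
    (f := (PreTensor.tmulL (E ⊗ᶜ F) K).flip k |> (V.comp W).tilde.toCLM.comp)
    (g := (PreTensor.tmulL (E ⊗ᶜ F) K).flip k |>
      ((V.tilde.comp (E.map W.tilde)).comp (E.assoc F K)).toCLM.comp) fun e f => ?_) x
  change (V.comp W).tilde ((E ⊗ᶜ F).tmul K (E.tmulC F e f) k) =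
    V.tilde (E.map W.tilde (E.assoc F K ((E ⊗ᶜ F).tmul K (E.tmulC F e f) k)))
  rw [IsoCov.tilde_tmul, IsoCov.comp_tmul, Corr.assoc_tmul, Corr.map_tmul, IsoCov.tilde_tmul,
    IsoCov.tilde_tmul]
  rfl

end Composition

namespace HilbertRep

variable {A : Type v} [NonUnitalCStarAlgebra A]

theorem eq_zero_of_σ (K : HilbertRep.{u} A) (x : K) (h : ∀ a, K.σ a x = 0) : x = 0 := by
  have h1 := (Submodule.topologicalClosure_eq_top_iff).mp K.nondegenerate
  refine (Submodule.eq_bot_iff _).mp h1 x ?_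
  rw [Submodule.mem_orthogonal]
  intro y hy
  induction hy using Submodule.span_induction with
  | mem y hy => obtain ⟨a, y, rfl⟩ := hy; rw [inner_σ_left, h, inner_zero_right]
  | zero => exact inner_zero_left _
  | add y z _ _ hy hz => rw [inner_add_left, hy, hz, add_zero]
  | smul c y _ hy => rw [inner_smul_left, hy, mul_zero]

/-- A criterion for nondegeneracy. -/
theorem nondegenerate_of {X : Type*} [NormedAddCommGroup X] [InnerProductSpace ℂ X]
    [CompleteSpace X] (s : A →⋆ₙₐ[ℂ] (X →L[ℂ] X)) (h : ∀ x, (∀ a, s a x = 0) → x = 0) :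
    (Submodule.span ℂ {x : X | ∃ a y, x = s a y}).topologicalClosure = ⊤ := by
  refine (Submodule.topologicalClosure_eq_top_iff).mpr ((Submodule.eq_bot_iff _).mpr fun x hx => ?_)
  refine h x fun a => ext_inner_left ℂ fun y => ?_
  rw [inner_zero_right, ← ContinuousLinearMap.adjoint_inner_left,
    ← ContinuousLinearMap.star_eq_adjoint, ← map_star]
  exact (Submodule.mem_orthogonal _ _).mp hx _ (Submodule.subset_span ⟨_, _, rfl⟩)

section DirectSum

variable (K : ℕ → HilbertRep.{u} A)

theorem memℓp_diag (a : A) (x : lp (fun n => (K n : Type u)) 2) :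
    Memℓp (fun n => (K n).σ a (x n)) 2 :=
  Memℓp.mono ((lp.memℓp x).norm.const_mul ‖a‖) fun n => (K n).σ a |>.le_of_opNorm_le
    ((K n).norm_σ_le a) (x n)

/-- The diagonal operator. -/
noncomputable def diag (a : A) :
    lp (fun n => (K n : Type u)) 2 →L[ℂ] lp (fun n => (K n : Type u)) 2 :=
  LinearMap.mkContinuous
    { toFun := fun x => ⟨fun n => (K n).σ a (x n), memℓp_diag K a x⟩
      map_add' := fun x y => lp.ext <| funext fun n => by
        change (K n).σ a (x n + y n) = (K n).σ a (x n) + (K n).σ a (y n); rw [map_add]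
      map_smul' := fun c x => lp.ext <| funext fun n => by
        change (K n).σ a (c • x n) = c • (K n).σ a (x n); rw [map_smul] } ‖a‖ fun x => by
    have : ‖((‖a‖ : ℂ) • x)‖ = ‖a‖ * ‖x‖ := by rw [norm_smul]; simp
    rw [← this]
    refine lp.norm_mono (by norm_num) fun n => ?_
    change ‖(K n).σ a (x n)‖ ≤ ‖(‖a‖ : ℂ) • x n‖
    rw [norm_smul]
    simpa using (K n).σ a |>.le_of_opNorm_le ((K n).norm_σ_le a) (x n)

theorem diag_apply (a : A) (x : lp (fun n => (K n : Type u)) 2) (n : ℕ) :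
    diag K a x n = (K n).σ a (x n) := rfl

/-- The diagonal representation. -/
noncomputable def diagHom : A →⋆ₙₐ[ℂ]
    (lp (fun n => (K n : Type u)) 2 →L[ℂ] lp (fun n => (K n : Type u)) 2) where
  toFun := diag K
  map_smul' c a := ContinuousLinearMap.ext fun x => lp.ext <| funext fun n => by
    change (K n).σ (c • a) (x n) = c • (K n).σ a (x n); rw [map_smul]; rfl
  map_zero' := ContinuousLinearMap.ext fun x => lp.ext <| funext fun n => by
    change (K n).σ 0 (x n) = 0; rw [map_zero]; rfl
  map_add' a b := ContinuousLinearMap.ext fun x => lp.ext <| funext fun n => by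
    change (K n).σ (a + b) (x n) = (K n).σ a (x n) + (K n).σ b (x n); rw [map_add]; rfl
  map_mul' a b := ContinuousLinearMap.ext fun x => lp.ext <| funext fun n => by
    change (K n).σ (a * b) (x n) = (K n).σ a ((K n).σ b (x n)); rw [map_mul]; rfl
  map_star' a := by
    rw [ContinuousLinearMap.star_eq_adjoint]
    refine ContinuousLinearMap.ext fun x => ext_inner_left ℂ fun y => ?_
    rw [ContinuousLinearMap.adjoint_inner_right, lp.inner_eq_tsum, lp.inner_eq_tsum]
    exact tsum_congr fun n => ((K n).inner_σ_left a _ _).symm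

/-- The Hilbert space direct sum of a sequence of representations. -/
noncomputable def dsum : HilbertRep.{u} A where
  carrier := lp (fun n => (K n : Type u)) 2
  σ := diagHom K
  nondegenerate := nondegenerate_of _ fun _ h => lp.ext <| funext fun n =>
    (K n).eq_zero_of_σ _ fun a => congrArg (fun y : lp (fun n => (K n : Type u)) 2 => y n) (h a)

/-- The components of a vector in the direct sum. -/
noncomputable def coord (n : ℕ) (x : dsum K) : K n :=
  (show lp (fun n => (K n : Type u)) 2 from x) n

/-- The inclusion of the `n`-th summand. -/
noncomputable def single (n : ℕ) : Hom (K n) (dsum K) where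
  toCLM := lp.singleContinuousLinearMap ℂ (fun n => (K n : Type u)) 2 n
  comm _ _ := lp.ext <| funext fun m => by
    change (Pi.single n ((K n).σ _ _) : ∀ m, K m) m =
      (K m).σ _ ((Pi.single n _ : ∀ m, K m) m)
    by_cases h : m = n
    · subst h; simp
    · rw [Pi.single_eq_of_ne h, Pi.single_eq_of_ne h, map_zero]

theorem inner_single (n : ℕ) (x y : K n) : ⟪single K n x, single K n y⟫_ℂ = ⟪x, y⟫_ℂ := by
  refine (lp.inner_single_left (𝕜 := ℂ) (G := fun n => (K n : Type u)) n x _).trans ?_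
  exact congrArg (fun z => ⟪x, z⟫_ℂ) (Pi.single_eq_same (M := fun n => (K n : Type u)) n y)

end DirectSum

/-- The Hilbert space direct sum of two representation spaces. -/
abbrev Sum (K L : HilbertRep.{u} A) : Type u := WithLp 2 (K × L)

/-- A closed invariant subspace. -/
structure SubRep (K : HilbertRep.{u} A) where
  toSubmodule : Submodule ℂ K
  isClosed : IsClosed (toSubmodule : Set K)
  invariant : ∀ a, ∀ x ∈ toSubmodule, K.σ a x ∈ toSubmodule

namespace SubRep

variable {K : HilbertRep.{u} A} (M : SubRep K)

instance : CompleteSpace M.toSubmodule := M.isClosed.completeSpace_coe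

/-- The restricted operator. -/
noncomputable def restrict (a : A) : M.toSubmodule →L[ℂ] M.toSubmodule :=
  ((K.σ a).comp M.toSubmodule.subtypeL).codRestrict M.toSubmodule
    fun x => M.invariant a x x.2

/-- The restricted representation. -/
noncomputable def restrictHom : A →⋆ₙₐ[ℂ] (M.toSubmodule →L[ℂ] M.toSubmodule) where
  toFun := M.restrict
  map_smul' c a := ContinuousLinearMap.ext fun x => Subtype.ext <| by
    change K.σ (c • a) (x : K) = c • K.σ a (x : K); rw [map_smul]; rfl
  map_zero' := ContinuousLinearMap.ext fun x => Subtype.ext <| by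
    change K.σ 0 (x : K) = 0; rw [map_zero]; rfl
  map_add' a b := ContinuousLinearMap.ext fun x => Subtype.ext <| by
    change K.σ (a + b) (x : K) = K.σ a (x : K) + K.σ b (x : K); rw [map_add]; rfl
  map_mul' a b := ContinuousLinearMap.ext fun x => Subtype.ext <| by
    change K.σ (a * b) (x : K) = K.σ a (K.σ b (x : K)); rw [map_mul]; rfl
  map_star' a := by
    rw [ContinuousLinearMap.star_eq_adjoint]
    refine ContinuousLinearMap.ext fun x => ext_inner_left ℂ fun y => ?_
    rw [ContinuousLinearMap.adjoint_inner_right]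
    exact (K.inner_σ_left a (y : K) (x : K)).symm

/-- The representation obtained by restriction to a closed invariant subspace. -/
noncomputable def toRep : HilbertRep.{u} A where
  carrier := M.toSubmodule
  σ := M.restrictHom
  nondegenerate := nondegenerate_of _ fun _ h => Subtype.ext <|
    K.eq_zero_of_σ _ fun a => congrArg Subtype.val (h a)

/-- The inclusion of a closed invariant subspace. -/
noncomputable def incl : Hom M.toRep K where
  toCLM := M.toSubmodule.subtypeL
  comm _ _ := rfl

theorem inner_incl (x y : M.toRep) : ⟪M.incl x, M.incl y⟫_ℂ = ⟪x, y⟫_ℂ := rfl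

/-- The inclusion of a closed invariant subspace in a larger one. -/
noncomputable def inclusion {M N : SubRep K} (h : M.toSubmodule ≤ N.toSubmodule) :
    Hom M.toRep N.toRep where
  toCLM := M.toSubmodule.subtypeL.codRestrict N.toSubmodule fun x => h x.2
  comm _ _ := rfl

end SubRep

namespace Hom

variable {K L : HilbertRep.{u} A}

/-- The range of an isometric intertwiner. -/
noncomputable def range (T : Hom K L) (hT : ∀ x y, ⟪T x, T y⟫_ℂ = ⟪x, y⟫_ℂ) : SubRep L where
  toSubmodule := LinearMap.range T.toCLM.toLinearMap
  isClosed := T.isClosed_range hT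
  invariant := by
    rintro a _ ⟨x, rfl⟩
    exact ⟨K.σ a x, T.comm a x⟩

/-- The orthogonal complement of the range of an intertwiner. -/
noncomputable def rangeOrtho (T : Hom K L) : SubRep L where
  toSubmodule := (LinearMap.range T.toCLM.toLinearMap)ᗮ
  isClosed := Submodule.isClosed_orthogonal _
  invariant a x hx := by
    rw [Submodule.mem_orthogonal] at hx ⊢
    rintro _ ⟨y, rfl⟩
    rw [inner_σ_right]
    exact hx _ ⟨K.σ (star a) y, T.comm _ y⟩

/-- The orthogonal projection `j j*` onto the range of an isometric intertwiner `j`. -/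
noncomputable def proj (j : Hom K L) : Hom L L := j.comp j.adjoint

/-- The complementary projection `I - j j*`. -/
noncomputable def coproj (j : Hom K L) : Hom L L := (Hom.id L).sub j.proj

end Hom

/-- For closed invariant subspaces `M ≤ N`, `proj` is the orthogonal projection of `N` onto `M`. -/
theorem SubRep.proj_inclusion {K : HilbertRep.{u} A} {M N : SubRep K}
    (h : M.toSubmodule ≤ N.toSubmodule) (x : N.toRep) :
    N.incl ((SubRep.inclusion h).proj x) = M.toSubmodule.starProjection (N.incl x) := by
  set j := SubRep.inclusion h with hj
  refine (Submodule.eq_starProjection_of_mem_of_inner_eq_zero (j.adjoint x).2 fun w hw => ?_).symm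
  have hjj : ∀ y z, ⟪j y, j z⟫_ℂ = ⟪y, z⟫_ℂ := fun _ _ => rfl
  have h1 : ∀ w : M.toRep, ⟪x - j (j.adjoint x), j w⟫_ℂ = 0 := fun w => by
    rw [inner_sub_left, hjj, Hom.adjoint_inner_left, sub_self]
  exact h1 ⟨w, hw⟩

end HilbertRep

section Representations

variable {A : Type v} [NonUnitalCStarAlgebra A] [PartialOrder A] [StarOrderedRing A]

namespace Corr

variable (E F : Corr.{u} A) {K L M N : HilbertRep.{u} A}

theorem inner_ext {M N : HilbertRep.{u} A} {T : HilbertRep.Hom (E ⊗ᴴ K) M}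
    {S : HilbertRep.Hom (E ⊗ᴴ L) M} {T' : HilbertRep.Hom (E ⊗ᴴ K) N}
    {S' : HilbertRep.Hom (E ⊗ᴴ L) N}
    (h : ∀ e k e' l, ⟪T (E.tmul K e k), S (E.tmul L e' l)⟫_ℂ =
      ⟪T' (E.tmul K e k), S' (E.tmul L e' l)⟫_ℂ) (x y) : ⟪T x, S y⟫_ℂ = ⟪T' x, S' y⟫_ℂ := by
  refine E.ext_inc (f := fun x => ⟪T x, S y⟫_ℂ) (g := fun x => ⟪T' x, S' y⟫_ℂ)
    (by fun_prop) (by fun_prop) (fun z => ?_) x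
  refine E.ext_inc (f := fun y => ⟪T (E.inc K z), S y⟫_ℂ)
    (g := fun y => ⟪T' (E.inc K z), S' y⟫_ℂ) (by fun_prop) (by fun_prop) (fun w => ?_) y
  induction z with
  | zero => simp
  | add z z' hz hz' => simp only [map_add, inner_add_left, hz, hz']
  | tmul e k =>
    induction w with
    | zero => simp
    | add w w' hw hw' => simp only [map_add, inner_add_right, hw, hw']
    | tmul e' l => exact h e k e' l

theorem inner_map (T : HilbertRep.Hom K L) (hT : ∀ x y, ⟪T x, T y⟫_ℂ = ⟪x, y⟫_ℂ) (x y) :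
    ⟪E.map T x, E.map T y⟫_ℂ = ⟪x, y⟫_ℂ :=
  E.inner_ext (T' := HilbertRep.Hom.id _) (S' := HilbertRep.Hom.id _) (fun e k e' l => by
    rw [map_tmul, map_tmul, HilbertRep.Hom.id_apply, HilbertRep.Hom.id_apply, inner_tmul,
      inner_tmul, ← T.comm, hT]) x y

theorem inner_map_eq_zero (T : HilbertRep.Hom K M) (S : HilbertRep.Hom L M)
    (h : ∀ x y, ⟪T x, S y⟫_ℂ = 0) (x y) : ⟪E.map T x, E.map S y⟫_ℂ = 0 := by
  have := E.inner_ext (T := E.map T) (S := E.map S) (T' := E.map T)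
    (S' := (E.map S).sub (E.map S)) (fun e k e' l => by
      have : ((E.map S).sub (E.map S)) (E.tmul L e' l) = 0 := sub_self _
      rw [this, inner_zero_right, map_tmul, map_tmul, inner_tmul, ← S.comm, h]) x y
  rw [this]
  have : ((E.map S).sub (E.map S)) y = 0 := sub_self _
  rw [this, inner_zero_right]

/-- An isomorphism of correspondences. -/
structure Iso (E F : Corr.{u} A) where
  toEquiv : E ≃ₗ[ℂ] F
  ip_map : ∀ x y, F.ip (toEquiv x) (toEquiv y) = E.ip x y
  map_left : ∀ a x, toEquiv (E.left a x) = F.left a (toEquiv x)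
  map_right : ∀ a x, toEquiv (E.right (MulOpposite.op a) x) =
    F.right (MulOpposite.op a) (toEquiv x)

variable {E F}

/-- The inverse isomorphism. -/
noncomputable def Iso.symm (f : Iso E F) : Iso F E where
  toEquiv := f.toEquiv.symm
  ip_map x y := by rw [← f.ip_map, f.toEquiv.apply_symm_apply, f.toEquiv.apply_symm_apply]
  map_left a x := f.toEquiv.injective <| by
    rw [f.map_left, f.toEquiv.apply_symm_apply, f.toEquiv.apply_symm_apply]
  map_right a x := f.toEquiv.injective <| by
    rw [f.map_right, f.toEquiv.apply_symm_apply, f.toEquiv.apply_symm_apply]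

/-- Precomposition of an isometric bimodule map with an isomorphism of correspondences. -/
noncomputable def _root_.IsoCov.precomp (V : IsoCov F K L) (f : Iso E F) : IsoCov E K L where
  toFun := V.toFun ∘ₗ f.toEquiv.toLinearMap
  map_left a ξ := by simp [f.map_left, V.map_left]
  map_right a ξ := by simp [f.map_right, V.map_right]
  isometric η ξ := by simp [V.isometric, f.ip_map]

/-- The operator `f ⊗ I_K : E ⊗ K → F ⊗ K`. -/
noncomputable def Iso.map (f : Iso E F) (K : HilbertRep.{u} A) :
    HilbertRep.Hom (E ⊗ᴴ K) (F ⊗ᴴ K) :=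
  ((F.creation K).precomp f).tilde

theorem Iso.map_tmul (f : Iso E F) (e : E) (k : K) :
    f.map K (E.tmul K e k) = F.tmul K (f.toEquiv e) k :=
  IsoCov.tilde_tmul _ _ _

theorem Iso.map_surjective (f : Iso E F) : Function.Surjective (f.map K) := by
  have h : (f.map K).comp (f.symm.map K) = HilbertRep.Hom.id _ :=
    F.tensor_hom_ext fun e k => by
      rw [HilbertRep.Hom.comp_apply, Iso.map_tmul, Iso.map_tmul, HilbertRep.Hom.id_apply]
      congr 1
      exact f.toEquiv.apply_symm_apply e
  exact fun x => ⟨f.symm.map K x, congrArg (fun T => T x) h⟩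

variable (E)

/-- For an isomorphism `f : F ⊗ G → G' ⊗ F'`, the operator `f ⊗ I_K`, viewed as a map
`F ⊗ (G ⊗ K) → G' ⊗ (F' ⊗ K)` by associativity of the tensor product. -/
noncomputable def swap {F G G' F' : Corr.{u} A} (f : Iso (F ⊗ᶜ G) (G' ⊗ᶜ F'))
    (K : HilbertRep.{u} A) : HilbertRep.Hom (F ⊗ᴴ G ⊗ᴴ K) (G' ⊗ᴴ F' ⊗ᴴ K) :=
  (G'.assoc F' K).comp ((f.map K).comp (F.assoc G K).adjoint)

theorem swap_surjective {F G G' F' : Corr.{u} A} (f : Iso (F ⊗ᶜ G) (G' ⊗ᶜ F')) :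
    Function.Surjective (swap f K) := by
  refine (G'.assoc_surjective F' K).comp ((f.map_surjective).comp fun x => ?_)
  exact ⟨F.assoc G K x, congrArg (fun T => T x) (F.assoc_adjoint_comp G K)⟩

/-- The Hilbert space `E^{⊗ n} ⊗ K`, as an iterated interior tensor product. -/
noncomputable def pow (K : HilbertRep.{u} A) : ℕ → HilbertRep.{u} A
  | 0 => K
  | n + 1 => E ⊗ᴴ pow K n

/-- The operator `I_{E^{⊗ n}} ⊗ T`. -/
noncomputable def powMap (T : HilbertRep.Hom K L) : ∀ n, HilbertRep.Hom (E.pow K n) (E.pow L n)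
  | 0 => T
  | n + 1 => E.map (powMap T n)

/-- The Hilbert space `F(E) ⊗ K = ⨁ₙ E^{⊗ n} ⊗ K`, where `F(E)` is the Fock module of `E`, with
the representation `ρ` that acts diagonally; the summand for `n = 0` is `K`. -/
noncomputable def fock (K : HilbertRep.{u} A) : HilbertRep.{u} A := HilbertRep.dsum (E.pow K)

/-- The inclusion of `K` in `F(E) ⊗ K` as the summand for `n = 0`. -/
noncomputable def vac (K : HilbertRep.{u} A) : HilbertRep.Hom K (E.fock K) :=
  HilbertRep.single (E.pow K) 0

/-- The components of `S(ξ) x`. -/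
noncomputable def shiftFun (ξ : E) (x : ∀ n, E.pow K n) : ∀ n, E.pow K n
  | 0 => 0
  | n + 1 => E.tmul (E.pow K n) ξ (x n)

theorem memℓp_shiftFun (ξ : E) (x : lp (fun n => (E.pow K n : Type u)) 2) :
    Memℓp (E.shiftFun (K := K) ξ x) 2 := by
  have hg : Memℓp (fun n : ℕ => Nat.casesOn (motive := fun _ => ℝ) n 0 fun n => ‖ξ‖ * ‖x n‖) 2 := by
    have h : Memℓp (fun n => ‖ξ‖ * ‖x n‖) 2 := (lp.memℓp x).norm.const_mul ‖ξ‖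
    exact memℓp_gen ((summable_nat_add_iff 1).mp (h.summable (by norm_num)))
  refine Memℓp.mono hg fun n => ?_
  cases n with
  | zero => exact norm_zero.le
  | succ n => exact PreTensor.norm_emb_tmul_le E (E.pow K n) ξ (x n)

/-- The vector `S(ξ) x`. -/
noncomputable def shiftVec (ξ : E) (x : lp (fun n => (E.pow K n : Type u)) 2) :
    lp (fun n => (E.pow K n : Type u)) 2 :=
  ⟨E.shiftFun ξ x, E.memℓp_shiftFun ξ x⟩

theorem inner_shiftVec (ξ η : E) (x y : lp (fun n => (E.pow K n : Type u)) 2) :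
    ⟪E.shiftVec ξ x, E.shiftVec η y⟫_ℂ = ⟪x, HilbertRep.diag (E.pow K) (E.ip ξ η) y⟫_ℂ := by
  rw [lp.inner_eq_tsum, lp.inner_eq_tsum]
  refine ((lp.summable_inner (𝕜 := ℂ) (E.shiftVec ξ x) (E.shiftVec η y)).tsum_eq_zero_add).trans ?_
  have h0 : ⟪E.shiftVec ξ x 0, E.shiftVec η y 0⟫_ℂ = 0 := inner_zero_left (0 : K)
  rw [h0, zero_add]
  exact tsum_congr fun n => E.inner_tmul ξ η (x n) (y n)

theorem norm_shiftVec_le (ξ : E) (x : lp (fun n => (E.pow K n : Type u)) 2) :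
    ‖E.shiftVec ξ x‖ ≤ ‖ξ‖ * ‖x‖ := by
  refine le_of_sq_le_sq ?_ (by positivity)
  rw [mul_pow, E.norm_sq_eq, ← inner_self_eq_norm_sq (𝕜 := ℂ), inner_shiftVec]
  calc _ ≤ ‖⟪x, HilbertRep.diag (E.pow K) (E.ip ξ ξ) x⟫_ℂ‖ := Complex.re_le_norm _
    _ ≤ ‖x‖ * ‖HilbertRep.diag (E.pow K) (E.ip ξ ξ) x‖ := norm_inner_le_norm _ _
    _ ≤ ‖x‖ * (‖E.ip ξ ξ‖ * ‖x‖) := by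
      gcongr
      exact (HilbertRep.diag (E.pow K) (E.ip ξ ξ)).le_of_opNorm_le
        ((E.fock K).norm_σ_le (E.ip ξ ξ)) x
    _ = _ := by ring

/-- The map `S` as a bounded bilinear map. -/
noncomputable def shiftL (K : HilbertRep.{u} A) : E →L[ℂ] lp (fun n => (E.pow K n : Type u)) 2 →L[ℂ]
    lp (fun n => (E.pow K n : Type u)) 2 :=
  LinearMap.mkContinuous₂ (LinearMap.mk₂ ℂ (fun ξ x => E.shiftVec ξ x)
    (fun ξ η x => lp.ext <| funext fun n => by
      cases n with
      | zero => exact (add_zero (0 : K)).symm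
      | succ n => exact congrArg (fun f => f (x n)) (map_add (PreTensor.tmulL E (E.pow K n)) ξ η))
    (fun c ξ x => lp.ext <| funext fun n => by
      cases n with
      | zero => exact (smul_zero (A := K) c).symm
      | succ n => exact congrArg (fun f => f (x n)) (map_smul (PreTensor.tmulL E (E.pow K n)) c ξ))
    (fun ξ x y => lp.ext <| funext fun n => by
      cases n with
      | zero => exact (add_zero (0 : K)).symm
      | succ n => exact map_add (PreTensor.tmulL E (E.pow K n) ξ) (x n) (y n))
    (fun c ξ x => lp.ext <| funext fun n => by
      cases n with
      | zero => exact (smul_zero (A := K) c).symm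
      | succ n => exact map_smul (PreTensor.tmulL E (E.pow K n) ξ) c (x n))) 1
    fun ξ x => by rw [one_mul]; exact E.norm_shiftVec_le ξ x

/-- The induced representation `S(ξ) = T_ξ ⊗ I_K` of `E` on `F(E) ⊗ K`, where `T_ξ` is the creation
operator: `S(ξ)` maps `k ∈ E^{⊗ n} ⊗ K` to `ξ ⊗ k ∈ E^{⊗ (n + 1)} ⊗ K`. -/
noncomputable def shift (K : HilbertRep.{u} A) : IsoCov E (E.fock K) (E.fock K) where
  toFun := (E.shiftL K).toLinearMap
  map_left a ξ := ContinuousLinearMap.ext fun x => lp.ext <| funext fun n => by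
    cases n with
    | zero => exact (map_zero (K.σ a)).symm
    | succ n => exact (E.σ_tmul a ξ _).symm
  map_right a ξ := ContinuousLinearMap.ext fun x => lp.ext <| funext fun n => by
    cases n with
    | zero => rfl
    | succ n => exact DFunLike.congr_fun ((E.creation (E.pow K n)).map_right a ξ) (HilbertRep.coord _ n x)
  isometric η ξ := ContinuousLinearMap.ext fun k => ext_inner_left ℂ fun x => by
    rw [ContinuousLinearMap.comp_apply, ContinuousLinearMap.adjoint_inner_right]
    exact E.inner_shiftVec η ξ x k

theorem coord_shift_zero (ξ : E) (x : E.fock K) :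
    HilbertRep.coord (E.pow K) 0 (E.shift K ξ x) = 0 := rfl

theorem coord_shift_succ (ξ : E) (x : E.fock K) (n : ℕ) :
    HilbertRep.coord (E.pow K) (n + 1) (E.shift K ξ x) =
      E.tmul (E.pow K n) ξ (HilbertRep.coord (E.pow K) n x) := rfl

end Corr

namespace IsoCov

variable {E : Corr.{u} A} {H K L : HilbertRep.{u} A}

/-- The maps `Ṽₙ : E^{⊗ n} ⊗ H → H`, `Ṽₙ₊₁ = Ṽ (I_E ⊗ Ṽₙ)`. -/
noncomputable def powTilde (V : IsoCov E H H) : ∀ n, HilbertRep.Hom (E.pow H n) H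
  | 0 => HilbertRep.Hom.id H
  | n + 1 => V.tilde.comp (E.map (powTilde V n))

/-- A representation is pure if `Ṽₙ Ṽₙ* → 0` strongly. -/
def IsPure (V : IsoCov E H H) : Prop :=
  ∀ h : H, Filter.Tendsto (fun n => V.powTilde n ((V.powTilde n).adjoint h)) Filter.atTop (nhds 0)

/-- The wandering subspace `H ⊖ Ṽ(E ⊗ H)`. -/
noncomputable def wander (V : IsoCov E H H) : HilbertRep.SubRep H := V.tilde.rangeOrtho

/-- The subspace `Ṽ(E ⊗ M)`, for a closed invariant subspace `M`. -/
noncomputable def image (V : IsoCov E H H) (M : HilbertRep.SubRep H) : HilbertRep.SubRep H :=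
  (V.tilde.comp (E.map M.incl)).range fun x y => by
    rw [HilbertRep.Hom.comp_apply, HilbertRep.Hom.comp_apply, V.inner_tilde,
      E.inner_map _ M.inner_incl]

end IsoCov

/-- The map `E^{⊗ n} ⊗ K → F(E) ⊗ K`, `ξ ⊗ k ↦ Sₙ(ξ) k = S̃ₙ (ξ ⊗ k)`, where `K` is regarded as a
subspace of `F(E) ⊗ K`. -/
noncomputable def Corr.powShift (E : Corr.{u} A) (K : HilbertRep.{u} A) (n : ℕ) :
    HilbertRep.Hom (E.pow K n) (E.fock K) :=
  ((E.shift K).powTilde n).comp (E.powMap (E.vac K) n)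

variable (A) in
/-- A product system over `ℕ₀²`: two correspondences `E₁`, `E₂` over `A` and a unitary isomorphism
`t = t₂₁ : E₂ ⊗ E₁ → E₁ ⊗ E₂`; one puts `tᵢᵢ = id` and `t₁₂ = t₂₁⁻¹`. -/
structure ProductSystem where
  E₁ : Corr.{u} A
  E₂ : Corr.{u} A
  t : Corr.Iso (E₂ ⊗ᶜ E₁) (E₁ ⊗ᶜ E₂)

/-- An isometric covariant representation `(σ, V⁽¹⁾, V⁽²⁾)` of a product system on `H`, where `σ` is
part of `H`. The commutation relation `Ṽ⁽²⁾ (I ⊗ Ṽ⁽¹⁾) = Ṽ⁽¹⁾ (I ⊗ Ṽ⁽²⁾) (t₂₁ ⊗ I)` is the one for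
`(i, j) = (2, 1)`; the one for `(1, 2)` is equivalent, and those for `i = j` are empty. -/
structure IsoRep (X : ProductSystem.{u} A) (H : HilbertRep.{u} A) where
  V₁ : IsoCov X.E₁ H H
  V₂ : IsoCov X.E₂ H H
  comm : V₂.tilde.comp (X.E₂.map V₁.tilde) =
    (V₁.tilde.comp (X.E₁.map V₂.tilde)).comp (Corr.swap X.t H)

namespace ProductSystem

variable (X : ProductSystem.{u} A)

/-- The correspondence `E = E₁ ⊗ E₂`. -/
noncomputable abbrev E : Corr.{u} A := X.E₁ ⊗ᶜ X.E₂

/-- The operator `t_{1,𝟏} ⊗ I_K : E₁ ⊗ E ⊗ K → E ⊗ E₁ ⊗ K`, where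
`t_{1,𝟏} = (I_{E₁} ⊗ t₁₂) (t₁₁ ⊗ I_{E₂})`, up to associativity. -/
noncomputable def flip₁ (K : HilbertRep.{u} A) :
    HilbertRep.Hom (X.E₁ ⊗ᴴ X.E ⊗ᴴ K) (X.E ⊗ᴴ X.E₁ ⊗ᴴ K) :=
  (X.E₁.assoc X.E₂ (X.E₁ ⊗ᴴ K)).adjoint.comp
    ((X.E₁.map (Corr.swap X.t.symm K)).comp (X.E₁.map (X.E₁.assoc X.E₂ K)))

/-- The operator `t_{2,𝟏} ⊗ I_K : E₂ ⊗ E ⊗ K → E ⊗ E₂ ⊗ K`, where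
`t_{2,𝟏} = (I_{E₁} ⊗ t₂₂) (t₂₁ ⊗ I_{E₂})`, up to associativity. -/
noncomputable def flip₂ (K : HilbertRep.{u} A) :
    HilbertRep.Hom (X.E₂ ⊗ᴴ X.E ⊗ᴴ K) (X.E ⊗ᴴ X.E₂ ⊗ᴴ K) :=
  (X.E₁.assoc X.E₂ (X.E₂ ⊗ᴴ K)).adjoint.comp
    ((Corr.swap X.t (X.E₂ ⊗ᴴ K)).comp (X.E₂.map (X.E₁.assoc X.E₂ K)))

/-- The operator `E₁ ⊗ E^{⊗ n} ⊗ K → E^{⊗ n} ⊗ E₁ ⊗ K` which moves `E₁` past the `n` factors `E`, one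
after the other. -/
noncomputable def flipPow₁ (K : HilbertRep.{u} A) :
    ∀ n, HilbertRep.Hom (X.E₁ ⊗ᴴ X.E.pow K n) (X.E.pow (X.E₁ ⊗ᴴ K) n)
  | 0 => HilbertRep.Hom.id _
  | n + 1 => (X.E.map (flipPow₁ K n)).comp (X.flip₁ (X.E.pow K n))

/-- The operator `E₂ ⊗ E^{⊗ n} ⊗ K → E^{⊗ n} ⊗ E₂ ⊗ K` which moves `E₂` past the `n` factors `E`, one
after the other. -/
noncomputable def flipPow₂ (K : HilbertRep.{u} A) :
    ∀ n, HilbertRep.Hom (X.E₂ ⊗ᴴ X.E.pow K n) (X.E.pow (X.E₂ ⊗ᴴ K) n)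
  | 0 => HilbertRep.Hom.id _
  | n + 1 => (X.E.map (flipPow₂ K n)).comp (X.flip₂ (X.E.pow K n))

/-- `M = M_Θ` for `Θ : E₁ → B(K, F(E) ⊗ K)`, that is,
`M(ξ) Sₙ(ξₙ) k = S̃ₙ (I_{E^{⊗ n}} ⊗ Θ̃) (t ⊗ I_K) (ξ ⊗ ξₙ ⊗ k)` with `t : E₁ ⊗ E^{⊗ n} → E^{⊗ n} ⊗ E₁`.
This determines `M`, since the subspaces `S̃ₙ (E^{⊗ n} ⊗ K)` span `F(E) ⊗ K`. -/
def IsMultiplier₁ {K : HilbertRep.{u} A} (Θ : IsoCov X.E₁ K (X.E.fock K))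
    (M : IsoCov X.E₁ (X.E.fock K) (X.E.fock K)) : Prop :=
  ∀ (ξ : X.E₁) (n : ℕ) (x : X.E.pow K n), M ξ (X.E.powShift K n x) =
    (X.E.shift K).powTilde n (X.E.powMap Θ.tilde n (X.flipPow₁ K n (X.E₁.tmul _ ξ x)))

/-- `M = M_Θ` for `Θ : E₂ → B(K, F(E) ⊗ K)`, that is,
`M(ξ) Sₙ(ξₙ) k = S̃ₙ (I_{E^{⊗ n}} ⊗ Θ̃) (t ⊗ I_K) (ξ ⊗ ξₙ ⊗ k)` with `t : E₂ ⊗ E^{⊗ n} → E^{⊗ n} ⊗ E₂`.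
This determines `M`, since the subspaces `S̃ₙ (E^{⊗ n} ⊗ K)` span `F(E) ⊗ K`. -/
def IsMultiplier₂ {K : HilbertRep.{u} A} (Θ : IsoCov X.E₂ K (X.E.fock K))
    (M : IsoCov X.E₂ (X.E.fock K) (X.E.fock K)) : Prop :=
  ∀ (ξ : X.E₂) (n : ℕ) (x : X.E.pow K n), M ξ (X.E.powShift K n x) =
    (X.E.shift K).powTilde n (X.E.powMap Θ.tilde n (X.flipPow₂ K n (X.E₂.tmul _ ξ x)))

end ProductSystem

namespace IsoRep

variable {X : ProductSystem.{u} A} {H : HilbertRep.{u} A} (V : IsoRep X H)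

/-- The representation `V` of `E = E₁ ⊗ E₂`, `V(ξ₁ ⊗ ξ₂) = V⁽¹⁾(ξ₁) V⁽²⁾(ξ₂)`. -/
noncomputable def prod : IsoCov X.E H H := V.V₁.comp V.V₂

theorem prod_tilde : V.prod.tilde =
    (V.V₁.tilde.comp (X.E₁.map V.V₂.tilde)).comp (X.E₁.assoc X.E₂ H) := V.V₁.tilde_comp V.V₂

/-- The subspace `W = H ⊖ Ṽ (E ⊗ H)`. -/
noncomputable def W : HilbertRep.SubRep H := V.prod.wander

/-- The subspace `W₁ = H ⊖ Ṽ⁽¹⁾ (E₁ ⊗ H)`. -/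
noncomputable def W₁ : HilbertRep.SubRep H := V.V₁.wander

/-- The subspace `W₂ = H ⊖ Ṽ⁽²⁾ (E₂ ⊗ H)`. -/
noncomputable def W₂ : HilbertRep.SubRep H := V.V₂.wander

/-- The subspace `L₁ = Ṽ⁽¹⁾ (E₁ ⊗ W₂)`. -/
noncomputable def L₁ : HilbertRep.SubRep H := V.V₁.image V.W₂

/-- The subspace `L₂ = Ṽ⁽²⁾ (E₂ ⊗ W₁)`. -/
noncomputable def L₂ : HilbertRep.SubRep H := V.V₂.image V.W₁

theorem prod_tilde_eq₁ (z) : ∃ y, V.prod.tilde z = V.V₁.tilde (X.E₁.map V.V₂.tilde y) :=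
  ⟨X.E₁.assoc X.E₂ H z, congrArg (fun T => T z) V.prod_tilde⟩

theorem prod_tilde_eq₂ (z) : ∃ y, V.prod.tilde z = V.V₂.tilde (X.E₂.map V.V₁.tilde y) := by
  obtain ⟨y, hy⟩ := V.prod_tilde_eq₁ z
  obtain ⟨w, rfl⟩ := Corr.swap_surjective X.t y
  exact ⟨w, hy.trans (congrArg (fun T => T w) V.comm).symm⟩

theorem W₁_le : V.W₁.toSubmodule ≤ V.W.toSubmodule := by
  refine Submodule.orthogonal_le ?_
  rintro _ ⟨z, rfl⟩
  obtain ⟨y, hy⟩ := V.prod_tilde_eq₁ z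
  exact ⟨_, hy.symm⟩

theorem W₂_le : V.W₂.toSubmodule ≤ V.W.toSubmodule := by
  refine Submodule.orthogonal_le ?_
  rintro _ ⟨z, rfl⟩
  obtain ⟨y, hy⟩ := V.prod_tilde_eq₂ z
  exact ⟨_, hy.symm⟩

theorem L₁_le : V.L₁.toSubmodule ≤ V.W.toSubmodule := by
  rintro _ ⟨x, rfl⟩
  refine (Submodule.mem_orthogonal _ _).mpr ?_
  rintro _ ⟨z, rfl⟩
  obtain ⟨y, hy⟩ := V.prod_tilde_eq₁ z
  refine (congrArg (fun w => ⟪w, _⟫_ℂ) hy).trans ((V.V₁.inner_tilde _ _).trans ?_)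
  have h : ∀ (x) (y : V.W₂.toRep), ⟪V.V₂.tilde x, V.W₂.incl y⟫_ℂ = 0 :=
    fun x y => (Submodule.mem_orthogonal _ _).mp y.2 _ ⟨x, rfl⟩
  exact X.E₁.inner_map_eq_zero _ _ h _ _

theorem L₂_le : V.L₂.toSubmodule ≤ V.W.toSubmodule := by
  rintro _ ⟨x, rfl⟩
  refine (Submodule.mem_orthogonal _ _).mpr ?_
  rintro _ ⟨z, rfl⟩
  obtain ⟨y, hy⟩ := V.prod_tilde_eq₂ z
  refine (congrArg (fun w => ⟪w, _⟫_ℂ) hy).trans ((V.V₂.inner_tilde _ _).trans ?_)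
  have h : ∀ (x) (y : V.W₁.toRep), ⟪V.V₁.tilde x, V.W₁.incl y⟫_ℂ = 0 :=
    fun x y => (Submodule.mem_orthogonal _ _).mp y.2 _ ⟨x, rfl⟩
  exact X.E₂.inner_map_eq_zero _ _ h _ _

/-- The inclusion of `W₁` in `W`. -/
noncomputable def i₁ : HilbertRep.Hom V.W₁.toRep V.W.toRep := HilbertRep.SubRep.inclusion V.W₁_le

/-- The inclusion of `W₂` in `W`. -/
noncomputable def i₂ : HilbertRep.Hom V.W₂.toRep V.W.toRep := HilbertRep.SubRep.inclusion V.W₂_le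

/-- The inclusion of `L₁` in `W`. -/
noncomputable def j₁ : HilbertRep.Hom V.L₁.toRep V.W.toRep := HilbertRep.SubRep.inclusion V.L₁_le

/-- The inclusion of `L₂` in `W`. -/
noncomputable def j₂ : HilbertRep.Hom V.L₂.toRep V.W.toRep := HilbertRep.SubRep.inclusion V.L₂_le

/-- The Hilbert space `F(E) ⊗ W`. -/
noncomputable abbrev model : HilbertRep.{u} A := X.E.fock V.W.toRep

/-- `Φ` is the unitary of the Wold-von Neumann decomposition of the pure representation `(σ, V)` with
the wandering subspace `W`. -/
structure IsWold (Φ : H ≃ₗᵢ[ℂ] V.model) : Prop where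
  map_σ : ∀ a h, Φ (H.σ a h) = V.model.σ a (Φ h)
  map_V : ∀ ξ h, Φ (V.prod ξ h) = X.E.shift V.W.toRep ξ (Φ h)
  map_powTilde : ∀ n x, Φ (V.prod.powTilde n (X.E.powMap V.W.incl n x)) =
    X.E.powShift V.W.toRep n x

/-- `M = (ρ, M_{Θ₁}, M_{Θ₂})` is the BCL-representation for `V`, with the symbols `Θ₁` and `Θ₂`:
`Φ V⁽ⁱ⁾(ξ) Φ* = M_{Θᵢ}(ξ)`, where `Φ` is the unitary of the Wold-von Neumann decomposition. -/
structure IsBCL (Φ : H ≃ₗᵢ[ℂ] V.model) (M : IsoRep X V.model)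
    (Θ₁ : IsoCov X.E₁ V.W.toRep V.model) (Θ₂ : IsoCov X.E₂ V.W.toRep V.model) : Prop where
  conj₁ : ∀ ξ x, Φ (V.V₁ ξ (Φ.symm x)) = M.V₁ ξ x
  conj₂ : ∀ ξ x, Φ (V.V₂ ξ (Φ.symm x)) = M.V₂ ξ x
  multiplier₁ : X.IsMultiplier₁ Θ₁ M.V₁
  multiplier₂ : X.IsMultiplier₂ Θ₂ M.V₂

end IsoRep

end Representations

/-! ### Isometric intertwiners, orthogonal sums and projections. -/

namespace HilbertRep.Hom

variable {A : Type v} [NonUnitalCStarAlgebra A] {K L M N : HilbertRep.{u} A}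

/-! Wold decomposition. Write `h = w + Ṽ y` with `w ∈ W`. Then `I - Ṽₙ₊₁ Ṽₙ₊₁*` sends `h` to `w + Ṽ
(I ⊗ (I - Ṽₙ Ṽₙ*)) y`, so by induction every `I - Ṽₙ Ṽₙ*` has its values in the closed span of the
subspaces `Ṽₖ(E^{⊗ k} ⊗ W)` (`coproj_powTilde_mem`). Purity lets `I - Ṽₙ Ṽₙ*` tend strongly to `I`,
hence this span is `H`. The subspaces are mutually orthogonal because `Ṽ` is isometric and `W ⊥ ran
Ṽ` (`inner_wanderPow`), so `H` is their Hilbert sum, a copy of the Fock space over `W`.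

BCL-representation. Moving one factor past another with the commutation relation gives `Ṽ⁽ⁱ⁾ (I ⊗
Ṽₙ) = Ṽₙ (I ⊗ Ṽ⁽ⁱ⁾) (tᵢ⁽ⁿ⁾ ⊗ I)` (`powTilde_flipPow₁`, `powTilde_flipPow₂`). Restricted to `W` and
carried over by `Φ`, this is the multiplier identity for the symbol `Θᵢ(ξ) = Φ V⁽ⁱ⁾(ξ)|_W`.
Conversely, the multiplier identity for `n = 0` forces this symbol (`symbol₁_eq`, `symbol₂_eq`), so
the formulas come down to computing `Φ Ṽ⁽ⁱ⁾` on `Eᵢ ⊗ W`.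

Formulas. Let `Lᵢ` be the image under `Ṽ⁽ⁱ⁾` of `Eᵢ ⊗ Wⱼ`, `j ≠ i`, so that `W = W₁ ⊕ L₁ = W₂ ⊕ L₂`
(`isOrthoSum_i₁_j₁`, `isOrthoSum_i₂_j₂`). For `i = 1` split `E₁ ⊗ W` along `W₂ ⊕ L₂`. On `E₁ ⊗ W₂`
the values of `Ṽ⁽¹⁾` lie in `L₁ ⊆ W`, where `Φ` is the vacuum embedding; as `L₁ ⊥ W₁`, the
projection `P_{W₁}^⊥` changes nothing. On `E₁ ⊗ L₂` one undoes `Ṽ⁽²⁾` and arrives at `E₁ ⊗ E₂ ⊗ W₁`,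
where `Ṽ⁽¹⁾ (I ⊗ Ṽ⁽²⁾)` is `Ṽ`, and `Φ` turns `Ṽ` into `S̃`. For `i = 2` the same happens on `E₂ ⊗
E₁ ⊗ W₂`, and `t₂₁` is needed to reach `E`. -/

theorem ext_apply {T S : Hom K L} (h : ∀ x, T x = S x) : T = S :=
  Hom.ext (ContinuousLinearMap.ext h)

/-- Holds by unfolding. For this reason the steps closed by `rfl` in the calculations below only
regroup factors or unfold definitions. -/
theorem comp_assoc (T : Hom M N) (S : Hom L M) (R : Hom K L) :
    (T.comp S).comp R = T.comp (S.comp R) := rfl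

theorem id_comp (T : Hom K L) : (Hom.id L).comp T = T := rfl

theorem comp_id (T : Hom K L) : T.comp (Hom.id K) = T := rfl

theorem sub_apply (T S : Hom K L) (x : K) : (T.sub S) x = T x - S x := rfl

/-- An intertwiner which preserves the inner product. -/
def IsIsometric (T : Hom K L) : Prop := ∀ x y, ⟪T x, T y⟫_ℂ = ⟪x, y⟫_ℂ

theorem IsIsometric.comp {T : Hom L M} {S : Hom K L} (hT : T.IsIsometric) (hS : S.IsIsometric) :
    (T.comp S).IsIsometric := fun x y => (hT _ _).trans (hS x y)

theorem IsIsometric.adjoint_apply {T : Hom K L} (hT : T.IsIsometric) (x : K) :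
    T.adjoint (T x) = x :=
  congrArg (fun S : Hom K K => S x) (T.adjoint_comp_self hT)

theorem adjoint_apply_eq_zero {T : Hom K L} {S : Hom M L} (h : ∀ x y, ⟪T x, S y⟫_ℂ = 0) (y : M) :
    T.adjoint (S y) = 0 := by
  refine ext_inner_left ℂ fun x => ?_
  rw [adjoint_inner_right, h, inner_zero_right]

/-- A unitary which intertwines two representations, as an intertwiner. -/
noncomputable def ofEquiv (Φ : K ≃ₗᵢ[ℂ] L) (h : ∀ a x, Φ (K.σ a x) = L.σ a (Φ x)) : Hom K L where
  toCLM := Φ.toContinuousLinearEquiv.toContinuousLinearMap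
  comm := h

theorem isIsometric_ofEquiv (Φ : K ≃ₗᵢ[ℂ] L) (h : ∀ a x, Φ (K.σ a x) = L.σ a (Φ x)) :
    (ofEquiv Φ h).IsIsometric := Φ.inner_map_map

/-- An isometric surjective intertwiner, as a unitary. -/
noncomputable def toEquiv (T : Hom K L) (hT : T.IsIsometric) (hs : Function.Surjective T) :
    K ≃ₗᵢ[ℂ] L :=
  LinearIsometryEquiv.ofSurjective (T.toCLM.toLinearMap.isometryOfInner hT) hs

/-- Two isometric intertwiners with orthogonal ranges which span `M`. -/
structure IsOrthoSum (i : Hom K M) (j : Hom L M) : Prop where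
  left : i.IsIsometric
  right : j.IsIsometric
  ortho : ∀ x y, ⟪i x, j y⟫_ℂ = 0
  span : ∀ z, ∃ x y, z = i x + j y

namespace IsOrthoSum

variable {i : Hom K M} {j : Hom L M}

theorem symm (h : IsOrthoSum i j) : IsOrthoSum j i where
  left := h.right
  right := h.left
  ortho x y := by rw [← inner_conj_symm, h.ortho, map_zero]
  span z := by
    obtain ⟨x, y, hz⟩ := h.span z
    exact ⟨y, x, hz.trans (add_comm _ _)⟩

/-- The unitary `(x, y) ↦ i x + j y`. -/
noncomputable def equiv (h : IsOrthoSum i j) : HilbertRep.Sum K L ≃ₗᵢ[ℂ] M :=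
  LinearIsometryEquiv.ofSurjective
    (((i.toCLM.toLinearMap ∘ₗ LinearMap.fst ℂ K L + j.toCLM.toLinearMap ∘ₗ LinearMap.snd ℂ K L) ∘ₗ
      (WithLp.linearEquiv 2 ℂ (K × L)).toLinearMap).isometryOfInner fun x y => by
        change ⟪i x.fst + j x.snd, i y.fst + j y.snd⟫_ℂ = _
        rw [inner_add_left, inner_add_right, inner_add_right, h.left, h.right, h.ortho,
          h.symm.ortho, add_zero, zero_add, WithLp.prod_inner_apply]
        rfl)
    fun z => by
      obtain ⟨x, y, hz⟩ := h.span z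
      exact ⟨WithLp.toLp 2 (x, y), hz.symm⟩

theorem equiv_apply (h : IsOrthoSum i j) (z : HilbertRep.Sum K L) : h.equiv z = i z.fst + j z.snd := rfl

/-- This removes `P_{Wᵢ}^⊥` from the first summand of a symbol, whose argument lies in `Lᵢ ⊥ Wᵢ`. -/
theorem coproj_apply (h : IsOrthoSum i j) (y : L) : i.coproj (j y) = j y := by
  change j y - i (i.adjoint (j y)) = j y
  rw [adjoint_apply_eq_zero h.ortho, map_zero, sub_zero]

/-- The range of `j` is the orthogonal complement of the range of `i`. Stated as an operator
identity `i i* + j j* = I`, the decomposition can be tensored with a correspondence. -/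
theorem coproj_eq (h : IsOrthoSum i j) : i.coproj = j.proj := ext_apply fun z => by
  obtain ⟨x, y, rfl⟩ := h.span z
  change i x + j y - i (i.adjoint (i x + j y)) = j (j.adjoint (i x + j y))
  rw [map_add, map_add, map_add, adjoint_apply_eq_zero h.ortho,
    adjoint_apply_eq_zero h.symm.ortho, h.left.adjoint_apply, h.right.adjoint_apply, map_zero,
    add_zero, zero_add, add_sub_cancel_left]

end IsOrthoSum

/-- From `i* i = I`. This removes `P_{Wᵢ}` from the second summand of a symbol. -/
theorem IsIsometric.proj_comp {i : Hom K M} (hi : i.IsIsometric) : i.proj.comp i = i :=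
  ext_apply fun x => congrArg i (hi.adjoint_apply x)

theorem adjoint_comp (T : Hom L M) (S : Hom K L) :
    (T.comp S).adjoint = S.adjoint.comp T.adjoint :=
  Hom.ext (ContinuousLinearMap.adjoint_comp _ _)

/-- The splitting is `z = (z - T T* z) + T (T* z)`; the first term is orthogonal to the range
because `T* T = I`. -/
theorem isOrthoSum_rangeOrtho {T : Hom K L} (hT : T.IsIsometric) :
    IsOrthoSum T.rangeOrtho.incl T where
  left := T.rangeOrtho.inner_incl
  right := hT
  ortho x y := (Submodule.mem_orthogonal' _ _).mp x.2 _ ⟨y, rfl⟩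
  span z := by
    refine ⟨⟨z - T (T.adjoint z), (Submodule.mem_orthogonal _ _).mpr ?_⟩, T.adjoint z,
      (sub_add_cancel _ _).symm⟩
    rintro _ ⟨y, rfl⟩
    change ⟪T y, z - T (T.adjoint z)⟫_ℂ = 0
    rw [inner_sub_right, hT, adjoint_inner_right, sub_self]

/-- An isometric intertwiner, as a map onto its range. -/
noncomputable def toRange (T : Hom K L) (hT : T.IsIsometric) : Hom K (T.range hT).toRep where
  toCLM := T.toCLM.codRestrict (T.range hT).toSubmodule fun x => ⟨x, rfl⟩
  comm a x := Subtype.ext (T.comm a x)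

theorem isIsometric_toRange (T : Hom K L) (hT : T.IsIsometric) :
    (T.toRange hT).IsIsometric := hT

theorem toRange_surjective (T : Hom K L) (hT : T.IsIsometric) :
    Function.Surjective (T.toRange hT) := by
  rintro ⟨_, x, rfl⟩
  exact ⟨x, rfl⟩

end HilbertRep.Hom

/-! ### Functoriality of tensor products with correspondences. -/

section

variable {A : Type v} [NonUnitalCStarAlgebra A] [PartialOrder A] [StarOrderedRing A]

open HilbertRep

namespace Corr

variable (E F G : Corr.{u} A) {K L M N : HilbertRep.{u} A}

theorem map_comp (T : Hom L M) (S : Hom K L) : E.map (T.comp S) = (E.map T).comp (E.map S) :=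
  E.tensor_hom_ext fun e k => by
    rw [Hom.comp_apply, map_tmul, map_tmul, map_tmul, Hom.comp_apply]

theorem map_id : E.map (Hom.id K) = Hom.id (E ⊗ᴴ K) :=
  E.tensor_hom_ext fun e k => by rw [map_tmul, Hom.id_apply, Hom.id_apply]

theorem map_map (T : Hom L M) (S : Hom K L) (x) : E.map T (E.map S x) = E.map (T.comp S) x := by
  rw [map_comp, Hom.comp_apply]

theorem map_sub (T S : Hom K L) : E.map (T.sub S) = (E.map T).sub (E.map S) :=
  E.tensor_hom_ext fun e k => by
    rw [Hom.sub_apply, map_tmul, map_tmul, map_tmul, Hom.sub_apply]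
    exact (PreTensor.tmulL E L e).map_sub _ _

/-- On elementary tensors both sides pair to `⟪l, T σ(⟨e, e'⟩) k⟫`, since `T` commutes with the
representations. -/
theorem map_adjoint (T : Hom K L) : (E.map T).adjoint = E.map T.adjoint :=
  Hom.ext_apply fun y => ext_inner_right ℂ fun x => by
    rw [Hom.adjoint_inner_left]
    refine E.inner_ext (T := Hom.id _) (S := E.map T) (T' := E.map T.adjoint) (S' := Hom.id _)
      (fun e l e' k => ?_) y x
    rw [Hom.id_apply, Hom.id_apply, map_tmul, map_tmul, inner_tmul, inner_tmul,
      Hom.adjoint_inner_left, T.comm]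

theorem isIsometric_map {T : Hom K L} (hT : T.IsIsometric) : (E.map T).IsIsometric :=
  E.inner_map T hT

/-- `T T* = I` gives the right inverse `I ⊗ T*`, which avoids a density argument. -/
theorem map_surjective {T : Hom K L} (hT : T.IsIsometric) (hs : Function.Surjective T) :
    Function.Surjective (E.map T) := fun x => ⟨E.map T.adjoint x, by
  rw [map_map, T.comp_adjoint_self hT hs, map_id, Hom.id_apply]⟩

/-- Vectors of `E ⊗ M` need not be finite sums of elementary tensors, so the splitting is obtained
by applying `I ⊗ ·` to `i i* + j j* = I`. -/
theorem isOrthoSum_map {i : Hom K M} {j : Hom L M} (h : Hom.IsOrthoSum i j) :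
    Hom.IsOrthoSum (E.map i) (E.map j) where
  left := E.isIsometric_map h.left
  right := E.isIsometric_map h.right
  ortho := E.inner_map_eq_zero i j h.ortho
  span z := by
    refine ⟨E.map i.adjoint z, E.map j.adjoint z, ?_⟩
    rw [map_map, map_map]
    change z = E.map i.proj z + E.map j.proj z
    rw [← h.coproj_eq, Hom.coproj, map_sub, map_id, Hom.sub_apply, Hom.id_apply, add_sub_cancel]

/-- Intertwiners on `(E ⊗ F) ⊗ K` are determined by their values on elementary tensors. -/
theorem tensorC_hom_ext {T S : Hom ((E ⊗ᶜ F) ⊗ᴴ K) L}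
    (h : ∀ e f k, T ((E ⊗ᶜ F).tmul K (E.tmulC F e f) k) =
      S ((E ⊗ᶜ F).tmul K (E.tmulC F e f) k)) : T = S := by
  refine tensor_hom_ext _ fun x k => ?_
  exact DFunLike.congr_fun (extC_tmul
    (f := T.toCLM.comp ((PreTensor.tmulL (E ⊗ᶜ F) K).flip k))
    (g := S.toCLM.comp ((PreTensor.tmulL (E ⊗ᶜ F) K).flip k)) fun e f => h e f k) x

theorem assoc_map (T : Hom K L) :
    (E.assoc F L).comp ((E ⊗ᶜ F).map T) = (E.map (F.map T)).comp (E.assoc F K) :=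
  E.tensorC_hom_ext F fun e f k => by
    rw [Hom.comp_apply, Hom.comp_apply, map_tmul, assoc_tmul, assoc_tmul, map_tmul, map_tmul]

/-- The associativity map is unitary, so its adjoint is its inverse, and `assoc_map` can be
multiplied by these inverses on both sides. -/
theorem map_assoc_adjoint (T : Hom K L) :
    ((E ⊗ᶜ F).map T).comp (E.assoc F K).adjoint =
      (E.assoc F L).adjoint.comp (E.map (F.map T)) := by
  calc _ = ((E.assoc F L).adjoint.comp (E.assoc F L)).comp
          (((E ⊗ᶜ F).map T).comp (E.assoc F K).adjoint) := by
        rw [assoc_adjoint_comp, Hom.id_comp]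
    _ = (E.assoc F L).adjoint.comp
          (((E.assoc F L).comp ((E ⊗ᶜ F).map T)).comp (E.assoc F K).adjoint) := rfl
    _ = (E.assoc F L).adjoint.comp
          ((E.map (F.map T)).comp ((E.assoc F K).comp (E.assoc F K).adjoint)) := by
        rw [assoc_map]; rfl
    _ = _ := by rw [assoc_comp_adjoint, Hom.comp_id]

variable {E F G}

theorem Iso.map_map (f : Iso E F) (T : Hom K L) :
    (f.map L).comp (E.map T) = (F.map T).comp (f.map K) :=
  E.tensor_hom_ext fun e k => by
    rw [Hom.comp_apply, Hom.comp_apply, Corr.map_tmul, Iso.map_tmul, Iso.map_tmul, Corr.map_tmul]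

theorem Iso.map_comp_symm (f : Iso E F) : (f.map K).comp (f.symm.map K) = Hom.id _ :=
  F.tensor_hom_ext fun e k => by
    rw [Hom.comp_apply, Iso.map_tmul, Iso.map_tmul, Hom.id_apply]
    exact congrArg (fun x => F.tmul K x k) (f.toEquiv.apply_symm_apply e)

/-- `f` acts on the two left factors and `T` on the last one; formally, the inverse associator, `f ⊗
I` and the associator are each natural in the space. -/
theorem swap_map {F G G' F' : Corr.{u} A} (f : Iso (F ⊗ᶜ G) (G' ⊗ᶜ F')) (T : Hom K L) :
    (swap f L).comp (F.map (G.map T)) = (G'.map (F'.map T)).comp (swap f K) := by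
  calc _ = (G'.assoc F' L).comp ((f.map L).comp
          ((F.assoc G L).adjoint.comp (F.map (G.map T)))) := rfl
    _ = (G'.assoc F' L).comp (((f.map L).comp ((F ⊗ᶜ G).map T)).comp (F.assoc G K).adjoint) := by
        rw [← map_assoc_adjoint]; rfl
    _ = ((G'.assoc F' L).comp ((G' ⊗ᶜ F').map T)).comp
          ((f.map K).comp (F.assoc G K).adjoint) := by
        rw [f.map_map]; rfl
    _ = _ := by rw [assoc_map]; rfl

theorem swap_comp_symm {F G G' F' : Corr.{u} A} (f : Iso (F ⊗ᶜ G) (G' ⊗ᶜ F')) :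
    (swap f K).comp (swap f.symm K) = Hom.id _ := by
  calc _ = (G'.assoc F' K).comp ((f.map K).comp
          (((F.assoc G K).adjoint.comp (F.assoc G K)).comp
            ((f.symm.map K).comp (G'.assoc F' K).adjoint))) := rfl
    _ = (G'.assoc F' K).comp (((f.map K).comp (f.symm.map K)).comp (G'.assoc F' K).adjoint) := by
        rw [assoc_adjoint_comp, Hom.id_comp]; rfl
    _ = _ := by rw [f.map_comp_symm, Hom.id_comp, assoc_comp_adjoint]

/-! ### Tensor powers and the Fock space. -/

variable (E)

theorem powMap_comp (T : Hom L M) (S : Hom K L) :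
    ∀ n, E.powMap (T.comp S) n = (E.powMap T n).comp (E.powMap S n)
  | 0 => rfl
  | n + 1 => (congrArg E.map (powMap_comp T S n)).trans (E.map_comp _ _)

theorem isIsometric_powMap {T : Hom K L} (hT : T.IsIsometric) : ∀ n, (E.powMap T n).IsIsometric
  | 0 => hT
  | n + 1 => E.isIsometric_map (isIsometric_powMap hT n)

variable (K) in
/-- The inclusion of `E^{⊗ n} ⊗ K` in `F(E) ⊗ K`. -/
noncomputable def fockSingle (n : ℕ) : Hom (E.pow K n) (E.fock K) := single (E.pow K) n

theorem shift_fockSingle (ξ : E) (n : ℕ) (x : E.pow K n) :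
    E.shift K ξ (E.fockSingle K n x) = E.fockSingle K (n + 1) (E.tmul (E.pow K n) ξ x) :=
  lp.ext <| funext fun m => by
    cases m with
    | zero =>
      exact (Pi.single_eq_of_ne (M := fun n => (E.pow K n : Type u)) (Nat.zero_ne_add_one n)
        (E.tmul (E.pow K n) ξ x)).symm
    | succ m =>
      change PreTensor.tmulL E (E.pow K m) ξ ((Pi.single n x : ∀ m, E.pow K m) m) = _
      by_cases h : m = n
      · subst h
        rw [Pi.single_eq_same]
        exact (Pi.single_eq_same (M := fun n => (E.pow K n : Type u)) (m + 1) _).symm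
      · rw [Pi.single_eq_of_ne h, map_zero]
        exact (Pi.single_eq_of_ne (M := fun n => (E.pow K n : Type u))
          (fun h' => h (Nat.succ_injective h')) _).symm

theorem shift_tilde_fockSingle (n : ℕ) :
    (E.shift K).tilde.comp (E.map (E.fockSingle K n)) = E.fockSingle K (n + 1) :=
  E.tensor_hom_ext fun ξ x => by
    rw [Hom.comp_apply, map_tmul, IsoCov.tilde_tmul]
    exact E.shift_fockSingle ξ n x

/-- Each application of `S̃` raises the degree by one, starting from the vacuum summand. With the
iterated shift seen as the inclusion of a summand, the Fock space can be handled as a Hilbert sum.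
-/
theorem powShift_eq_fockSingle : ∀ n, E.powShift K n = E.fockSingle K n
  | 0 => rfl
  | n + 1 => by
    have h : E.powShift K (n + 1) =
        (E.shift K).tilde.comp ((E.map ((E.shift K).powTilde n)).comp
          (E.map (E.powMap (E.vac K) n))) := rfl
    rw [h, ← Corr.map_comp]
    exact (congrArg (fun T => (E.shift K).tilde.comp (E.map T)) (powShift_eq_fockSingle n)).trans
      (E.shift_tilde_fockSingle n)

end Corr

/-! ### Conjugation and intertwining of covariant representations. -/

namespace IsoCov

variable {E : Corr.{u} A} {K L M N : HilbertRep.{u} A}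

/-- The isometric bimodule map `ξ ↦ T V(ξ) S`, for isometric intertwiners `T` and `S`. -/
noncomputable def conj (V : IsoCov E K L) {S : Hom N K} {T : Hom L M} (hS : S.IsIsometric)
    (hT : T.IsIsometric) : IsoCov E N M where
  toFun := (ContinuousLinearMap.compL ℂ N L M T.toCLM).toLinearMap ∘ₗ
    ((ContinuousLinearMap.compL ℂ N K L).flip S.toCLM).toLinearMap ∘ₗ V.toFun
  map_left a ξ := ContinuousLinearMap.ext fun x => by
    change T (V (E.left a ξ) (S x)) = M.σ a (T (V ξ (S x)))
    rw [V.map_left, ← T.comm]; rfl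
  map_right a ξ := ContinuousLinearMap.ext fun x => by
    change T (V (E.right (MulOpposite.op a) ξ) (S x)) = T (V ξ (S (N.σ a x)))
    rw [V.map_right, S.comm]; rfl
  isometric η ξ := ContinuousLinearMap.ext fun x => ext_inner_left ℂ fun y => by
    rw [ContinuousLinearMap.comp_apply, ContinuousLinearMap.adjoint_inner_right]
    change ⟪T (V η (S y)), T (V ξ (S x))⟫_ℂ = _
    rw [hT, V.inner_apply, ← S.comm, hS]

theorem conj_apply (V : IsoCov E K L) {S : Hom N K} {T : Hom L M} (hS : S.IsIsometric)
    (hT : T.IsIsometric) (ξ : E) (x : N) : V.conj hS hT ξ x = T (V ξ (S x)) := rfl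

theorem conj_tilde (V : IsoCov E K L) {S : Hom N K} {T : Hom L M} (hS : S.IsIsometric)
    (hT : T.IsIsometric) : (V.conj hS hT).tilde = T.comp (V.tilde.comp (E.map S)) :=
  E.tensor_hom_ext fun e k => by
    rw [Hom.comp_apply, Hom.comp_apply, tilde_tmul, Corr.map_tmul, tilde_tmul, conj_apply]

theorem isIsometric_tilde (V : IsoCov E K L) : V.tilde.IsIsometric := V.inner_tilde

theorem isIsometric_powTilde (V : IsoCov E K K) : ∀ n, (V.powTilde n).IsIsometric
  | 0 => fun _ _ => rfl
  | n + 1 => V.isIsometric_tilde.comp (E.isIsometric_map (V.isIsometric_powTilde n))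

/-- An intertwiner of covariant representations intertwines the maps `Ṽₙ`. -/
theorem comp_powTilde {V : IsoCov E K K} {W : IsoCov E L L} {T : Hom K L}
    (h : ∀ ξ x, T (V ξ x) = W ξ (T x)) :
    ∀ n, T.comp (V.powTilde n) = (W.powTilde n).comp (E.powMap T n)
  | 0 => rfl
  | n + 1 => by
    -- The case of degree one. The induction moves `T` through the outer `Ṽ`, where it becomes `I ⊗
    -- T`, and then through the inner `I ⊗ Ṽₙ`.
    have h1 : T.comp V.tilde = W.tilde.comp (E.map T) := E.tensor_hom_ext fun e k => by
      rw [Hom.comp_apply, Hom.comp_apply, tilde_tmul, Corr.map_tmul, tilde_tmul, h]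
    calc _ = (T.comp V.tilde).comp (E.map (V.powTilde n)) := rfl
      _ = W.tilde.comp (E.map (T.comp (V.powTilde n))) := by rw [h1, Corr.map_comp]; rfl
      _ = _ := by rw [comp_powTilde h n, Corr.map_comp]; rfl

end IsoCov

end

/-! ### Moving a factor `Eᵢ` past powers of `E`. -/

section

variable {A : Type v} [NonUnitalCStarAlgebra A] [PartialOrder A] [StarOrderedRing A]

open HilbertRep

namespace ProductSystem

variable (X : ProductSystem.{u} A) {K L : HilbertRep.{u} A}

/-- All constituents of the flip are natural in the space: the associator inside `E₁ ⊗ ·`, the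
exchange of `E₁` and `E₂`, and the inverse associator. -/
theorem flip₁_map (T : Hom K L) :
    (X.flip₁ L).comp (X.E₁.map (X.E.map T)) = (X.E.map (X.E₁.map T)).comp (X.flip₁ K) := by
  calc _ = (X.E₁.assoc X.E₂ (X.E₁ ⊗ᴴ L)).adjoint.comp ((X.E₁.map (Corr.swap X.t.symm L)).comp
          ((X.E₁.map (X.E₁.assoc X.E₂ L)).comp (X.E₁.map (X.E.map T)))) := rfl
    _ = (X.E₁.assoc X.E₂ (X.E₁ ⊗ᴴ L)).adjoint.comp
          (((X.E₁.map (Corr.swap X.t.symm L)).comp (X.E₁.map (X.E₁.map (X.E₂.map T)))).comp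
            (X.E₁.map (X.E₁.assoc X.E₂ K))) := by
        rw [← Corr.map_comp, Corr.assoc_map, Corr.map_comp]; rfl
    _ = ((X.E₁.assoc X.E₂ (X.E₁ ⊗ᴴ L)).adjoint.comp (X.E₁.map (X.E₂.map (X.E₁.map T)))).comp
          ((X.E₁.map (Corr.swap X.t.symm K)).comp (X.E₁.map (X.E₁.assoc X.E₂ K))) := by
        rw [← Corr.map_comp, Corr.swap_map, Corr.map_comp]; rfl
    _ = _ := by rw [← Corr.map_assoc_adjoint]; rfl

theorem flip₂_map (T : Hom K L) :
    (X.flip₂ L).comp (X.E₂.map (X.E.map T)) = (X.E.map (X.E₂.map T)).comp (X.flip₂ K) := by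
  calc _ = (X.E₁.assoc X.E₂ (X.E₂ ⊗ᴴ L)).adjoint.comp ((Corr.swap X.t (X.E₂ ⊗ᴴ L)).comp
          ((X.E₂.map (X.E₁.assoc X.E₂ L)).comp (X.E₂.map (X.E.map T)))) := rfl
    _ = (X.E₁.assoc X.E₂ (X.E₂ ⊗ᴴ L)).adjoint.comp
          (((Corr.swap X.t (X.E₂ ⊗ᴴ L)).comp (X.E₂.map (X.E₁.map (X.E₂.map T)))).comp
            (X.E₂.map (X.E₁.assoc X.E₂ K))) := by
        rw [← Corr.map_comp, Corr.assoc_map, Corr.map_comp]; rfl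
    _ = ((X.E₁.assoc X.E₂ (X.E₂ ⊗ᴴ L)).adjoint.comp (X.E₁.map (X.E₂.map (X.E₂.map T)))).comp
          ((Corr.swap X.t (X.E₂ ⊗ᴴ K)).comp (X.E₂.map (X.E₁.assoc X.E₂ K))) := by
        rw [Corr.swap_map]; rfl
    _ = _ := by rw [← Corr.map_assoc_adjoint]; rfl

/-- Needed for `T` the inclusion of `W` in `H`: the commutation relation lives on `H`, the
multiplier identity on `W`. -/
theorem flipPow₁_map (T : Hom K L) : ∀ n,
    (X.flipPow₁ L n).comp (X.E₁.map (X.E.powMap T n)) =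
      (X.E.powMap (X.E₁.map T) n).comp (X.flipPow₁ K n)
  | 0 => rfl
  | n + 1 => by
    calc _ = (X.E.map (X.flipPow₁ L n)).comp
            ((X.flip₁ _).comp (X.E₁.map (X.E.map (X.E.powMap T n)))) := rfl
      _ = (X.E.map ((X.flipPow₁ L n).comp (X.E₁.map (X.E.powMap T n)))).comp (X.flip₁ _) := by
          rw [flip₁_map, Corr.map_comp]; rfl
      _ = _ := by rw [flipPow₁_map T n, Corr.map_comp]; rfl

theorem flipPow₂_map (T : Hom K L) : ∀ n,
    (X.flipPow₂ L n).comp (X.E₂.map (X.E.powMap T n)) =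
      (X.E.powMap (X.E₂.map T) n).comp (X.flipPow₂ K n)
  | 0 => rfl
  | n + 1 => by
    calc _ = (X.E.map (X.flipPow₂ L n)).comp
            ((X.flip₂ _).comp (X.E₂.map (X.E.map (X.E.powMap T n)))) := rfl
      _ = (X.E.map ((X.flipPow₂ L n).comp (X.E₂.map (X.E.powMap T n)))).comp (X.flip₂ _) := by
          rw [flip₂_map, Corr.map_comp]; rfl
      _ = _ := by rw [flipPow₂_map T n, Corr.map_comp]; rfl

end ProductSystem

namespace IsoRep

variable {X : ProductSystem.{u} A} {H : HilbertRep.{u} A} (V : IsoRep X H)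

theorem comm_symm : (V.V₂.tilde.comp (X.E₂.map V.V₁.tilde)).comp (Corr.swap X.t.symm H) =
    V.V₁.tilde.comp (X.E₁.map V.V₂.tilde) := by
  rw [V.comm, Hom.comp_assoc, Corr.swap_comp_symm, Hom.comp_id]

theorem prod_tilde_assoc_adjoint : V.prod.tilde.comp (X.E₁.assoc X.E₂ H).adjoint =
    V.V₁.tilde.comp (X.E₁.map V.V₂.tilde) := by
  rw [prod_tilde, Hom.comp_assoc, Corr.assoc_comp_adjoint, Hom.comp_id]

/-- Splits `Ṽ` into its two factors in front of an arbitrary `T`. It serves for `T = Ṽ⁽ⁱ⁾` in the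
flip relations and for the inclusion of `W₁` in the symbol formula. -/
theorem prod_tilde_map_assoc_adjoint {K : HilbertRep.{u} A} (T : Hom K H) :
    (V.prod.tilde.comp (X.E.map T)).comp (X.E₁.assoc X.E₂ K).adjoint =
      V.V₁.tilde.comp (X.E₁.map (V.V₂.tilde.comp (X.E₂.map T))) := by
  rw [Hom.comp_assoc, Corr.map_assoc_adjoint, ← Hom.comp_assoc, prod_tilde_assoc_adjoint,
    Corr.map_comp]
  rfl

/-- In `V⁽¹⁾ V⁽¹⁾ V⁽²⁾` only the last two operators are exchanged, by `comm_symm`. The two copies of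
`E₁` stay in place because `t₁₁ = id`. -/
theorem prod_tilde_flip₁ : V.V₁.tilde.comp (X.E₁.map V.prod.tilde) =
    (V.prod.tilde.comp (X.E.map V.V₁.tilde)).comp (X.flip₁ H) := by
  symm
  calc _ = ((V.prod.tilde.comp (X.E.map V.V₁.tilde)).comp (X.E₁.assoc X.E₂ (X.E₁ ⊗ᴴ H)).adjoint).comp
          ((X.E₁.map (Corr.swap X.t.symm H)).comp (X.E₁.map (X.E₁.assoc X.E₂ H))) := rfl
    _ = V.V₁.tilde.comp
          (((X.E₁.map (V.V₂.tilde.comp (X.E₂.map V.V₁.tilde))).comp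
            (X.E₁.map (Corr.swap X.t.symm H))).comp (X.E₁.map (X.E₁.assoc X.E₂ H))) := by
        rw [prod_tilde_map_assoc_adjoint]; rfl
    _ = _ := by rw [← Corr.map_comp, comm_symm, ← Corr.map_comp, ← prod_tilde]

/-- Here the first two operators of `V⁽²⁾ V⁽¹⁾ V⁽²⁾` are exchanged. The exchange takes place over
`E₂ ⊗ H`, so naturality of `t₂₁ ⊗ I` is used to bring it next to the commutation relation on `H`. -/
theorem prod_tilde_flip₂ : V.V₂.tilde.comp (X.E₂.map V.prod.tilde) =
    (V.prod.tilde.comp (X.E.map V.V₂.tilde)).comp (X.flip₂ H) := by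
  symm
  calc _ = ((V.prod.tilde.comp (X.E.map V.V₂.tilde)).comp (X.E₁.assoc X.E₂ (X.E₂ ⊗ᴴ H)).adjoint).comp
          ((Corr.swap X.t (X.E₂ ⊗ᴴ H)).comp (X.E₂.map (X.E₁.assoc X.E₂ H))) := rfl
    _ = (V.V₁.tilde.comp (X.E₁.map V.V₂.tilde)).comp
          (((X.E₁.map (X.E₂.map V.V₂.tilde)).comp (Corr.swap X.t (X.E₂ ⊗ᴴ H))).comp
            (X.E₂.map (X.E₁.assoc X.E₂ H))) := by
        rw [prod_tilde_map_assoc_adjoint, Corr.map_comp]; rfl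
    _ = ((V.V₁.tilde.comp (X.E₁.map V.V₂.tilde)).comp (Corr.swap X.t H)).comp
          ((X.E₂.map (X.E₁.map V.V₂.tilde)).comp (X.E₂.map (X.E₁.assoc X.E₂ H))) := by
        rw [← Corr.swap_map]; rfl
    _ = V.V₂.tilde.comp ((X.E₂.map V.V₁.tilde).comp
          ((X.E₂.map (X.E₁.map V.V₂.tilde)).comp (X.E₂.map (X.E₁.assoc X.E₂ H)))) := by
        rw [← V.comm]; rfl
    _ = _ := by rw [← Corr.map_comp, ← Corr.map_comp, ← Hom.comp_assoc, ← prod_tilde]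

/-- `prod_tilde_flip₁` moves `Ṽ⁽¹⁾` past the outermost `Ṽ`; naturality of the flip then exposes
`Ṽ⁽¹⁾ (I ⊗ Ṽₙ)` inside, where induction applies. This is the multiplier identity before `Φ` is
applied. -/
theorem powTilde_flipPow₁ : ∀ n, V.V₁.tilde.comp (X.E₁.map (V.prod.powTilde n)) =
    ((V.prod.powTilde n).comp (X.E.powMap V.V₁.tilde n)).comp (X.flipPow₁ H n)
  | 0 => by
    change V.V₁.tilde.comp (X.E₁.map (Hom.id H)) = V.V₁.tilde
    rw [Corr.map_id, Hom.comp_id]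
  | n + 1 => by
    calc _ = V.V₁.tilde.comp (X.E₁.map (V.prod.tilde.comp (X.E.map (V.prod.powTilde n)))) := rfl
      _ = (V.V₁.tilde.comp (X.E₁.map V.prod.tilde)).comp
            (X.E₁.map (X.E.map (V.prod.powTilde n))) := by rw [Corr.map_comp]; rfl
      _ = (V.prod.tilde.comp (X.E.map V.V₁.tilde)).comp
            ((X.flip₁ H).comp (X.E₁.map (X.E.map (V.prod.powTilde n)))) := by
          rw [prod_tilde_flip₁]; rfl
      _ = V.prod.tilde.comp ((X.E.map (V.V₁.tilde.comp (X.E₁.map (V.prod.powTilde n)))).comp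
            (X.flip₁ _)) := by rw [X.flip₁_map, Corr.map_comp]; rfl
      _ = _ := by rw [powTilde_flipPow₁ n, Corr.map_comp, Corr.map_comp]; rfl

theorem powTilde_flipPow₂ : ∀ n, V.V₂.tilde.comp (X.E₂.map (V.prod.powTilde n)) =
    ((V.prod.powTilde n).comp (X.E.powMap V.V₂.tilde n)).comp (X.flipPow₂ H n)
  | 0 => by
    change V.V₂.tilde.comp (X.E₂.map (Hom.id H)) = V.V₂.tilde
    rw [Corr.map_id, Hom.comp_id]
  | n + 1 => by
    calc _ = V.V₂.tilde.comp (X.E₂.map (V.prod.tilde.comp (X.E.map (V.prod.powTilde n)))) := rfl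
      _ = (V.V₂.tilde.comp (X.E₂.map V.prod.tilde)).comp
            (X.E₂.map (X.E.map (V.prod.powTilde n))) := by rw [Corr.map_comp]; rfl
      _ = (V.prod.tilde.comp (X.E.map V.V₂.tilde)).comp
            ((X.flip₂ H).comp (X.E₂.map (X.E.map (V.prod.powTilde n)))) := by
          rw [prod_tilde_flip₂]; rfl
      _ = V.prod.tilde.comp ((X.E.map (V.V₂.tilde.comp (X.E₂.map (V.prod.powTilde n)))).comp
            (X.flip₂ _)) := by rw [X.flip₂_map, Corr.map_comp]; rfl
      _ = _ := by rw [powTilde_flipPow₂ n, Corr.map_comp, Corr.map_comp]; rfl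

end IsoRep

end

/-! ### The Wold-von Neumann decomposition. -/

section

variable {A : Type v} [NonUnitalCStarAlgebra A] [PartialOrder A] [StarOrderedRing A]

open HilbertRep

namespace IsoCov

variable {E : Corr.{u} A} {H : HilbertRep.{u} A} (V : IsoCov E H H)

theorem isOrthoSum_wander : Hom.IsOrthoSum V.wander.incl V.tilde :=
  Hom.isOrthoSum_rangeOrtho V.isIsometric_tilde

/-- The map `E^{⊗ n} ⊗ W → H`, `ξ ⊗ w ↦ Ṽₙ(ξ ⊗ w)`, for the wandering subspace `W`. -/
noncomputable def wanderPow (n : ℕ) : Hom (E.pow V.wander.toRep n) H :=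
  (V.powTilde n).comp (E.powMap V.wander.incl n)

theorem wanderPow_succ (n : ℕ) :
    V.wanderPow (n + 1) = V.tilde.comp (E.map (V.wanderPow n)) := by
  have h : V.wanderPow (n + 1) = V.tilde.comp
      ((E.map (V.powTilde n)).comp (E.map (E.powMap V.wander.incl n))) := rfl
  rw [h, ← Corr.map_comp]; rfl

theorem apply_wanderPow (ξ : E) (n : ℕ) (x : E.pow V.wander.toRep n) :
    V ξ (V.wanderPow n x) = V.wanderPow (n + 1) (E.tmul (E.pow V.wander.toRep n) ξ x) := by
  rw [wanderPow_succ]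
  refine Eq.trans ?_ (congrArg V.tilde (E.map_tmul (V.wanderPow n) ξ x)).symm
  rw [tilde_tmul]

theorem isIsometric_wanderPow (n : ℕ) : (V.wanderPow n).IsIsometric :=
  (V.isIsometric_powTilde n).comp (E.isIsometric_powMap V.wander.inner_incl n)

theorem inner_wanderPow_zero (n : ℕ) (x y) : ⟪V.wanderPow 0 x, V.wanderPow (n + 1) y⟫_ℂ = 0 := by
  rw [wanderPow_succ]
  exact V.isOrthoSum_wander.ortho x (E.map (V.wanderPow n) y)

/-- The isometry `Ṽ` is cancelled on both sides until one exponent is `0`; then one vector lies in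
`W` and the other in `ran Ṽ`. -/
theorem inner_wanderPow : ∀ m n, m ≠ n → ∀ x y, ⟪V.wanderPow m x, V.wanderPow n y⟫_ℂ = 0
  | 0, 0, h => (h rfl).elim
  | 0, n + 1, _ => V.inner_wanderPow_zero n
  | m + 1, 0, _ => fun x y => by rw [← inner_conj_symm, inner_wanderPow_zero, map_zero]
  | m + 1, n + 1, h => fun x y => by
    rw [wanderPow_succ, wanderPow_succ]
    refine (V.inner_tilde _ _).trans ?_
    exact E.inner_map_eq_zero _ _ (inner_wanderPow m n fun h' => h (congrArg _ h')) x y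

/-- The closed span of the subspaces `Ṽₙ(E^{⊗ n} ⊗ W)`. -/
noncomputable def wanderSpan : Submodule ℂ H :=
  (⨆ n, LinearMap.range (V.wanderPow n).toCLM.toLinearMap).topologicalClosure

theorem wanderPow_mem (n : ℕ) (x) : V.wanderPow n x ∈ V.wanderSpan :=
  Submodule.le_topologicalClosure _ (Submodule.mem_iSup_of_mem n ⟨x, rfl⟩)

theorem isClosed_wanderSpan : IsClosed (V.wanderSpan : Set H) :=
  Submodule.isClosed_topologicalClosure _

theorem wanderSpan_le {S : Submodule ℂ H} (hS : IsClosed (S : Set H))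
    (h : ∀ n x, V.wanderPow n x ∈ S) : V.wanderSpan ≤ S := by
  refine Submodule.topologicalClosure_minimal _ (iSup_le fun n => ?_) hS
  rintro _ ⟨x, rfl⟩
  exact h n x

theorem apply_mem_wanderSpan (ξ : E) {k : H} (hk : k ∈ V.wanderSpan) : V ξ k ∈ V.wanderSpan := by
  have h : V.wanderSpan ≤ V.wanderSpan.comap (V ξ).toLinearMap :=
    V.wanderSpan_le (V.isClosed_wanderSpan.preimage (V ξ).continuous) fun n x => by
      change V ξ (V.wanderPow n x) ∈ V.wanderSpan
      rw [apply_wanderPow]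
      exact V.wanderPow_mem _ _
  exact h hk

/-- The span is closed and invariant under each `V(ξ)`, so elementary tensors suffice. It is applied
to `D = I - Ṽₙ Ṽₙ*`. -/
theorem tilde_map_mem_wanderSpan {D : Hom H H} (hD : ∀ k, D k ∈ V.wanderSpan) (y) :
    V.tilde (E.map D y) ∈ V.wanderSpan := by
  have h : V.wanderSpan.comap (V.tilde.comp (E.map D)).toCLM.toLinearMap = ⊤ :=
    PreTensor.eq_top_of_tmul_mem E H _
      (V.isClosed_wanderSpan.preimage (V.tilde.comp (E.map D)).toCLM.continuous) fun e k => by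
        change V.tilde (E.map D (E.tmul H e k)) ∈ V.wanderSpan
        rw [Corr.map_tmul, tilde_tmul]
        exact V.apply_mem_wanderSpan e (hD k)
  have hy : y ∈ V.wanderSpan.comap (V.tilde.comp (E.map D)).toCLM.toLinearMap := by
    rw [h]; trivial
  exact hy

/-- For `h = w + Ṽ y` the recursion is `(I - Ṽₙ₊₁ Ṽₙ₊₁*) h = w + Ṽ (I ⊗ (I - Ṽₙ Ṽₙ*)) y`. The first
term lies in `W`, the second in the span by induction. -/
theorem coproj_powTilde_mem : ∀ n h, (V.powTilde n).coproj h ∈ V.wanderSpan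
  | 0, h => by
    have h0 : (V.powTilde 0).coproj h = 0 := by
      change h - (Hom.id H).adjoint h = 0
      exact sub_eq_zero.mpr
        (Hom.IsIsometric.adjoint_apply (T := Hom.id H) (fun _ _ => rfl) h).symm
    rw [h0]
    exact Submodule.zero_mem _
  | n + 1, h => by
    obtain ⟨w, y, rfl⟩ := V.isOrthoSum_wander.span h
    have hw : V.tilde.adjoint (V.wander.incl w) = 0 :=
      Hom.adjoint_apply_eq_zero V.isOrthoSum_wander.symm.ortho w
    have hs : (V.powTilde (n + 1)).coproj (V.wander.incl w + V.tilde y) =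
        V.wanderPow 0 w + V.tilde (E.map (V.powTilde n).coproj y) := by
      -- `Ṽₙ₊₁* = (I ⊗ Ṽₙ*) Ṽ*`, and `Ṽ*` annihilates `w` and sends `Ṽ y` to `y`.
      have ha : (V.powTilde (n + 1)).adjoint (V.wander.incl w + V.tilde y) =
          E.map (V.powTilde n).adjoint y := by
        have h1 : (V.powTilde (n + 1)).adjoint = (E.map (V.powTilde n)).adjoint.comp
            V.tilde.adjoint := Hom.adjoint_comp _ _
        rw [h1, Corr.map_adjoint]
        change E.map (V.powTilde n).adjoint (V.tilde.adjoint (V.wander.incl w + V.tilde y)) = _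
        rw [map_add V.tilde.adjoint.toCLM, hw, zero_add, V.isIsometric_tilde.adjoint_apply]
      calc _ = V.wander.incl w + V.tilde y - V.tilde (E.map (V.powTilde n)
              ((V.powTilde (n + 1)).adjoint (V.wander.incl w + V.tilde y))) := rfl
        _ = V.wander.incl w + V.tilde y -
              V.tilde (E.map (V.powTilde n) (E.map (V.powTilde n).adjoint y)) :=
            congrArg (fun z => V.wander.incl w + V.tilde y - V.tilde (E.map (V.powTilde n) z)) ha
        _ = _ := by
            rw [Corr.map_map, Hom.coproj, Corr.map_sub, Corr.map_id, Hom.sub_apply, Hom.id_apply,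
              map_sub V.tilde.toCLM, add_sub_assoc]
            rfl
    rw [hs]
    exact Submodule.add_mem _ (V.wanderPow_mem 0 w)
      (V.tilde_map_mem_wanderSpan (coproj_powTilde_mem n) y)

variable {V}

/-- By purity `h` is the limit of the vectors `(I - Ṽₙ Ṽₙ*) h`, which lie in this closed subspace.
-/
theorem IsPure.wanderSpan_eq_top (hV : V.IsPure) : V.wanderSpan = ⊤ := by
  refine Submodule.eq_top_iff'.mpr fun h => ?_
  have hlim : Filter.Tendsto (fun n => (V.powTilde n).coproj h) Filter.atTop (nhds h) := by
    have := (hV h).const_sub h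
    rwa [sub_zero] at this
  exact V.isClosed_wanderSpan.mem_of_tendsto hlim
    (Filter.Eventually.of_forall fun n => V.coproj_powTilde_mem n h)

theorem IsPure.clm_ext (hV : V.IsPure) {Y : Type*} [NormedAddCommGroup Y] [NormedSpace ℂ Y]
    {f g : H →L[ℂ] Y} (h : ∀ n x, f (V.wanderPow n x) = g (V.wanderPow n x)) : f = g := by
  have hle : V.wanderSpan ≤ LinearMap.eqLocus f.toLinearMap g.toLinearMap :=
    V.wanderSpan_le (isClosed_eq f.continuous g.continuous) h
  rw [hV.wanderSpan_eq_top] at hle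
  exact ContinuousLinearMap.ext fun x => hle (Submodule.mem_top (x := x))

/-- The Wold-von Neumann decomposition. -/
theorem IsPure.exists_equiv (hV : V.IsPure) : ∃ Φ : H ≃ₗᵢ[ℂ] (E.fock V.wander.toRep : HilbertRep.{u} A),
    ∀ n x, Φ (V.wanderPow n x) = E.powShift V.wander.toRep n x := by
  -- An orthogonal family of isometric embeddings with dense span; the space of square summable
  -- sequences attached to it is the carrier of the Fock space.
  have hsum : IsHilbertSum ℂ (fun n => (E.pow V.wander.toRep n : Type u)) fun n =>
      (V.wanderPow n).toCLM.toLinearMap.isometryOfInner (V.isIsometric_wanderPow n) :=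
    IsHilbertSum.mk (fun m n h => V.inner_wanderPow m n h) hV.wanderSpan_eq_top.ge
  refine ⟨hsum.linearIsometryEquiv, fun n x => ?_⟩
  rw [Corr.powShift_eq_fockSingle]
  have h := hsum.linearIsometryEquiv_symm_apply_single x
  exact (congrArg hsum.linearIsometryEquiv h).symm.trans
    (hsum.linearIsometryEquiv.apply_symm_apply _)

end IsoCov

/-- The Hilbert sum unitary matches the summands by construction. That it intertwines `σ` with `ρ`
and `V` with `S` need only be tested on the vectors `Ṽₙ(x)`, which span a dense subspace. -/
theorem IsoRep.exists_isWold {X : ProductSystem.{u} A} {H : HilbertRep.{u} A} (V : IsoRep X H)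
    (hV : V.prod.IsPure) : ∃ Φ : H ≃ₗᵢ[ℂ] V.model, V.IsWold Φ := by
  obtain ⟨Φ, hΦ⟩ := hV.exists_equiv
  let Φc : H →L[ℂ] V.model := Φ.toContinuousLinearEquiv.toContinuousLinearMap
  refine ⟨Φ, fun a h => ?_, fun ξ h => ?_, hΦ⟩
  · refine DFunLike.congr_fun (hV.clm_ext (f := Φc.comp (H.σ a))
      (g := (V.model.σ a).comp Φc) fun n x => ?_) h
    change Φ (H.σ a (V.prod.wanderPow n x)) = V.model.σ a (Φ (V.prod.wanderPow n x))
    rw [← Hom.comm]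
    exact (hΦ _ _).trans ((Hom.comm _ _ _).trans (congrArg _ (hΦ _ _).symm))
  · refine DFunLike.congr_fun (hV.clm_ext (f := Φc.comp (V.prod ξ))
      (g := (X.E.shift V.W.toRep ξ).comp Φc) fun n x => ?_) h
    change Φ (V.prod ξ (V.prod.wanderPow n x)) = X.E.shift V.W.toRep ξ (Φ (V.prod.wanderPow n x))
    rw [IsoCov.apply_wanderPow]
    refine (hΦ _ _).trans (Eq.trans ?_ (congrArg _ (hΦ _ _).symm))
    rw [Corr.powShift_eq_fockSingle, Corr.powShift_eq_fockSingle]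
    exact (X.E.shift_fockSingle ξ n x).symm

end

/-! ### The two splittings of `W`, and the BCL-representation. -/

section

variable {A : Type v} [NonUnitalCStarAlgebra A] [PartialOrder A] [StarOrderedRing A]

open HilbertRep

namespace IsoCov

variable {E F : Corr.{u} A} {H : HilbertRep.{u} A}

/-- A vector orthogonal to `W̃ (I ⊗ Ṽ) (F ⊗ E ⊗ H)` is the sum of a vector orthogonal to `W̃ (F ⊗ H)`
and a vector of `W̃ (F ⊗ M)`, where `M = H ⊖ Ṽ(E ⊗ H)`. -/
theorem exists_wander_add_image (V : IsoCov E H H) (W : IsoCov F H H) (h : H)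
    (hh : ∀ y, ⟪h, W.tilde (F.map V.tilde y)⟫_ℂ = 0) :
    ∃ x y, h = W.wander.incl x + W.tilde (F.map V.wander.incl y) := by
  obtain ⟨x, z, rfl⟩ := W.isOrthoSum_wander.span h
  have hF := F.isOrthoSum_map V.isOrthoSum_wander
  obtain ⟨y, c, rfl⟩ := hF.span z
  -- Testing the hypothesis at `c` itself: the other components are orthogonal and `W̃` is
  -- isometric, so what is left is the squared norm of this vector.
  have hc : F.map V.tilde c = 0 := by
    have := hh c
    rwa [inner_add_left, W.isOrthoSum_wander.ortho, zero_add, W.inner_tilde, inner_add_left,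
      hF.ortho, zero_add, inner_self_eq_zero] at this
  exact ⟨x, y, by rw [hc, add_zero]⟩

variable (V : IsoCov E H H) (M : SubRep H)

/-- The unitary `E ⊗ M → Ṽ(E ⊗ M)`. -/
noncomputable def toImage : Hom (E ⊗ᴴ M.toRep) (V.image M).toRep :=
  (V.tilde.comp (E.map M.incl)).toRange
    (V.isIsometric_tilde.comp (E.isIsometric_map M.inner_incl))

theorem isIsometric_toImage : (V.toImage M).IsIsometric := Hom.isIsometric_toRange _ _

theorem toImage_surjective : Function.Surjective (V.toImage M) := Hom.toRange_surjective _ _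

theorem incl_comp_toImage :
    (V.image M).incl.comp (V.toImage M) = V.tilde.comp (E.map M.incl) := rfl

/-- Shows that `Ṽ*`, restricted to `Ṽ(E ⊗ M)`, inverts the unitary `toImage`. The lower right
entries of `U'` and `U` are written with this adjoint. -/
theorem adjoint_comp_incl_comp_toImage :
    (V.tilde.adjoint.comp (V.image M).incl).comp (V.toImage M) = E.map M.incl := by
  rw [Hom.comp_assoc, incl_comp_toImage, ← Hom.comp_assoc,
    V.tilde.adjoint_comp_self V.inner_tilde, Hom.id_comp]

end IsoCov

namespace IsoRep

variable {X : ProductSystem.{u} A} {H : HilbertRep.{u} A} (V : IsoRep X H)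

theorem prod_tilde_swap : V.prod.tilde.comp ((X.t.map H).comp (X.E₂.assoc X.E₁ H).adjoint) =
    V.V₂.tilde.comp (X.E₂.map V.V₁.tilde) := by
  rw [V.comm, prod_tilde]; rfl

/-- `W` is orthogonal to `ran Ṽ`, which contains `ran Ṽ⁽²⁾ (I ⊗ Ṽ⁽¹⁾)` by the commutation relation;
`exists_wander_add_image` then splits its vectors along `W₂` and `Ṽ⁽²⁾(E₂ ⊗ W₁)`. -/
theorem isOrthoSum_i₂_j₂ : Hom.IsOrthoSum V.i₂ V.j₂ where
  left _ _ := rfl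
  right _ _ := rfl
  ortho := by
    rintro x ⟨_, y, rfl⟩
    exact V.V₂.isOrthoSum_wander.ortho x (X.E₂.map V.W₁.incl y)
  span w := by
    obtain ⟨x, y, h⟩ := V.V₁.exists_wander_add_image V.V₂ (V.W.incl w) fun y => by
      have h := congrArg (fun T => T y) V.prod_tilde_swap
      exact (congrArg (fun z => ⟪V.W.incl w, z⟫_ℂ) h.symm).trans
        (V.prod.isOrthoSum_wander.ortho w _)
    exact ⟨x, V.V₂.toImage V.W₁ y, Subtype.ext h⟩

theorem isOrthoSum_i₁_j₁ : Hom.IsOrthoSum V.i₁ V.j₁ where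
  left _ _ := rfl
  right _ _ := rfl
  ortho := by
    rintro x ⟨_, y, rfl⟩
    exact V.V₁.isOrthoSum_wander.ortho x (X.E₁.map V.W₂.incl y)
  span w := by
    obtain ⟨x, y, h⟩ := V.V₂.exists_wander_add_image V.V₁ (V.W.incl w) fun y => by
      have h := congrArg (fun T => T y) V.prod_tilde_assoc_adjoint
      exact (congrArg (fun z => ⟪V.W.incl w, z⟫_ℂ) h.symm).trans
        (V.prod.isOrthoSum_wander.ortho w _)
    exact ⟨x, V.V₁.toImage V.W₂ y, Subtype.ext h⟩

section Conj

variable {K : HilbertRep.{u} A}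

/-- The representation `ξ ↦ Φ V⁽ⁱ⁾(ξ) Φ*`, for a unitary intertwiner `Φ`. -/
noncomputable def conj (Φ : H ≃ₗᵢ[ℂ] K) (hΦ : ∀ a x, Φ (H.σ a x) = K.σ a (Φ x))
    (hΦ' : ∀ a x, Φ.symm (K.σ a x) = H.σ a (Φ.symm x)) : IsoRep X K where
  V₁ := V.V₁.conj (Hom.isIsometric_ofEquiv Φ.symm hΦ') (Hom.isIsometric_ofEquiv Φ hΦ)
  V₂ := V.V₂.conj (Hom.isIsometric_ofEquiv Φ.symm hΦ') (Hom.isIsometric_ofEquiv Φ hΦ)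
  comm := by
    set S := Hom.ofEquiv Φ.symm hΦ'
    set T := Hom.ofEquiv Φ hΦ
    have hST : S.comp T = Hom.id H := Hom.ext_apply fun x => Φ.symm_apply_apply x
    -- The inner `Φ* Φ` cancels in a product of two conjugated operators, so both sides reduce to
    -- the commutation relation on `H`; `swap_map` then moves `Φ*` past `t₂₁ ⊗ I`.
    have key : ∀ {E F : Corr.{u} A} (V : IsoCov E H H) (W : IsoCov F H H),
        (T.comp (V.tilde.comp (E.map S))).comp (E.map (T.comp (W.tilde.comp (F.map S)))) =
          T.comp ((V.tilde.comp (E.map W.tilde)).comp (E.map (F.map S))) := fun {E F} V W => by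
      calc _ = T.comp (V.tilde.comp
              ((E.map S).comp (E.map (T.comp (W.tilde.comp (F.map S)))))) := rfl
        _ = T.comp (V.tilde.comp (E.map ((S.comp T).comp (W.tilde.comp (F.map S))))) := by
            rw [← Corr.map_comp]; rfl
        _ = _ := by rw [hST, Hom.id_comp, Corr.map_comp]; rfl
    rw [IsoCov.conj_tilde, IsoCov.conj_tilde, key, key, V.comm, Hom.comp_assoc,
      Corr.swap_map]
    rfl

end Conj

variable {V} {Φ : H ≃ₗᵢ[ℂ] V.model}

namespace IsWold

/-- The unitary of the Wold-von Neumann decomposition as an intertwiner. -/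
noncomputable def hom (h : V.IsWold Φ) : Hom H V.model := Hom.ofEquiv Φ h.map_σ

theorem symm_map_σ (h : V.IsWold Φ) (a x) : Φ.symm (V.model.σ a x) = H.σ a (Φ.symm x) := by
  rw [LinearIsometryEquiv.symm_apply_eq, h.map_σ, Φ.apply_symm_apply]

theorem isIsometric_hom (h : V.IsWold Φ) : h.hom.IsIsometric := Hom.isIsometric_ofEquiv Φ h.map_σ

/-- The defining property of `Φ` in degree `0`, where `Ṽ₀` and `S̃₀` are identities. -/
theorem hom_comp_incl (h : V.IsWold Φ) : h.hom.comp V.W.incl = X.E.vac V.W.toRep :=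
  Hom.ext_apply fun w => h.map_powTilde 0 w

theorem hom_comp_powTilde (h : V.IsWold Φ) (n : ℕ) : h.hom.comp (V.prod.powTilde n) =
    ((X.E.shift V.W.toRep).powTilde n).comp (X.E.powMap h.hom n) :=
  IsoCov.comp_powTilde h.map_V n

/-- The degree one behaviour of `Φ`, which produces the summand with `S̃` in the symbol formulas. -/
theorem hom_prod_tilde (h : V.IsWold Φ) : h.hom.comp (V.prod.tilde.comp (X.E.map V.W.incl)) =
    (X.E.shift V.W.toRep).tilde.comp (X.E.map (X.E.vac V.W.toRep)) :=
  X.E.tensor_hom_ext fun ξ w => by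
    rw [Hom.comp_apply, Hom.comp_apply, Hom.comp_apply, Corr.map_tmul, Corr.map_tmul,
      IsoCov.tilde_tmul, IsoCov.tilde_tmul, ← h.hom_comp_incl]
    exact h.map_V ξ _

/-- The BCL-representation. -/
theorem exists_isBCL (h : V.IsWold Φ) : ∃ M Θ₁ Θ₂, V.IsBCL Φ M Θ₁ Θ₂ := by
  have hsymm : ∀ n x, Φ.symm (X.E.powShift V.W.toRep n x) =
      V.prod.powTilde n (X.E.powMap V.W.incl n x) := fun n x => by
    rw [LinearIsometryEquiv.symm_apply_eq, h.map_powTilde]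
  have hW : V.W.incl.IsIsometric := V.W.inner_incl
  -- The symbols are `Θᵢ(ξ) = Φ V⁽ⁱ⁾(ξ)|_W`; the conjugation relations hold by definition, and the
  -- multiplier identities remain.
  refine ⟨V.conj Φ h.map_σ h.symm_map_σ, V.V₁.conj hW h.isIsometric_hom,
    V.V₂.conj hW h.isIsometric_hom, fun _ _ => rfl, fun _ _ => rfl,
    fun ξ n x => ?_, fun ξ n x => ?_⟩
  · change Φ (V.V₁ ξ (Φ.symm (X.E.powShift V.W.toRep n x))) = _
    rw [hsymm, IsoCov.conj_tilde, Corr.powMap_comp, Corr.powMap_comp]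
    have h1 : V.V₁ ξ (V.prod.powTilde n (X.E.powMap V.W.incl n x)) =
        V.V₁.tilde (X.E₁.map (V.prod.powTilde n) (X.E₁.map (X.E.powMap V.W.incl n)
          (X.E₁.tmul _ ξ x))) := by
      rw [Corr.map_tmul, Corr.map_tmul, IsoCov.tilde_tmul]
    rw [h1]
    -- Three moves: `Ṽ⁽¹⁾` past `Ṽₙ` on `H`, the inclusion of `W` past the flip, and `Φ` past `Ṽₙ`,
    -- which becomes `S̃ₙ`.
    have h2 : h.hom.comp ((V.V₁.tilde.comp (X.E₁.map (V.prod.powTilde n))).comp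
          (X.E₁.map (X.E.powMap V.W.incl n))) =
        ((X.E.shift V.W.toRep).powTilde n).comp (((X.E.powMap h.hom n).comp
          ((X.E.powMap V.V₁.tilde n).comp (X.E.powMap (X.E₁.map V.W.incl) n))).comp
            (X.flipPow₁ V.W.toRep n)) := by
      rw [powTilde_flipPow₁, Hom.comp_assoc, X.flipPow₁_map, Hom.comp_assoc, ← Hom.comp_assoc,
        h.hom_comp_powTilde]
      rfl
    exact congrArg (fun T => T (X.E₁.tmul _ ξ x)) h2
  · change Φ (V.V₂ ξ (Φ.symm (X.E.powShift V.W.toRep n x))) = _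
    rw [hsymm, IsoCov.conj_tilde, Corr.powMap_comp, Corr.powMap_comp]
    have h1 : V.V₂ ξ (V.prod.powTilde n (X.E.powMap V.W.incl n x)) =
        V.V₂.tilde (X.E₂.map (V.prod.powTilde n) (X.E₂.map (X.E.powMap V.W.incl n)
          (X.E₂.tmul _ ξ x))) := by
      rw [Corr.map_tmul, Corr.map_tmul, IsoCov.tilde_tmul]
    rw [h1]
    have h2 : h.hom.comp ((V.V₂.tilde.comp (X.E₂.map (V.prod.powTilde n))).comp
          (X.E₂.map (X.E.powMap V.W.incl n))) =
        ((X.E.shift V.W.toRep).powTilde n).comp (((X.E.powMap h.hom n).comp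
          ((X.E.powMap V.V₂.tilde n).comp (X.E.powMap (X.E₂.map V.W.incl) n))).comp
            (X.flipPow₂ V.W.toRep n)) := by
      rw [powTilde_flipPow₂, Hom.comp_assoc, X.flipPow₂_map, Hom.comp_assoc, ← Hom.comp_assoc,
        h.hom_comp_powTilde]
      rfl
    exact congrArg (fun T => T (X.E₂.tmul _ ξ x)) h2

end IsWold

namespace IsBCL

variable {M : IsoRep X V.model} {Θ₁ : IsoCov X.E₁ V.W.toRep V.model}
  {Θ₂ : IsoCov X.E₂ V.W.toRep V.model}

/-- For `n = 0` the flip and `S̃₀` are identities, so `M_Θ(ξ) w = Θ(ξ) w` on the vacuum summand. The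
symbol is thus determined by `M`, and through it by `V` and `Φ`. -/
theorem symbol₁_eq (hM : V.IsBCL Φ M Θ₁ Θ₂) (h : V.IsWold Φ) :
    Θ₁.tilde = h.hom.comp (V.V₁.tilde.comp (X.E₁.map V.W.incl)) :=
  X.E₁.tensor_hom_ext fun ξ w => by
    rw [Hom.comp_apply, Hom.comp_apply, Corr.map_tmul]
    have h1 : M.V₁ ξ (X.E.powShift V.W.toRep 0 w) = Θ₁.tilde (X.E₁.tmul _ ξ w) :=
      hM.multiplier₁ ξ 0 w
    have h2 : Φ (V.W.incl w) = X.E.powShift V.W.toRep 0 w := h.map_powTilde 0 w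
    refine h1.symm.trans ?_
    rw [← h2, ← hM.conj₁, Φ.symm_apply_apply, IsoCov.tilde_tmul]
    rfl

theorem symbol₂_eq (hM : V.IsBCL Φ M Θ₁ Θ₂) (h : V.IsWold Φ) :
    Θ₂.tilde = h.hom.comp (V.V₂.tilde.comp (X.E₂.map V.W.incl)) :=
  X.E₂.tensor_hom_ext fun ξ w => by
    rw [Hom.comp_apply, Hom.comp_apply, Corr.map_tmul]
    have h1 : M.V₂ ξ (X.E.powShift V.W.toRep 0 w) = Θ₂.tilde (X.E₂.tmul _ ξ w) :=
      hM.multiplier₂ ξ 0 w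
    have h2 : Φ (V.W.incl w) = X.E.powShift V.W.toRep 0 w := h.map_powTilde 0 w
    refine h1.symm.trans ?_
    rw [← h2, ← hM.conj₂, Φ.symm_apply_apply, IsoCov.tilde_tmul]
    rfl

end IsBCL

end IsoRep

end

/-! ### The unitaries `U'` and `U` and the values of `Ṽ⁽ⁱ⁾` on the two summands. -/

section

variable {A : Type v} [NonUnitalCStarAlgebra A] [PartialOrder A] [StarOrderedRing A]

open HilbertRep

namespace IsoRep

variable {X : ProductSystem.{u} A} {H : HilbertRep.{u} A} (V : IsoRep X H)

/-- The unitary `Ṽ⁽¹⁾ : E₁ ⊗ W₂ → L₁`. -/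
noncomputable def u₁ : Hom (X.E₁ ⊗ᴴ V.W₂.toRep) V.L₁.toRep := V.V₁.toImage V.W₂

/-- The unitary `Ṽ⁽²⁾ : E₂ ⊗ W₁ → L₂`. -/
noncomputable def u₂ : Hom (X.E₂ ⊗ᴴ V.W₁.toRep) V.L₂.toRep := V.V₂.toImage V.W₁

theorem isIsometric_u₁ : V.u₁.IsIsometric := V.V₁.isIsometric_toImage V.W₂

theorem isIsometric_u₂ : V.u₂.IsIsometric := V.V₂.isIsometric_toImage V.W₁

theorem u₁_surjective : Function.Surjective V.u₁ := V.V₁.toImage_surjective V.W₂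

theorem u₂_surjective : Function.Surjective V.u₂ := V.V₂.toImage_surjective V.W₁

theorem map_adjoint_map_u₁ (x) : X.E₂.map V.V₁.tilde.adjoint (X.E₂.map V.L₁.incl (X.E₂.map V.u₁ x)) =
    X.E₂.map (X.E₁.map V.W₂.incl) x := by
  rw [Corr.map_map, Corr.map_map]
  exact congrArg (fun T => X.E₂.map T x) (V.V₁.adjoint_comp_incl_comp_toImage V.W₂)

theorem map_adjoint_map_u₂ (x) : X.E₁.map V.V₂.tilde.adjoint (X.E₁.map V.L₂.incl (X.E₁.map V.u₂ x)) =
    X.E₁.map (X.E₂.map V.W₁.incl) x := by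
  rw [Corr.map_map, Corr.map_map]
  exact congrArg (fun T => X.E₁.map T x) (V.V₂.adjoint_comp_incl_comp_toImage V.W₁)

/-- The unitary `I ⊗ Ṽ⁽²⁾ : E ⊗ W₁ → E₁ ⊗ L₂`. -/
noncomputable def prodEquiv₁ : (X.E ⊗ᴴ V.W₁.toRep : HilbertRep.{u} A) ≃ₗᵢ[ℂ]
    (X.E₁ ⊗ᴴ V.L₂.toRep : HilbertRep.{u} A) :=
  ((X.E₁.map V.u₂).comp (X.E₁.assoc X.E₂ V.W₁.toRep)).toEquiv
    ((X.E₁.isIsometric_map V.isIsometric_u₂).comp (X.E₁.inner_assoc X.E₂ _))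
    ((X.E₁.map_surjective V.isIsometric_u₂ V.u₂_surjective).comp (X.E₁.assoc_surjective X.E₂ _))

theorem prodEquiv₁_apply (x) :
    V.prodEquiv₁ x = X.E₁.map V.u₂ (X.E₁.assoc X.E₂ V.W₁.toRep x) := rfl

/-- The unitary `I ⊗ Ṽ⁽¹⁾ : E₂ ⊗ E₁ ⊗ W₂ → E₂ ⊗ L₁`. -/
noncomputable def prodEquiv₂ : (X.E₂ ⊗ᴴ X.E₁ ⊗ᴴ V.W₂.toRep : HilbertRep.{u} A) ≃ₗᵢ[ℂ]
    (X.E₂ ⊗ᴴ V.L₁.toRep : HilbertRep.{u} A) :=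
  (X.E₂.map V.u₁).toEquiv (X.E₂.isIsometric_map V.isIsometric_u₁)
    (X.E₂.map_surjective V.isIsometric_u₁ V.u₁_surjective)

theorem prodEquiv₂_apply (x) : V.prodEquiv₂ x = X.E₂.map V.u₁ x := rfl

/-- The unitary `U'`. -/
noncomputable def unitary₁ : HilbertRep.Sum (X.E₁ ⊗ᴴ V.W₂.toRep) (X.E₁ ⊗ᴴ V.L₂.toRep) ≃ₗᵢ[ℂ]
    HilbertRep.Sum V.L₁.toRep (X.E ⊗ᴴ V.W₁.toRep) :=
  -- The second entry is the inverse of `I ⊗ Ṽ⁽²⁾ : E ⊗ W₁ → E₁ ⊗ L₂`, which equals `I ⊗ Ṽ⁽²⁾*` on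
  -- this subspace.
  LinearIsometryEquiv.withLpProdCongr 2 (V.u₁.toEquiv V.isIsometric_u₁ V.u₁_surjective)
    V.prodEquiv₁.symm

/-- Used from right to left: rewriting `z.snd` as an image under `I ⊗ Ṽ⁽²⁾` leaves only the forward
unitary to be computed with. -/
theorem prodEquiv₁_unitary₁_snd (z) : V.prodEquiv₁ (V.unitary₁ z).snd = z.snd :=
  V.prodEquiv₁.apply_symm_apply z.snd

/-- The unitary `U`. -/
noncomputable def unitary₂ : HilbertRep.Sum (X.E₂ ⊗ᴴ V.W₁.toRep) (X.E₂ ⊗ᴴ V.L₁.toRep) ≃ₗᵢ[ℂ]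
    HilbertRep.Sum V.L₂.toRep (X.E₂ ⊗ᴴ X.E₁ ⊗ᴴ V.W₂.toRep) :=
  LinearIsometryEquiv.withLpProdCongr 2 (V.u₂.toEquiv V.isIsometric_u₂ V.u₂_surjective)
    V.prodEquiv₂.symm

theorem prodEquiv₂_unitary₂_snd (z) : V.prodEquiv₂ (V.unitary₂ z).snd = z.snd :=
  V.prodEquiv₂.apply_symm_apply z.snd

/-- On the summand `E₁ ⊗ W₂` the values stay in `W`, where `Φ` is the vacuum embedding. -/
theorem tilde₁_map_i₂ (x) : V.V₁.tilde (X.E₁.map V.W.incl (X.E₁.map V.i₂ x)) =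
    V.W.incl (V.j₁ (V.u₁ x)) := by
  rw [Corr.map_map]; rfl

theorem tilde₂_map_i₁ (x) : V.V₂.tilde (X.E₂.map V.W.incl (X.E₂.map V.i₁ x)) =
    V.W.incl (V.j₂ (V.u₂ x)) := by
  rw [Corr.map_map]; rfl

/-- On the summand `E₁ ⊗ L₂` the operator `Ṽ⁽²⁾` hidden in `L₂` combines with `Ṽ⁽¹⁾` to `Ṽ`. -/
theorem tilde₁_map_prodEquiv₁ (x) :
    V.V₁.tilde (X.E₁.map V.W.incl (X.E₁.map V.j₂ (V.prodEquiv₁ x))) =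
      V.prod.tilde (X.E.map V.W.incl (X.E.map V.i₁ x)) := by
  rw [prodEquiv₁_apply, Corr.map_map, Corr.map_map, Corr.map_map]
  have h1 : (V.W.incl.comp V.j₂).comp V.u₂ = V.V₂.tilde.comp (X.E₂.map V.W₁.incl) := rfl
  have h2 : V.W.incl.comp V.i₁ = V.W₁.incl := rfl
  have h3 := V.prod_tilde_map_assoc_adjoint V.W₁.incl
  rw [h1, h2]
  refine (congrArg (fun T => T (X.E₁.assoc X.E₂ V.W₁.toRep x)) h3).symm.trans ?_
  exact congrArg (fun y => V.prod.tilde (X.E.map V.W₁.incl y))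
    (Hom.IsIsometric.adjoint_apply (X.E₁.inner_assoc X.E₂ V.W₁.toRep) x)

theorem map_swap_assoc_adjoint {K L : HilbertRep.{u} A} (T : Hom K L) (x) :
    X.E.map T (X.t.map K ((X.E₂.assoc X.E₁ K).adjoint x)) =
      X.t.map L ((X.E₂.assoc X.E₁ L).adjoint (X.E₂.map (X.E₁.map T) x)) := by
  have h1 := congrArg (fun S => X.t.map L (S x)) (X.E₂.map_assoc_adjoint X.E₁ T)
  have h2 := congrArg (fun S => S ((X.E₂.assoc X.E₁ K).adjoint x)) (X.t.map_map T)
  exact h2.symm.trans h1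

/-- Here the factors combine in the order `Ṽ⁽²⁾ (I ⊗ Ṽ⁽¹⁾)`, which is `Ṽ` only after `t₂₁`; this is
the origin of `t₂₁` in the second symbol. -/
theorem tilde₂_map_prodEquiv₂ (x) :
    V.V₂.tilde (X.E₂.map V.W.incl (X.E₂.map V.j₁ (V.prodEquiv₂ x))) =
      V.prod.tilde (X.E.map V.W.incl (X.t.map V.W.toRep ((X.E₂.assoc X.E₁ V.W.toRep).adjoint
        (X.E₂.map (X.E₁.map V.i₂) x)))) := by
  rw [prodEquiv₂_apply, Corr.map_map, Corr.map_map, map_swap_assoc_adjoint, Corr.map_map,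
    ← Corr.map_comp]
  have h1 : (V.W.incl.comp V.j₁).comp V.u₁ = V.V₁.tilde.comp (X.E₁.map V.W₂.incl) := rfl
  have h2 : V.W.incl.comp V.i₂ = V.W₂.incl := rfl
  have h3 := congrArg (fun T => T (X.E₂.map (X.E₁.map V.W₂.incl) x)) V.prod_tilde_swap
  rw [h1, h2, Corr.map_comp]
  exact h3.symm

end IsoRep

end

/-- The formulas are claimed for every Wold unitary and every BCL-representation, which is why the
uniqueness in `symbol₁_eq` and `symbol₂_eq` is needed. `J'` and `J` make the identifications of `Eᵢ
⊗ W` explicit. The conditions on the components of `U'` and `U` determine these unitaries, since the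
maps applied to the components are injective. -/
theorem theorem2p4 {A : Type v} [NonUnitalCStarAlgebra A] [PartialOrder A] [StarOrderedRing A]
    (X : ProductSystem.{u} A) (H : HilbertRep.{u} A) (V : IsoRep X H) (hV : V.prod.IsPure) :
    (∃ Φ : H ≃ₗᵢ[ℂ] V.model, V.IsWold Φ) ∧
    ∀ Φ : H ≃ₗᵢ[ℂ] V.model, V.IsWold Φ →
      (∃ M Θ₁ Θ₂, V.IsBCL Φ M Θ₁ Θ₂) ∧
      ∀ M Θ₁ Θ₂, V.IsBCL Φ M Θ₁ Θ₂ →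
        (∃ (J' : HilbertRep.Sum (X.E₁ ⊗ᴴ V.W₂.toRep) (X.E₁ ⊗ᴴ V.L₂.toRep) ≃ₗᵢ[ℂ]
              (X.E₁ ⊗ᴴ V.W.toRep : HilbertRep.{u} A))
            (U' : HilbertRep.Sum (X.E₁ ⊗ᴴ V.W₂.toRep) (X.E₁ ⊗ᴴ V.L₂.toRep) ≃ₗᵢ[ℂ]
              HilbertRep.Sum V.L₁.toRep (X.E ⊗ᴴ V.W₁.toRep)),
          (∀ z, J' z = X.E₁.map V.i₂ z.fst + X.E₁.map V.j₂ z.snd) ∧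
          (∀ z, V.L₁.incl (U' z).fst = V.V₁.tilde (X.E₁.map V.W₂.incl z.fst)) ∧
          (∀ z, X.E₁.assoc X.E₂ H (X.E.map V.W₁.incl (U' z).snd) =
            X.E₁.map V.V₂.tilde.adjoint (X.E₁.map V.L₂.incl z.snd)) ∧
          ∀ z, Θ₁.tilde (J' z) =
            X.E.vac V.W.toRep (V.i₁.coproj (V.j₁ (U' z).fst)) +
            (X.E.shift V.W.toRep).tilde (X.E.map (X.E.vac V.W.toRep)
              (X.E.map V.i₁.proj (X.E.map V.i₁ (U' z).snd)))) ∧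
        (∃ (J : HilbertRep.Sum (X.E₂ ⊗ᴴ V.W₁.toRep) (X.E₂ ⊗ᴴ V.L₁.toRep) ≃ₗᵢ[ℂ]
              (X.E₂ ⊗ᴴ V.W.toRep : HilbertRep.{u} A))
            (U : HilbertRep.Sum (X.E₂ ⊗ᴴ V.W₁.toRep) (X.E₂ ⊗ᴴ V.L₁.toRep) ≃ₗᵢ[ℂ]
              HilbertRep.Sum V.L₂.toRep (X.E₂ ⊗ᴴ X.E₁ ⊗ᴴ V.W₂.toRep)),
          (∀ z, J z = X.E₂.map V.i₁ z.fst + X.E₂.map V.j₁ z.snd) ∧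
          (∀ z, V.L₂.incl (U z).fst = V.V₂.tilde (X.E₂.map V.W₁.incl z.fst)) ∧
          (∀ z, X.E₂.map (X.E₁.map V.W₂.incl) (U z).snd =
            X.E₂.map V.V₁.tilde.adjoint (X.E₂.map V.L₁.incl z.snd)) ∧
          ∀ z, Θ₂.tilde (J z) =
            X.E.vac V.W.toRep (V.i₂.coproj (V.j₂ (U z).fst)) +
            (X.E.shift V.W.toRep).tilde (X.E.map (X.E.vac V.W.toRep)
              (X.E.map V.i₂.proj (X.t.map V.W.toRep
                ((X.E₂.assoc X.E₁ V.W.toRep).adjoint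
                  (X.E₂.map (X.E₁.map V.i₂) (U z).snd)))))) := by
  -- `E₁ ⊗ W` is split along `W = W₂ ⊕ L₂` and `E₂ ⊗ W` along `W = W₁ ⊕ L₁`; the projections in the
  -- formulas belong to the opposite splittings.
  refine ⟨V.exists_isWold hV, fun Φ h => ⟨h.exists_isBCL, fun M Θ₁ Θ₂ hM =>
    ⟨⟨(X.E₁.isOrthoSum_map V.isOrthoSum_i₂_j₂).equiv, V.unitary₁, fun z => rfl, fun z => rfl,
        fun z => ?_, fun z => ?_⟩,
      ⟨(X.E₂.isOrthoSum_map V.isOrthoSum_i₁_j₁).equiv, V.unitary₂, fun z => rfl, fun z => rfl,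
        fun z => ?_, fun z => ?_⟩⟩⟩⟩
  · rw [← V.prodEquiv₁_unitary₁_snd z, V.prodEquiv₁_apply, V.map_adjoint_map_u₂]
    exact congrArg (fun T => T (V.unitary₁ z).snd) (X.E₁.assoc_map X.E₂ V.W₁.incl)
  -- Both projections act trivially on their arguments and disappear; the two summands are then
  -- compared separately.
  · rw [HilbertRep.Hom.IsOrthoSum.equiv_apply, map_add Θ₁.tilde.toCLM,
      V.isOrthoSum_i₁_j₁.coproj_apply, X.E.map_map V.i₁.proj,
      HilbertRep.Hom.IsIsometric.proj_comp V.isOrthoSum_i₁_j₁.left, hM.symbol₁_eq h]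
    congr 1
    · exact (congrArg Φ (V.tilde₁_map_i₂ z.fst)).trans
        (congrArg (fun T => T (V.j₁ (V.u₁ z.fst))) h.hom_comp_incl)
    · rw [← V.prodEquiv₁_unitary₁_snd z]
      refine (congrArg Φ (V.tilde₁_map_prodEquiv₁ _)).trans ?_
      exact congrArg (fun T => T (X.E.map V.i₁ (V.unitary₁ z).snd)) h.hom_prod_tilde
  · rw [← V.prodEquiv₂_unitary₂_snd z, V.prodEquiv₂_apply, V.map_adjoint_map_u₁]
  -- `P_{W₂}` stands to the left of `t₂₁ ⊗ I`; naturality moves it to the right, next to the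
  -- inclusion of `W₂`, where it disappears.
  · rw [HilbertRep.Hom.IsOrthoSum.equiv_apply, map_add Θ₂.tilde.toCLM,
      V.isOrthoSum_i₂_j₂.coproj_apply, IsoRep.map_swap_assoc_adjoint, X.E₂.map_map,
      ← Corr.map_comp, HilbertRep.Hom.IsIsometric.proj_comp V.isOrthoSum_i₂_j₂.left,
      hM.symbol₂_eq h]
    congr 1
    · exact (congrArg Φ (V.tilde₂_map_i₁ z.fst)).trans
        (congrArg (fun T => T (V.j₂ (V.u₂ z.fst))) h.hom_comp_incl)
    · rw [← V.prodEquiv₂_unitary₂_snd z]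
      refine (congrArg Φ (V.tilde₂_map_prodEquiv₂ _)).trans ?_
      exact congrArg (fun T => T (X.t.map V.W.toRep ((X.E₂.assoc X.E₁ V.W.toRep).adjoint
        (X.E₂.map (X.E₁.map V.i₂) (V.unitary₂ z).snd)))) h.hom_prod_tilde
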